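/- Let $d\ge 1$, let $L\ge 3$ be an integer and put $P=L/2$. Let $f:\mathbb{R}^{d\times d}\to\mathbb{R}$ be convex and $\mathcal{C}^3$-smooth with $f(W)=f(W^\top)$ for all $W$, and let $\nabla f$ be its gradient with respect to $\langle A,B\rangle=\mathrm{Tr}(AB^\top)$. Consider the end-to-end dynamics of depth-$L$ matrix factorization $$\frac{\mathrm{d}W}{\mathrm{d}t}=g(W):=-\sum_{i=0}^{L-1}(WW^\top)^{\frac{i}{L}}\,\nabla f(W)\,(W^\top W)^{1-\frac{i+1}{L}}$$ (where $A^0=I$). Assume that for every positive semidefinite $W_0$ it has a solution on $[0,\infty)$ with $W(0)=W_0$, and write $\phi(W_0,t)$ for its value at time $t\ge 0$. Let $\lambda_1(A)\ge\lambda_2(A)\ge\cdots$ denote the eigenvalues of a symmetric matrix $A$, and suppose that $\mu_1:=\lambda_1(-\nabla f(0))$ satisfies $$\|\nabla f(0)\|_2=\mu_1>\max\{\lambda_2(-\nabla f(0)),0\}$$ (the condition on $\lambda_2$ being void if $d=1$), where $\|\cdot\|_2$ is the spectral norm. Let $v$ be a unit eigenvector of $-\nabla f(0)$ for the eigenvalue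 $\mu_1$ and, for $t\in\mathbb{R}$, let $$\overline{W}(t):=\lim_{\alpha\to 0^+}\phi\Big(\alpha vv^\top,\ \tfrac{\alpha^{-(1-1/P)}}{2\mu_1(P-1)}+t\Big).$$ Suppose that $\overline{W}(\infty):=\lim_{t\to+\infty}\overline{W}(t)$ exists and minimizes $f$ over the set of positive semidefinite $d\times d$ matrices of rank at most $1$. Suppose also that, with $W_0=\overline{W}(\infty)$ and $\mathcal{T}:=\{VW_0^\top+W_0V^\top: V\in\mathbb{R}^{d\times d}\}$, the Jacobian of $g$ at $W_0$ maps $\mathcal{T}$ to itself and its restriction to $\mathcal{T}$ is diagonalizable with all eigenvalues negative real numbers. Then the limit defining $\overline{W}(t)$ exists for every $t\in\mathbb{R}$, and $$\inf_{t\ge 0}\big\|\phi(\alpha I,t)-\overline{W}(\infty)\big\|_F=O(\alpha)\qquad\text{as }\alpha\to 0^+ .$$ -/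

import Mathlib

open Filter Topology

/-- Real power `A ^ s` of a symmetric positive semidefinite matrix, by functional calculus
(the eigenvalues are raised to the power `s`; in particular `A ^ 0 = 1`). -/
noncomputable def psdPow {d : ℕ} (A : Matrix (Fin d) (Fin d) ℝ) (s : ℝ) : Matrix (Fin d) (Fin d) ℝ :=
  cfc (fun x : ℝ => x ^ s) A

/-- The spectral norm (largest singular value) of a square matrix. -/
noncomputable def spectralNorm₂ {d : ℕ} (A : Matrix (Fin d) (Fin d) ℝ) : ℝ :=
  ‖Matrix.toEuclideanCLM (n := Fin d) (𝕜 := ℝ) A‖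

/-- The eigenvalues of a symmetric matrix with multiplicity, in decreasing order:
`eigDesc A 0` is the largest one (and `0` is used if `A` is not symmetric). -/
noncomputable def eigDesc {d : ℕ} (A : Matrix (Fin d) (Fin d) ℝ) (k : Fin d) : ℝ :=
  open Classical in
  if h : A.IsHermitian then h.eigenvalues₀ (Fin.cast (Fintype.card_fin d).symm k) else 0

attribute [local instance] Matrix.frobeniusNormedAddCommGroup Matrix.frobeniusNormedSpace

/-- The gradient of `f` for the inner product `⟨A, B⟩ = Tr (A Bᵀ)`: the matrix of
partial derivatives. -/
noncomputable def matGrad {d : ℕ} (f : Matrix (Fin d) (Fin d) ℝ → ℝ) (W : Matrix (Fin d) (Fin d) ℝ) :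
    Matrix (Fin d) (Fin d) ℝ :=
  Matrix.of fun i j => fderiv ℝ f W (Matrix.single i j 1)

/-- If `f (Wᵀ) = f W` for all `W`, then the gradient at a symmetric matrix is symmetric, so that
`eigDesc` of it consists of genuine eigenvalues. -/
theorem matGrad_isHermitian {d : ℕ} {f : Matrix (Fin d) (Fin d) ℝ → ℝ}
    (hf : Differentiable ℝ f) (hsym : ∀ W, f W.transpose = f W)
    {W : Matrix (Fin d) (Fin d) ℝ} (hW : W.transpose = W) : (matGrad f W).IsHermitian := by
  let T : Matrix (Fin d) (Fin d) ℝ →L[ℝ] Matrix (Fin d) (Fin d) ℝ :=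
    LinearMap.toContinuousLinearMap (Matrix.transposeLinearEquiv (Fin d) (Fin d) ℝ ℝ).toLinearMap
  have hT : ∀ X, T X = X.transpose := fun X => rfl
  have h1 : HasFDerivAt (fun X => f (T X)) ((fderiv ℝ f (T W)).comp T) W :=
    (hf (T W)).hasFDerivAt.comp W T.hasFDerivAt
  have h2 : (fun X => f (T X)) = f := funext fun X => by rw [hT, hsym]
  rw [h2, hT, hW] at h1
  have h3 := h1.fderiv
  ext i j
  have h4 := congrArg (fun l => l (Matrix.single i j (1 : ℝ))) h3
  simp only [ContinuousLinearMap.comp_apply, hT, Matrix.transpose_single] at h4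
  simp only [matGrad, Matrix.conjTranspose_apply, Matrix.of_apply, star_trivial]
  exact h4.symm

/-- The vector field of the end-to-end dynamics of depth-`L` matrix factorization,
`-∑_{i=0}^{L-1} (W Wᵀ)^{i/L} ∇f(W) (Wᵀ W)^{1-(i+1)/L}`. -/
noncomputable def endToEndField {d : ℕ} (f : Matrix (Fin d) (Fin d) ℝ → ℝ) (L : ℕ)
    (W : Matrix (Fin d) (Fin d) ℝ) : Matrix (Fin d) (Fin d) ℝ :=
  -∑ i ∈ Finset.range L,
    psdPow (W * W.transpose) ((i : ℝ) / L) * matGrad f W *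
      psdPow (W.transpose * W) (1 - ((i : ℝ) + 1) / L)

/-- `W` solves the end-to-end dynamics on `[0, ∞)` with `W 0 = W₀`. -/
def IsEndToEndSolution {d : ℕ} (f : Matrix (Fin d) (Fin d) ℝ → ℝ) (L : ℕ)
    (W₀ : Matrix (Fin d) (Fin d) ℝ) (W : ℝ → Matrix (Fin d) (Fin d) ℝ) : Prop :=
  W 0 = W₀ ∧
    ∀ t, 0 ≤ t → HasDerivWithinAt W (endToEndField f L (W t)) (Set.Ici 0) t

/-- `flow f L W₀ t` is the value at time `t ≥ 0` of the solution of the end-to-end dynamics that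
starts at `W₀` (meaningful whenever that solution exists on `[0, ∞)`). -/
noncomputable def flow {d : ℕ} (f : Matrix (Fin d) (Fin d) ℝ → ℝ) (L : ℕ)
    (W₀ : Matrix (Fin d) (Fin d) ℝ) : ℝ → Matrix (Fin d) (Fin d) ℝ :=
  Classical.epsilon (IsEndToEndSolution f L W₀)

/-- The rank-one trajectory `t ↦ φ(α v vᵀ, α^{-(1-1/P)} / (2 μ (P-1)) + t)`, `P = L / 2`. -/
noncomputable def glrlApprox {d : ℕ} (f : Matrix (Fin d) (Fin d) ℝ → ℝ) (L : ℕ) (μ : ℝ) (v : Fin d → ℝ)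
    (α t : ℝ) : Matrix (Fin d) (Fin d) ℝ :=
  flow f L (α • Matrix.vecMulVec v v)
    (α ^ (-(1 - 1 / ((L : ℝ) / 2))) / (2 * μ * ((L : ℝ) / 2 - 1)) + t)

/-- The trajectory of deep greedy low-rank learning: the limit of `glrlApprox` as `α → 0⁺`. -/
noncomputable def glrlTrajectory {d : ℕ} (f : Matrix (Fin d) (Fin d) ℝ → ℝ) (L : ℕ) (μ : ℝ) (v : Fin d → ℝ)
    (t : ℝ) : Matrix (Fin d) (Fin d) ℝ :=
  limUnder (𝓝[>] (0 : ℝ)) fun α => glrlApprox f L μ v α t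

/-- The positive semidefinite matrices of rank at most `r`. -/
def psdRankLE (d r : ℕ) : Set (Matrix (Fin d) (Fin d) ℝ) :=
  {W | W.PosSemidef ∧ W.rank ≤ r}

/-- The tangent space `{V W₀ᵀ + W₀ Vᵀ}` at `W₀` of the manifold of symmetric matrices whose rank
is that of `W₀`. -/
def rankTangent {d : ℕ} (W₀ : Matrix (Fin d) (Fin d) ℝ) :
    Submodule ℝ (Matrix (Fin d) (Fin d) ℝ) where
  carrier := {X | ∃ V : Matrix (Fin d) (Fin d) ℝ, X = V * W₀.transpose + W₀ * V.transpose}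
  zero_mem' := ⟨0, by simp⟩
  add_mem' := by
    rintro _ _ ⟨V, rfl⟩ ⟨V', rfl⟩
    exact ⟨V + V', by rw [Matrix.transpose_add, add_mul, mul_add]; abel⟩
  smul_mem' := by
    rintro c _ ⟨V, rfl⟩
    exact ⟨c • V, by
      rw [Matrix.transpose_smul, Matrix.smul_mul, Matrix.mul_smul, smul_add]⟩

/-- The Jacobian of the end-to-end vector field at `W₀` maps the tangent space `rankTangent W₀`
to itself, and its restriction there is diagonalizable over `ℝ` with negative eigenvalues only:
the tangent space has a basis of eigenvectors with negative eigenvalues. (When `W₀ ≠ 0` this forces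
the vector field to be differentiable at `W₀`, since otherwise `fderiv` is zero.) -/
def TangentStable {d : ℕ} (f : Matrix (Fin d) (Fin d) ℝ → ℝ) (L : ℕ)
    (W₀ : Matrix (Fin d) (Fin d) ℝ) : Prop :=
  ∃ (b : Module.Basis (Fin (Module.finrank ℝ (rankTangent W₀))) ℝ (rankTangent W₀))
    (c : Fin (Module.finrank ℝ (rankTangent W₀)) → ℝ),
    ∀ i, c i < 0 ∧ fderiv ℝ (endToEndField f L) W₀ (b i) = c i • (b i : Matrix _ _ ℝ)

section Main
attribute [local instance] Matrix.frobeniusNormedRing Matrix.frobeniusNormedAlgebra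
open Matrix

/-! Put p = L/2, κ = 1 - 2/L = 1 - 1/p, A = -∇f(0), ε = α^(2/L).

Root equation. Along suitable solutions M = W^(1/p) is positive semidefinite and solves M' = -(∇f(W)
W + W ∇f(W)) with W = M^p. Since p > 1, this field is locally Lipschitz on the semidefinite cone,
while the fractional powers in the original field are singular at 0. Solutions are not assumed
symmetric, so their form has to be derived: from a positive definite start the determinant decays at
most exponentially; from a rank-one start a defect measuring higher rank obeys a linear Gronwall
inequality; symmetry follows by another Gronwall argument (`isRootFlow_of_posDef`,
`isRootFlow_of_rankOne`).

Escape from 0. For small M the equation is M' ≈ A M^p + M^p A. Its top eigenvalue m satisfies m' =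
2μm^p and, in the shifted time, blows up at time 0; the spectral gap keeps the other eigenvalues
O(ε). Because the spectral norm of A is exactly μ, the nonlinear error is O(m^(p+1))
(`exists_tracking_bound`), and two orbits separate at most like m^p (`exists_separation_bound`). The
orbits of αvvᵀ and αI differ by O(m^(p+1) + ε). At the time when m^(p+1) = ε this is O(ε), and later
amplification by a factor of order m^(-p) leaves only O(m), which tends to 0. The same comparison
makes the rank-one orbits a Cauchy family. Continuous dependence then carries both families to one
common limit at every t (`exists_tendsto_flow`).

The rate. The comparison above only gives ε^(1/(p+1)). The rate O(α) comes from q = tr W - tr(W²)/tr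
W, which is comparable to the mass outside the top eigenvalue. At the matching time M is O(ε)-close
to a multiple of vvᵀ, hence q = O(ε^p) = O(α). As q' ≤ C q^(1+κ) on bounded sets, q remains O(α)
over times much shorter than α^(-κ) (`exists_tailMass_le_two_mul`, `exists_tailMass_flow_le`).

The end. The minimizer is w uuᵀ with w > 0, and ∇f annihilates u there, so it is stationary. In an
eigenbasis of the Jacobian the tangential coordinates of the deviation have a sum of squares V with
V' ≤ -cV + Kq², and the normal part is controlled by q up to a quadratic term (`exists_lyapunov`).
Once the orbit of αI, following the common limit, is close to the minimizer, a further time (2/c)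
log(1/α) makes V = O(α²) while q is still O(α), so the distance is O(α) (`exists_final_phase`). -/

/-! ### Orthogonal diagonalization and functional calculus -/

theorem norm_sq_eq_sum {d : ℕ} (A : Matrix (Fin d) (Fin d) ℝ) : ‖A‖ ^ 2 = ∑ i, ∑ j, A i j ^ 2 := by
  have h0 : 0 ≤ ∑ i, ∑ j, A i j ^ 2 := by positivity
  rw [Matrix.frobenius_norm_def, ← Real.sqrt_eq_rpow]
  simp only [Real.norm_eq_abs, Real.rpow_two, sq_abs]
  exact Real.sq_sqrt h0

theorem norm_sq_eq_trace {d : ℕ} (A : Matrix (Fin d) (Fin d) ℝ) : ‖A‖ ^ 2 = (Aᵀ * A).trace := by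
  rw [norm_sq_eq_sum, Finset.sum_comm]
  simp [Matrix.trace, Matrix.mul_apply, sq]

theorem norm_orthogonal_mul {d : ℕ} {U : Matrix (Fin d) (Fin d) ℝ} (hU : Uᵀ * U = 1)
    (A : Matrix (Fin d) (Fin d) ℝ) : ‖U * A‖ = ‖A‖ := by
  rw [← sq_eq_sq₀ (norm_nonneg _) (norm_nonneg _), norm_sq_eq_trace, norm_sq_eq_trace,
    Matrix.transpose_mul, Matrix.mul_assoc, ← Matrix.mul_assoc Uᵀ, hU, Matrix.one_mul]

theorem norm_mul_orthogonal_transpose {d : ℕ} {U : Matrix (Fin d) (Fin d) ℝ} (hU : Uᵀ * U = 1)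
    (A : Matrix (Fin d) (Fin d) ℝ) : ‖A * Uᵀ‖ = ‖A‖ := by
  rw [← Matrix.frobenius_norm_transpose, Matrix.transpose_mul, Matrix.transpose_transpose,
    norm_orthogonal_mul hU, Matrix.frobenius_norm_transpose]

/-- `A = U diag(a) Uᵀ` with `U` orthogonal. -/
structure Diagonalizes {d : ℕ} (A U : Matrix (Fin d) (Fin d) ℝ) (a : Fin d → ℝ) : Prop where
  orth : Uᵀ * U = 1
  eq : A = U * diagonal a * Uᵀ

namespace Diagonalizes
variable {d : ℕ} {A B U V W : Matrix (Fin d) (Fin d) ℝ} {a b : Fin d → ℝ}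

theorem orth' (h : Diagonalizes A U a) : U * Uᵀ = 1 := mul_eq_one_comm.mp h.orth

/-- The entries x of Uᵀ W V satisfy (a i - b j) x i j = 0, so they live where the eigenvalues agree,
and there φ takes equal values. With W = 1 this shows that the functional calculus does not depend
on the diagonalization. -/
theorem intertwine (hA : Diagonalizes A U a) (hB : Diagonalizes B V b) (hW : A * W = W * B)
    (φ : ℝ → ℝ) : U * diagonal (φ ∘ a) * Uᵀ * W = W * (V * diagonal (φ ∘ b) * Vᵀ) := by
  have key : diagonal (φ ∘ a) * (Uᵀ * W * V) = (Uᵀ * W * V) * diagonal (φ ∘ b) := by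
    have h1 : diagonal a * (Uᵀ * W * V) = (Uᵀ * W * V) * diagonal b := by
      calc diagonal a * (Uᵀ * W * V) = (Uᵀ * U) * diagonal a * Uᵀ * W * V := by
            rw [hA.orth]; simp only [Matrix.mul_assoc, Matrix.one_mul]
        _ = Uᵀ * (A * W) * V := by rw [hA.eq]; simp only [Matrix.mul_assoc]
        _ = Uᵀ * W * V * diagonal b * (Vᵀ * V) := by
            rw [hW, hB.eq]; simp only [Matrix.mul_assoc]
        _ = _ := by rw [hB.orth, Matrix.mul_one]
    ext i j
    have h2 := congrFun (congrFun h1 i) j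
    rw [diagonal_mul, mul_diagonal] at h2 ⊢
    simp only [Function.comp]
    by_cases h : a i = b j
    · rw [h, mul_comm]
    · have : (Uᵀ * W * V) i j = 0 := by
        have : (a i - b j) * (Uᵀ * W * V) i j = 0 := by linear_combination h2
        exact (mul_eq_zero.mp this).resolve_left (sub_ne_zero.mpr h)
      rw [this]; ring
  calc U * diagonal (φ ∘ a) * Uᵀ * W = U * diagonal (φ ∘ a) * Uᵀ * W * (V * Vᵀ) := by
        rw [hB.orth', Matrix.mul_one]
    _ = U * (diagonal (φ ∘ a) * (Uᵀ * W * V)) * Vᵀ := by simp only [Matrix.mul_assoc]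
    _ = (U * Uᵀ) * W * (V * diagonal (φ ∘ b) * Vᵀ) := by rw [key]; simp only [Matrix.mul_assoc]
    _ = _ := by rw [hA.orth', Matrix.one_mul]

theorem isHermitian (hA : Diagonalizes A U a) : A.IsHermitian := by
  rw [Matrix.IsHermitian, Matrix.conjTranspose_eq_transpose_of_trivial, hA.eq]
  simp [Matrix.mul_assoc]

theorem exists_of_isHermitian (hA : A.IsHermitian) :
    ∃ U, Diagonalizes A U hA.eigenvalues ∧ ∀ φ : ℝ → ℝ, cfc φ A = U * diagonal (φ ∘ hA.eigenvalues) * Uᵀ := by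
  refine ⟨hA.eigenvectorUnitary, ⟨?_, ?_⟩, ?_⟩
  · have := Unitary.coe_star_mul_self hA.eigenvectorUnitary
    rwa [star_eq_conjTranspose, Matrix.conjTranspose_eq_transpose_of_trivial] at this
  · have := hA.spectral_theorem
    rw [Unitary.conjStarAlgAut_apply, star_eq_conjTranspose,
      Matrix.conjTranspose_eq_transpose_of_trivial] at this
    exact this
  · intro φ
    rw [hA.cfc_eq, Matrix.IsHermitian.cfc, Unitary.conjStarAlgAut_apply,
      star_eq_conjTranspose, Matrix.conjTranspose_eq_transpose_of_trivial]
    rfl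

theorem cfc_eq (hA : Diagonalizes A U a) (φ : ℝ → ℝ) : cfc φ A = U * diagonal (φ ∘ a) * Uᵀ := by
  obtain ⟨V, hV, hφ⟩ := exists_of_isHermitian hA.isHermitian
  have := hV.intertwine hA (W := 1) (by simp) φ
  rw [hφ]; simpa using this

theorem diagonalizes_cfc (hA : Diagonalizes A U a) (φ : ℝ → ℝ) :
    Diagonalizes (cfc φ A) U (φ ∘ a) := ⟨hA.orth, hA.cfc_eq φ⟩

theorem spectrum_eq (hA : Diagonalizes A U a) : spectrum ℝ A = Set.range a := by
  have h : spectrum ℝ (U * diagonal a * Uᵀ) = spectrum ℝ (diagonal a) := by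
    have hU : IsUnit U := ⟨⟨U, Uᵀ, hA.orth', hA.orth⟩, rfl⟩
    have := spectrum.units_conjugate (R := ℝ) (a := diagonal a)
      (u := (⟨U, Uᵀ, hA.orth', hA.orth⟩ : (Matrix (Fin d) (Fin d) ℝ)ˣ))
    exact this
  rw [hA.eq, h, spectrum_diagonal]

theorem trace_eq (hA : Diagonalizes A U a) : A.trace = ∑ i, a i := by
  rw [hA.eq, Matrix.trace_mul_comm, ← Matrix.mul_assoc, hA.orth, Matrix.one_mul,
    Matrix.trace_diagonal]

theorem mul (hA : Diagonalizes A U a) (hB : Diagonalizes B U b) :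
    Diagonalizes (A * B) U (a * b) := by
  refine ⟨hA.orth, ?_⟩
  rw [hA.eq, hB.eq]
  calc U * diagonal a * Uᵀ * (U * diagonal b * Uᵀ) = U * diagonal a * (Uᵀ * U) * diagonal b * Uᵀ := by
        simp only [Matrix.mul_assoc]
    _ = _ := by rw [hA.orth, Matrix.mul_one, Matrix.mul_assoc U, diagonal_mul_diagonal]; rfl

theorem add (hA : Diagonalizes A U a) (hB : Diagonalizes B U b) :
    Diagonalizes (A + B) U (a + b) := by
  refine ⟨hA.orth, ?_⟩
  rw [hA.eq, hB.eq, ← Matrix.add_mul, ← Matrix.mul_add, diagonal_add]; rfl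

theorem smul (hA : Diagonalizes A U a) (c : ℝ) : Diagonalizes (c • A) U (c • a) := by
  refine ⟨hA.orth, ?_⟩
  rw [hA.eq, Matrix.diagonal_smul, Matrix.mul_smul, Matrix.smul_mul]

theorem sub (hA : Diagonalizes A U a) (hB : Diagonalizes B U b) :
    Diagonalizes (A - B) U (a - b) := by
  simpa [sub_eq_add_neg] using hA.add (hB.smul (-1))

theorem one (hA : Diagonalizes A U a) : Diagonalizes 1 U 1 :=
  ⟨hA.orth, by
    have : (diagonal (1 : Fin d → ℝ)) = (1 : Matrix (Fin d) (Fin d) ℝ) := diagonal_one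
    rw [this, Matrix.mul_one, hA.orth']⟩

theorem congr (hA : Diagonalizes A U a) (hB : Diagonalizes B U b) (h : a = b) : A = B := by
  rw [hA.eq, hB.eq, h]

theorem norm_sq (hA : Diagonalizes A U a) : ‖A‖ ^ 2 = ∑ i, a i ^ 2 := by
  rw [hA.eq, norm_mul_orthogonal_transpose hA.orth, norm_orthogonal_mul hA.orth, norm_sq_eq_sum]
  refine Finset.sum_congr rfl fun i _ => ?_
  rw [Finset.sum_eq_single i]
  · simp
  · intro j _ hj; simp [diagonal_apply_ne' _ hj]
  · simp

theorem nonneg (hA : Diagonalizes A U a) (h : A.PosSemidef) (i : Fin d) : 0 ≤ a i := by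
  have := (Matrix.posSemidef_iff_isHermitian_and_spectrum_nonneg.mp h).2
  exact this (hA.spectrum_eq ▸ ⟨i, rfl⟩)

theorem posSemidef (hA : Diagonalizes A U a) (h : ∀ i, 0 ≤ a i) : A.PosSemidef := by
  refine Matrix.posSemidef_iff_isHermitian_and_spectrum_nonneg.mpr ⟨hA.isHermitian, ?_⟩
  rw [hA.spectrum_eq]
  rintro _ ⟨i, rfl⟩
  exact h i

theorem det_eq (hA : Diagonalizes A U a) : A.det = ∏ i, a i := by
  rw [hA.eq, Matrix.det_mul_comm, ← Matrix.mul_assoc, hA.orth, Matrix.one_mul, det_diagonal]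

theorem psdPow (hA : Diagonalizes A U a) (s : ℝ) :
    Diagonalizes (psdPow A s) U (fun i => a i ^ s) := hA.diagonalizes_cfc _

end Diagonalizes

theorem Matrix.IsHermitian.exists_diagonalizes {d : ℕ} {A : Matrix (Fin d) (Fin d) ℝ}
    (hA : A.IsHermitian) : ∃ U a, Diagonalizes A U a :=
  let ⟨U, hU, _⟩ := Diagonalizes.exists_of_isHermitian hA
  ⟨U, _, hU⟩

/-- A scalar function that is `K`-Lipschitz from the spectrum of `A` to that of `B` acts on the
two matrices with Lipschitz constant `K` for the Frobenius norm. -/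
theorem norm_cfc_sub_cfc_le {d : ℕ} {A B : Matrix (Fin d) (Fin d) ℝ} (hA : A.IsHermitian)
    (hB : B.IsHermitian) {φ : ℝ → ℝ} {K : ℝ} (hK : 0 ≤ K)
    (h : ∀ x ∈ spectrum ℝ A, ∀ y ∈ spectrum ℝ B, |φ x - φ y| ≤ K * |x - y|) :
    ‖cfc φ A - cfc φ B‖ ≤ K * ‖A - B‖ := by
  obtain ⟨U, a, hU⟩ := hA.exists_diagonalizes
  obtain ⟨V, b, hV⟩ := hB.exists_diagonalizes
  -- In the mixed bases U, V the difference has the entries (ψ(a i) - ψ(b j)) (UᵀV) i j. Using this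
  -- for φ and for the identity reduces the claim to an entrywise comparison.
  have key : ∀ ψ : ℝ → ℝ, ‖U * diagonal (ψ ∘ a) * Uᵀ - V * diagonal (ψ ∘ b) * Vᵀ‖ ^ 2 =
      ∑ i, ∑ j, ((ψ (a i) - ψ (b j)) * (Uᵀ * V) i j) ^ 2 := by
    intro ψ
    have h1 : U * diagonal (ψ ∘ a) * Uᵀ - V * diagonal (ψ ∘ b) * Vᵀ =
        U * (diagonal (ψ ∘ a) * (Uᵀ * V) - (Uᵀ * V) * diagonal (ψ ∘ b)) * Vᵀ := by
      rw [Matrix.mul_sub, Matrix.sub_mul]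
      congr 1
      · calc _ = U * diagonal (ψ ∘ a) * Uᵀ * (V * Vᵀ) := by rw [hV.orth', Matrix.mul_one]
          _ = _ := by simp only [Matrix.mul_assoc]
      · calc _ = (U * Uᵀ) * V * diagonal (ψ ∘ b) * Vᵀ := by rw [hU.orth', Matrix.one_mul]
          _ = _ := by simp only [Matrix.mul_assoc]
    rw [h1, norm_mul_orthogonal_transpose hV.orth, norm_orthogonal_mul hU.orth, norm_sq_eq_sum]
    refine Finset.sum_congr rfl fun i _ => Finset.sum_congr rfl fun j _ => ?_
    rw [Matrix.sub_apply, diagonal_mul, mul_diagonal]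
    simp only [Function.comp]; ring
  rw [← abs_of_nonneg (norm_nonneg (cfc φ A - cfc φ B)),
    ← abs_of_nonneg (mul_nonneg hK (norm_nonneg (A - B))), ← sq_le_sq, mul_pow]
  have e1 := key φ
  have e2 := key id
  rw [hU.cfc_eq, hV.cfc_eq, e1]
  have e3 : ‖A - B‖ ^ 2 = ∑ i, ∑ j, ((a i - b j) * (Uᵀ * V) i j) ^ 2 := by
    simp only [Function.id_comp, id, ← hU.eq, ← hV.eq] at e2
    exact e2
  rw [e3, Finset.mul_sum]
  refine Finset.sum_le_sum fun i _ => ?_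
  rw [Finset.mul_sum]
  refine Finset.sum_le_sum fun j _ => ?_
  have := h (a i) (hU.spectrum_eq ▸ ⟨i, rfl⟩) (b j) (hV.spectrum_eq ▸ ⟨j, rfl⟩)
  calc ((φ (a i) - φ (b j)) * (Uᵀ * V) i j) ^ 2
      = |φ (a i) - φ (b j)| ^ 2 * ((Uᵀ * V) i j) ^ 2 := by rw [mul_pow, sq_abs]
    _ ≤ (K * |a i - b j|) ^ 2 * ((Uᵀ * V) i j) ^ 2 := by gcongr
    _ = _ := by rw [mul_pow, mul_pow, sq_abs]; ring

theorem cfc_mul_eq_mul_cfc {d : ℕ} {A B W : Matrix (Fin d) (Fin d) ℝ} (hA : A.IsHermitian)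
    (hB : B.IsHermitian) (hW : A * W = W * B) (φ : ℝ → ℝ) : cfc φ A * W = W * cfc φ B := by
  obtain ⟨U, a, hU⟩ := hA.exists_diagonalizes
  obtain ⟨V, b, hV⟩ := hB.exists_diagonalizes
  rw [hU.cfc_eq, hV.cfc_eq, hU.intertwine hV hW]

/-! ### Powers of semidefinite matrices and their Lipschitz bounds -/

section PsdPow
variable {d : ℕ} {A B : Matrix (Fin d) (Fin d) ℝ}

theorem psdPow_posSemidef (hA : A.PosSemidef) (s : ℝ) : (psdPow A s).PosSemidef := by
  obtain ⟨U, a, hU⟩ := hA.1.exists_diagonalizes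
  exact (hU.psdPow s).posSemidef fun i => Real.rpow_nonneg (hU.nonneg hA i) s

theorem isHermitian_iff_transpose : A.IsHermitian ↔ Aᵀ = A := by
  rw [Matrix.IsHermitian, Matrix.conjTranspose_eq_transpose_of_trivial]

theorem psdPow_transpose (hA : A.IsHermitian) (s : ℝ) : (psdPow A s)ᵀ = psdPow A s := by
  obtain ⟨U, a, hU⟩ := hA.exists_diagonalizes
  exact isHermitian_iff_transpose.mp (hU.psdPow s).isHermitian

theorem psdPow_zero (hA : A.IsHermitian) : psdPow A 0 = 1 := by
  obtain ⟨U, a, hU⟩ := hA.exists_diagonalizes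
  exact (hU.psdPow 0).congr hU.one (by ext i; simp)

theorem psdPow_one (hA : A.IsHermitian) : psdPow A 1 = A := by
  obtain ⟨U, a, hU⟩ := hA.exists_diagonalizes
  exact (hU.psdPow 1).congr hU (by ext i; simp)

theorem psdPow_mul_psdPow (hA : A.PosSemidef) {s t : ℝ} (hs : 0 ≤ s) (ht : 0 ≤ t) :
    psdPow A s * psdPow A t = psdPow A (s + t) := by
  obtain ⟨U, a, hU⟩ := hA.1.exists_diagonalizes
  refine ((hU.psdPow s).mul (hU.psdPow t)).congr (hU.psdPow _) ?_
  ext i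
  simp [Real.rpow_add_of_nonneg (hU.nonneg hA i) hs ht]

theorem psdPow_psdPow (hA : A.PosSemidef) (s t : ℝ) :
    psdPow (psdPow A s) t = psdPow A (s * t) := by
  obtain ⟨U, a, hU⟩ := hA.1.exists_diagonalizes
  refine ((hU.psdPow s).psdPow t).congr (hU.psdPow _) ?_
  ext i
  simp [Real.rpow_mul (hU.nonneg hA i)]

theorem psdPow_mul_self (hA : A.PosSemidef) (s : ℝ) : psdPow (A * A) s = psdPow A (2 * s) := by
  obtain ⟨U, a, hU⟩ := hA.1.exists_diagonalizes
  refine ((hU.mul hU).psdPow s).congr (hU.psdPow _) ?_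
  ext i
  simp [Real.rpow_mul (hU.nonneg hA i), sq]

theorem psdPow_commute (hA : A.IsHermitian) (s : ℝ) : psdPow A s * A = A * psdPow A s :=
  cfc_mul_eq_mul_cfc hA hA rfl _

theorem posSemidef_mul_transpose_self (W : Matrix (Fin d) (Fin d) ℝ) : (W * Wᵀ).PosSemidef := by
  simpa [Matrix.conjTranspose_eq_transpose_of_trivial] using Matrix.posSemidef_self_mul_conjTranspose W

theorem posSemidef_transpose_mul_self (W : Matrix (Fin d) (Fin d) ℝ) : (Wᵀ * W).PosSemidef := by
  simpa [Matrix.conjTranspose_eq_transpose_of_trivial] using Matrix.posSemidef_conjTranspose_mul_self W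

theorem psdPow_mul_transpose_mul (W : Matrix (Fin d) (Fin d) ℝ) (s : ℝ) :
    psdPow (W * Wᵀ) s * W = W * psdPow (Wᵀ * W) s :=
  cfc_mul_eq_mul_cfc (posSemidef_mul_transpose_self W).1 (posSemidef_transpose_mul_self W).1
    (Matrix.mul_assoc _ _ _) _

/-- The only possible eigenvalues are 0 and c, and on these x ^ s = c ^ (s - 1) * x. Positivity of s
is needed at 0, because 0 ^ 0 = 1. -/
theorem psdPow_of_mul_self_eq_smul (hA : A.IsHermitian) {c : ℝ} (hc : 0 < c) (h : A * A = c • A)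
    {s : ℝ} (hs : 0 < s) : psdPow A s = c ^ (s - 1) • A := by
  obtain ⟨U, a, hU⟩ := hA.exists_diagonalizes
  refine (hU.psdPow s).congr (hU.smul _) ?_
  have h1 : a * a = c • a := by
    have h2 : U * diagonal (a * a) * Uᵀ = U * diagonal (c • a) * Uᵀ := by
      rw [← (hU.mul hU).eq, ← (hU.smul c).eq, h]
    have h3 := congrArg (fun X => Uᵀ * X * U) h2
    have h4 : ∀ D, Uᵀ * (U * D * Uᵀ) * U = D := fun D => by
      calc _ = (Uᵀ * U) * D * (Uᵀ * U) := by simp only [Matrix.mul_assoc]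
        _ = D := by rw [hU.orth, Matrix.one_mul, Matrix.mul_one]
    simp only [h4] at h3
    exact diagonal_injective h3
  ext i
  have h2 : a i * a i = c * a i := congrFun h1 i
  rcases eq_or_ne (a i) 0 with h0 | h0
  · simp [h0, Real.zero_rpow hs.ne']
  · have : a i = c := mul_right_cancel₀ h0 h2
    simp only [this, Pi.smul_apply, smul_eq_mul]
    rw [Real.rpow_sub_one hc.ne']; field_simp

theorem abs_rpow_sub_rpow_le {p R x y : ℝ} (hp : 1 ≤ p) (hx : x ∈ Set.Icc 0 R)
    (hy : y ∈ Set.Icc 0 R) : |x ^ p - y ^ p| ≤ p * R ^ (p - 1) * |x - y| := by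
  have := (convex_Icc 0 R).norm_image_sub_le_of_norm_hasDerivWithin_le
    (f := fun z : ℝ => z ^ p) (f' := fun z => p * z ^ (p - 1)) (C := p * R ^ (p - 1))
    (fun z _ => (Real.hasDerivAt_rpow_const (Or.inr hp)).hasDerivWithinAt) ?_ hy hx
  · simpa [Real.norm_eq_abs] using this
  · intro z hz
    rw [Real.norm_eq_abs, abs_of_nonneg (by have := Real.rpow_nonneg hz.1 (p - 1); positivity)]
    gcongr
    · exact hz.1
    · exact hz.2

/-- The exact constant p R^(p-1), the derivative at R, matters: it fixes the growth exponent of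
errors during the escape from 0. -/
theorem norm_psdPow_sub_le (hA : A.PosSemidef) (hB : B.PosSemidef) {p R : ℝ} (hp : 1 ≤ p)
    (hR : 0 ≤ R) (hAR : spectrum ℝ A ⊆ Set.Icc 0 R) (hBR : spectrum ℝ B ⊆ Set.Icc 0 R) :
    ‖psdPow A p - psdPow B p‖ ≤ p * R ^ (p - 1) * ‖A - B‖ :=
  norm_cfc_sub_cfc_le hA.1 hB.1 (by positivity) fun _ hx _ hy =>
    abs_rpow_sub_rpow_le hp (hAR hx) (hBR hy)

/-- Powers with exponent below 1 are not Lipschitz at 0, but isolating 0 from the rest of the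
spectrum repairs this: the jump between 0 and a point of [δ, K] is bounded by 1 + K ^ s, and the
distance is at least δ. The summand 1 covers 0 ^ 0 = 1. -/
theorem exists_abs_rpow_sub_rpow_le (δ K s : ℝ) (hδ : 0 < δ) (hK : 0 ≤ K) (hs : 0 ≤ s) :
    ∃ C, 0 ≤ C ∧ ∀ x ∈ insert 0 (Set.Icc δ K), ∀ y ∈ insert 0 (Set.Icc δ K),
      |x ^ s - y ^ s| ≤ C * |x - y| := by
  have h0 : ∀ y ∈ Set.Icc δ K, |(0:ℝ) ^ s - y ^ s| ≤ (1 + K ^ s) / δ * |0 - y| := by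
    intro y hy
    have hy0 : 0 < y := hδ.trans_le hy.1
    have e1 : |(0:ℝ) ^ s - y ^ s| ≤ 1 + K ^ s := by
      have a1 : |(0:ℝ) ^ s| ≤ 1 := by
        rw [abs_of_nonneg (Real.rpow_nonneg le_rfl _)]; exact Real.zero_rpow_le_one s
      have a2 : |y ^ s| ≤ K ^ s := by
        rw [abs_of_nonneg (Real.rpow_nonneg hy0.le _)]
        exact Real.rpow_le_rpow hy0.le hy.2 hs
      exact (abs_sub _ _).trans (add_le_add a1 a2)
    have e2 : (1 + K ^ s) ≤ (1 + K ^ s) / δ * y := by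
      rw [div_mul_eq_mul_div, le_div_iff₀ hδ]
      have : 0 ≤ K ^ s := Real.rpow_nonneg hK _
      nlinarith [hy.1]
    rw [zero_sub, abs_neg, abs_of_pos hy0]
    exact e1.trans e2
  have hKs : 0 ≤ K ^ s := Real.rpow_nonneg hK _
  refine ⟨(1 + K ^ s) / δ + s * (δ ^ (s - 1) + K ^ (s - 1)), ?_, ?_⟩
  · have := Real.rpow_nonneg hK (s - 1)
    positivity
  have h1 : 0 ≤ s * (δ ^ (s - 1) + K ^ (s - 1)) := by
    have := Real.rpow_nonneg hK (s - 1)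
    positivity
  have h2 : 0 ≤ (1 + K ^ s) / δ := by positivity
  have key : ∀ x ∈ Set.Icc δ K, ∀ y ∈ Set.Icc δ K,
      |x ^ s - y ^ s| ≤ s * (δ ^ (s - 1) + K ^ (s - 1)) * |x - y| := by
    intro x hx y hy
    have := (convex_Icc δ K).norm_image_sub_le_of_norm_hasDerivWithin_le
      (f := fun z : ℝ => z ^ s) (f' := fun z => s * z ^ (s - 1))
      (C := s * (δ ^ (s - 1) + K ^ (s - 1)))
      (fun z hz => (Real.hasDerivAt_rpow_const
        (Or.inl (hδ.trans_le hz.1).ne')).hasDerivWithinAt) ?_ hy hx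
    · simpa [Real.norm_eq_abs] using this
    · intro z hz
      have hz0 : 0 < z := hδ.trans_le hz.1
      rw [Real.norm_eq_abs, abs_of_nonneg (by positivity)]
      gcongr
      have p1 := Real.rpow_nonneg hK (s - 1)
      have p2 := Real.rpow_nonneg hδ.le (s - 1)
      rcases le_total 1 s with h | h
      · have := Real.rpow_le_rpow hz0.le hz.2 (sub_nonneg.mpr h); linarith
      · have := Real.rpow_le_rpow_of_nonpos hδ hz.1 (sub_nonpos.mpr h); linarith
  have hmul : ∀ z : ℝ, 0 ≤ |z| := abs_nonneg
  rintro x (rfl | hx) y (rfl | hy)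
  · simp
  · nlinarith [h0 y hy, hmul (0 - y)]
  · rw [abs_sub_comm, abs_sub_comm x]
    nlinarith [h0 x hx, hmul (0 - x)]
  · nlinarith [key x hx y hy, hmul (x - y)]

theorem exists_norm_psdPow_sub_le (d : ℕ) (δ K s : ℝ) (hδ : 0 < δ) (hK : 0 ≤ K) (hs : 0 ≤ s) :
    ∃ C, 0 ≤ C ∧ ∀ A B : Matrix (Fin d) (Fin d) ℝ, A.IsHermitian → B.IsHermitian →
      spectrum ℝ A ⊆ insert 0 (Set.Icc δ K) → spectrum ℝ B ⊆ insert 0 (Set.Icc δ K) →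
      ‖psdPow A s - psdPow B s‖ ≤ C * ‖A - B‖ := by
  obtain ⟨C, hC, h⟩ := exists_abs_rpow_sub_rpow_le δ K s hδ hK hs
  exact ⟨C, hC, fun A B hA hB hA' hB' => norm_cfc_sub_cfc_le hA hB hC fun x hx y hy =>
    h x (hA' hx) y (hB' hy)⟩

end PsdPow

/-! ### Frobenius and spectral norms, perturbation of eigenvalues, rank-one matrices -/

section Norms
variable {d : ℕ} {A B : Matrix (Fin d) (Fin d) ℝ}

theorem abs_entry_le_norm (A : Matrix (Fin d) (Fin d) ℝ) (i j : Fin d) : |A i j| ≤ ‖A‖ := by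
  rw [← abs_of_nonneg (norm_nonneg A), ← sq_le_sq, norm_sq_eq_sum]
  calc A i j ^ 2 ≤ ∑ j, A i j ^ 2 :=
        Finset.single_le_sum (f := fun j => A i j ^ 2) (fun _ _ => sq_nonneg _) (Finset.mem_univ j)
    _ ≤ _ := Finset.single_le_sum (f := fun i => ∑ j, A i j ^ 2)
        (fun _ _ => Finset.sum_nonneg fun _ _ => sq_nonneg _) (Finset.mem_univ i)

theorem abs_trace_mul_le (A B : Matrix (Fin d) (Fin d) ℝ) : |(A * B).trace| ≤ ‖A‖ * ‖B‖ := by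
  have h : (A * B).trace ^ 2 ≤ (‖A‖ * ‖B‖) ^ 2 := by
    rw [mul_pow, norm_sq_eq_sum, norm_sq_eq_sum B, Finset.sum_comm (f := fun i j => B i j ^ 2)]
    simp only [Matrix.trace, Matrix.diag_apply, Matrix.mul_apply]
    simp only [← Finset.sum_product', Finset.univ_product_univ]
    exact Finset.sum_mul_sq_le_sq_mul_sq Finset.univ (fun x : Fin d × Fin d => A x.1 x.2)
      (fun x => B x.2 x.1)
  have := Real.sqrt_le_sqrt h
  rwa [Real.sqrt_sq_eq_abs, Real.sqrt_sq (by positivity)] at this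

theorem norm_le_sum_of_diagonalizes {U : Matrix (Fin d) (Fin d) ℝ} {a : Fin d → ℝ}
    (hA : Diagonalizes A U a) (h : ∀ i, 0 ≤ a i) : ‖A‖ ≤ ∑ i, a i := by
  have h0 : 0 ≤ ∑ i, a i := Finset.sum_nonneg fun i _ => h i
  refine abs_le_of_sq_le_sq' ?_ h0 |>.2
  rw [hA.norm_sq]
  exact Finset.sum_sq_le_sq_sum_of_nonneg fun i _ => h i

theorem norm_le_trace (hA : A.PosSemidef) : ‖A‖ ≤ A.trace := by
  obtain ⟨U, a, hU⟩ := hA.1.exists_diagonalizes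
  rw [hU.trace_eq]
  exact norm_le_sum_of_diagonalizes hU (hU.nonneg hA)

theorem abs_trace_le (A : Matrix (Fin d) (Fin d) ℝ) : |A.trace| ≤ d * ‖A‖ := by
  rw [Matrix.trace]
  calc |∑ i, A.diag i| ≤ ∑ i, |A.diag i| := Finset.abs_sum_le_sum_abs _ _
    _ ≤ ∑ _i : Fin d, ‖A‖ := Finset.sum_le_sum fun i _ => abs_entry_le_norm A i i
    _ = _ := by simp

/-- Weyl's inequality. In an eigenbasis of A, an eigenvalue is a diagonal entry of B plus one of A -
B; the former is an average of eigenvalues of B, with weights the squares of a row of the orthogonal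
matrix UᵀV. -/
theorem spectrum_le_add_norm (hA : A.IsHermitian) (hB : B.IsHermitian) {m : ℝ}
    (h : ∀ x ∈ spectrum ℝ B, x ≤ m) : ∀ x ∈ spectrum ℝ A, x ≤ m + ‖A - B‖ := by
  obtain ⟨U, a, hU⟩ := hA.exists_diagonalizes
  obtain ⟨V, b, hV⟩ := hB.exists_diagonalizes
  rw [hU.spectrum_eq]
  rw [hV.spectrum_eq] at h
  rintro _ ⟨i, rfl⟩
  have e1 : a i = (Uᵀ * A * U) i i := by
    have : Uᵀ * A * U = diagonal a := by
      rw [hU.eq]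
      calc _ = (Uᵀ * U) * diagonal a * (Uᵀ * U) := by simp only [Matrix.mul_assoc]
        _ = _ := by rw [hU.orth, Matrix.one_mul, Matrix.mul_one]
    rw [this, diagonal_apply_eq]
  have e2 : Uᵀ * A * U = Uᵀ * B * U + Uᵀ * (A - B) * U := by
    rw [Matrix.mul_sub, Matrix.sub_mul]; abel
  have hU' : (Uᵀ)ᵀ * Uᵀ = 1 := by rw [Matrix.transpose_transpose, hU.orth']
  have e3 : ‖Uᵀ * (A - B) * U‖ = ‖A - B‖ := by
    have := norm_mul_orthogonal_transpose hU' (Uᵀ * (A - B))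
    rw [Matrix.transpose_transpose] at this
    rw [this, norm_orthogonal_mul hU']
  have e4 : (Uᵀ * B * U) i i = ∑ j, (Uᵀ * V) i j ^ 2 * b j := by
    have : Uᵀ * B * U = (Uᵀ * V) * diagonal b * (Uᵀ * V)ᵀ := by
      rw [hV.eq, Matrix.transpose_mul, Matrix.transpose_transpose]
      simp only [Matrix.mul_assoc]
    rw [this, Matrix.mul_apply]
    refine Finset.sum_congr rfl fun j _ => ?_
    rw [mul_diagonal, Matrix.transpose_apply]; ring
  have e5 : ∑ j, (Uᵀ * V) i j ^ 2 = 1 := by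
    have : (Uᵀ * V) * (Uᵀ * V)ᵀ = 1 := by
      rw [Matrix.transpose_mul, Matrix.transpose_transpose]
      calc _ = Uᵀ * (V * Vᵀ) * U := by simp only [Matrix.mul_assoc]
        _ = 1 := by rw [hV.orth', Matrix.mul_one, hU.orth]
    have h1 := congrFun (congrFun this i) i
    rw [Matrix.mul_apply, Matrix.one_apply_eq] at h1
    rw [← h1]
    exact Finset.sum_congr rfl fun j _ => by rw [Matrix.transpose_apply, sq]
  rw [e1, e2, Matrix.add_apply]
  refine add_le_add ?_ ((le_abs_self _).trans ((abs_entry_le_norm _ i i).trans e3.le))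
  rw [e4]
  calc ∑ j, (Uᵀ * V) i j ^ 2 * b j ≤ ∑ j, (Uᵀ * V) i j ^ 2 * m :=
        Finset.sum_le_sum fun j _ => by have := h (b j) ⟨j, rfl⟩; gcongr
    _ = m := by rw [← Finset.sum_mul, e5, one_mul]

theorem spectrum_subset_Icc_norm (hA : A.PosSemidef) : spectrum ℝ A ⊆ Set.Icc 0 ‖A‖ := by
  intro x hx
  refine ⟨(Matrix.posSemidef_iff_isHermitian_and_spectrum_nonneg.mp hA).2 hx, ?_⟩
  have := spectrum_le_add_norm hA.1 (B := 0) Matrix.isHermitian_zero (m := 0) ?_ x hx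
  · simpa using this
  · intro y hy
    have h0 : Diagonalizes (0 : Matrix (Fin d) (Fin d) ℝ) 1 0 := ⟨by simp, by
      have : (diagonal (0 : Fin d → ℝ)) = (0 : Matrix (Fin d) (Fin d) ℝ) := diagonal_zero
      rw [this]; simp⟩
    rw [h0.spectrum_eq] at hy
    obtain ⟨i, rfl⟩ := hy
    simp

/-- Applied column by column. The spectral norm, not the Frobenius norm, of ∇f(0) has to appear in
the growth estimates, since only it equals the top eigenvalue. -/
theorem norm_mul_le_spectralNorm (A X : Matrix (Fin d) (Fin d) ℝ) :
    ‖A * X‖ ≤ spectralNorm₂ A * ‖X‖ := by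
  have h0 : 0 ≤ spectralNorm₂ A := norm_nonneg _
  refine abs_le_of_sq_le_sq' ?_ (by positivity) |>.2
  rw [mul_pow, norm_sq_eq_sum, norm_sq_eq_sum, Finset.sum_comm,
    Finset.sum_comm (f := fun i j => X i j ^ 2), Finset.mul_sum]
  refine Finset.sum_le_sum fun j _ => ?_
  have h := (Matrix.toEuclideanCLM (n := Fin d) (𝕜 := ℝ) A).le_opNorm (WithLp.toLp 2 (fun i => X i j))
  have h2 := pow_le_pow_left₀ (norm_nonneg _) h 2
  rw [mul_pow, EuclideanSpace.norm_sq_eq, EuclideanSpace.norm_sq_eq] at h2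
  simpa [Matrix.mul_apply, Matrix.mulVec, dotProduct, spectralNorm₂] using h2

theorem norm_mul_le_spectralNorm' (hA : Aᵀ = A) (X : Matrix (Fin d) (Fin d) ℝ) :
    ‖X * A‖ ≤ spectralNorm₂ A * ‖X‖ := by
  rw [← Matrix.frobenius_norm_transpose, Matrix.transpose_mul, hA,
    ← Matrix.frobenius_norm_transpose X]
  exact norm_mul_le_spectralNorm _ _

end Norms

/-- All eigenvalues are 0 or τ, and the trace leaves room for exactly one τ; its column of U is the
vector u. -/
theorem exists_eq_smul_vecMulVec {d : ℕ} {W : Matrix (Fin d) (Fin d) ℝ} (hW : W.IsHermitian)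
    {τ : ℝ} (hτ : 0 < τ) (h : W * W = τ • W) (ht : W.trace = τ) :
    ∃ u : Fin d → ℝ, u ⬝ᵥ u = 1 ∧ W = τ • Matrix.vecMulVec u u := by
  obtain ⟨U, a, hU⟩ := hW.exists_diagonalizes
  have h1 : ∀ i, a i = 0 ∨ a i = τ := by
    intro i
    have h2 := hU.spectrum_eq.symm ▸ Set.mem_range_self i
    have h3 : U * diagonal (a * a) * Uᵀ = U * diagonal (τ • a) * Uᵀ := by
      rw [← (hU.mul hU).eq, ← (hU.smul τ).eq, h]
    have h3 := congrArg (fun X => Uᵀ * X * U) h3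
    have h4 : ∀ D, Uᵀ * (U * D * Uᵀ) * U = D := fun D => by
      calc _ = (Uᵀ * U) * D * (Uᵀ * U) := by simp only [Matrix.mul_assoc]
        _ = D := by rw [hU.orth, Matrix.one_mul, Matrix.mul_one]
    simp only [h4] at h3
    have h5 : a i * a i = τ * a i := congrFun (diagonal_injective h3) i
    rcases eq_or_ne (a i) 0 with h0 | h0
    · exact Or.inl h0
    · exact Or.inr (mul_right_cancel₀ h0 h5)
  rw [hU.trace_eq] at ht
  obtain ⟨i, hi⟩ : ∃ i, a i = τ := by
    by_contra! hne
    have : ∀ i, a i = 0 := fun i => (h1 i).resolve_right (hne i)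
    simp [this] at ht; exact hτ.ne ht
  have h2 : ∀ j, j ≠ i → a j = 0 := by
    intro j hj
    by_contra hne
    have hj' : a j = τ := (h1 j).resolve_left hne
    have : a i + a j ≤ ∑ k, a k := by
      rw [← Finset.sum_pair hj.symm]
      refine Finset.sum_le_sum_of_subset_of_nonneg (Finset.subset_univ _) fun k _ _ => ?_
      rcases h1 k with h | h <;> rw [h]; exact hτ.le
    linarith
  refine ⟨fun k => U k i, ?_, ?_⟩
  · have := congrFun (congrFun hU.orth i) i
    rw [Matrix.mul_apply, Matrix.one_apply_eq] at this
    simpa [dotProduct] using this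
  · rw [hU.eq]
    ext k l
    rw [Matrix.mul_apply, Finset.sum_eq_single i]
    · simp [Matrix.vecMulVec, hi]; ring
    · intro j _ hj; simp [h2 j hj]
    · simp

/-- The topology of the Frobenius norm. -/
noncomputable abbrev frobeniusTopology (d : ℕ) : TopologicalSpace (Matrix (Fin d) (Fin d) ℝ) :=
  (Matrix.frobeniusNormedAddCommGroup (α := ℝ)).toPseudoMetricSpace.toUniformSpace.toTopologicalSpace

attribute [local instance] frobeniusTopology

/-! ### The gradient and the end-to-end field -/

theorem matGrad_transpose {d : ℕ} {f : Matrix (Fin d) (Fin d) ℝ → ℝ}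
    (hf : Differentiable ℝ f) (hsym : ∀ W, f W.transpose = f W)
    (W : Matrix (Fin d) (Fin d) ℝ) : matGrad f Wᵀ = (matGrad f W)ᵀ := by
  let T : Matrix (Fin d) (Fin d) ℝ →L[ℝ] Matrix (Fin d) (Fin d) ℝ :=
    LinearMap.toContinuousLinearMap (Matrix.transposeLinearEquiv (Fin d) (Fin d) ℝ ℝ).toLinearMap
  have hT : ∀ X, T X = X.transpose := fun X => rfl
  have h1 : HasFDerivAt (fun X => f (T X)) ((fderiv ℝ f (T W)).comp T) W :=
    (hf (T W)).hasFDerivAt.comp W T.hasFDerivAt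
  have h2 : (fun X => f (T X)) = f := funext fun X => by rw [hT, hsym]
  rw [h2, hT] at h1
  have h3 := h1.fderiv
  ext i j
  have h4 := congrArg (fun l => l (Matrix.single j i (1 : ℝ))) h3
  simp only [ContinuousLinearMap.comp_apply, hT, Matrix.transpose_single] at h4
  simp only [matGrad, Matrix.transpose_apply, Matrix.of_apply]
  exact h4.symm

theorem fderiv_eq_trace {d : ℕ} (f : Matrix (Fin d) (Fin d) ℝ → ℝ)
    (W H : Matrix (Fin d) (Fin d) ℝ) : fderiv ℝ f W H = ((matGrad f W)ᵀ * H).trace := by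
  conv_lhs => rw [Matrix.matrix_eq_sum_single H]
  simp only [map_sum, Matrix.trace, Matrix.diag_apply, Matrix.mul_apply, Matrix.transpose_apply]
  rw [Finset.sum_comm]
  refine Finset.sum_congr rfl fun j _ => Finset.sum_congr rfl fun i _ => ?_
  have : Matrix.single i j (H i j) = H i j • Matrix.single i j (1 : ℝ) := by
    rw [Matrix.smul_single]; simp
  rw [this, map_smul, smul_eq_mul, mul_comm]; rfl

theorem contDiff_matGrad {d : ℕ} {f : Matrix (Fin d) (Fin d) ℝ → ℝ} (hf : ContDiff ℝ 3 f) :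
    ContDiff ℝ 1 (matGrad f) := by
  have h1 : ContDiff ℝ 1 (fderiv ℝ f) := hf.fderiv_right (by norm_num)
  have h2 : matGrad f = fun W => ∑ i, ∑ j, (fderiv ℝ f W (Matrix.single i j 1)) •
      (Matrix.single i j 1 : Matrix (Fin d) (Fin d) ℝ) := by
    funext W
    conv_lhs => rw [Matrix.matrix_eq_sum_single (matGrad f W)]
    refine Finset.sum_congr rfl fun i _ => Finset.sum_congr rfl fun j _ => ?_
    rw [Matrix.smul_single, smul_eq_mul, mul_one]; rfl
  rw [h2]
  exact ContDiff.sum fun i _ => ContDiff.sum fun j _ =>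
    (h1.clm_apply contDiff_const).smul contDiff_const

theorem exists_matGrad_bound {d : ℕ} {f : Matrix (Fin d) (Fin d) ℝ → ℝ} (hf : ContDiff ℝ 3 f)
    (R : ℝ) : ∃ C, 0 < C ∧ (∀ W, ‖W‖ ≤ R → ‖matGrad f W‖ ≤ C) ∧
      ∀ W W', ‖W‖ ≤ R → ‖W'‖ ≤ R → ‖matGrad f W - matGrad f W'‖ ≤ C * ‖W - W'‖ := by
  have h1 := contDiff_matGrad hf
  have hK : IsCompact (Metric.closedBall (0 : Matrix (Fin d) (Fin d) ℝ) R) :=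
    isCompact_closedBall 0 R
  obtain ⟨C1, hC1⟩ := hK.exists_bound_of_continuousOn h1.continuous.continuousOn
  obtain ⟨C2, hC2⟩ := hK.exists_bound_of_continuousOn (h1.continuous_fderiv (by norm_num)).continuousOn
  refine ⟨max (max C1 C2) 1, by positivity, ?_, ?_⟩
  · intro W hW
    exact (hC1 W (by simpa using hW)).trans ((le_max_left _ _).trans (le_max_left _ _))
  · intro W W' hW hW'
    refine (convex_closedBall (0 : Matrix (Fin d) (Fin d) ℝ) R).norm_image_sub_le_of_norm_fderiv_le
      (𝕜 := ℝ) (fun x _ => (h1.differentiable (by norm_num)) x)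
      (fun x hx => (hC2 x hx).trans ((le_max_right _ _).trans (le_max_left _ _)))
      (by simpa using hW') (by simpa using hW)

/-- The exponents of the two outer factors of a summand of `endToEndField`. -/
theorem endToEnd_exponents {L i : ℕ} (hi : i ∈ Finset.range L) :
    0 ≤ (i : ℝ) / L ∧ 0 ≤ 1 - ((i : ℝ) + 1) / L ∧ (i : ℝ) / L + (1 - ((i : ℝ) + 1) / L) = 1 - 1 / L := by
  have hi' : i < L := Finset.mem_range.mp hi
  have hL : (0 : ℝ) < L := by exact_mod_cast (Nat.zero_le i).trans_lt hi'
  refine ⟨by positivity, ?_, by field_simp; ring⟩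
  rw [sub_nonneg, div_le_one hL]
  exact_mod_cast hi'

section Field
variable {d : ℕ} {f : Matrix (Fin d) (Fin d) ℝ → ℝ} {L : ℕ}

/-- Transposition exchanges the summands i and L - 1 - i. -/
theorem endToEndField_transpose (hf : Differentiable ℝ f) (hsym : ∀ W, f W.transpose = f W)
    (W : Matrix (Fin d) (Fin d) ℝ) : endToEndField f L Wᵀ = (endToEndField f L W)ᵀ := by
  rw [endToEndField, endToEndField, Matrix.transpose_neg, Matrix.transpose_sum,
    ← Finset.sum_range_reflect]
  congr 1
  refine Finset.sum_congr rfl fun i hi => ?_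
  have hi' : i < L := Finset.mem_range.mp hi
  have hL : (0 : ℝ) < L := by exact_mod_cast (Nat.zero_le i).trans_lt hi'
  rw [Matrix.transpose_mul, Matrix.transpose_mul, Matrix.transpose_transpose,
    psdPow_transpose (posSemidef_mul_transpose_self W).1,
    psdPow_transpose (posSemidef_transpose_mul_self W).1, matGrad_transpose hf hsym,
    Matrix.mul_assoc]
  have e1 : ((L - 1 - i : ℕ) : ℝ) = L - 1 - i := by
    rw [Nat.cast_sub (by omega), Nat.cast_sub (by omega)]; simp
  rw [e1]
  congr 3
  · field_simp; ring
  · field_simp; ring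

/-- Contraction of the field with a matrix `X` for which `X (W Wᵀ)^s = (Wᵀ W)^s X`. -/
theorem trace_mul_endToEndField {W X : Matrix (Fin d) (Fin d) ℝ}
    (hX : ∀ s : ℝ, X * psdPow (W * Wᵀ) s = psdPow (Wᵀ * W) s * X) :
    (X * endToEndField f L W).trace =
      -(L * (matGrad f W * (psdPow (Wᵀ * W) (1 - 1 / L) * X)).trace) := by
  rw [endToEndField, Matrix.mul_neg, Matrix.trace_neg, Matrix.mul_sum, Matrix.trace_sum]
  congr 1
  have hc : ∀ c : ℝ, L * c = ∑ _i ∈ Finset.range L, c := fun c => by simp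
  rw [hc]
  -- All L summands have the same trace: moving X through one power and rotating cyclically joins
  -- the two outer powers, whose exponents always add up to 1 - 1/L.
  refine Finset.sum_congr rfl fun i hi => ?_
  obtain ⟨h1, h2, h3⟩ := endToEnd_exponents hi
  rw [← h3, add_comm ((i : ℝ) / L), ← psdPow_mul_psdPow (posSemidef_transpose_mul_self W) h2 h1]
  calc (X * (psdPow (W * Wᵀ) (i / L) * matGrad f W * psdPow (Wᵀ * W) (1 - (i + 1) / L))).trace
      = (psdPow (Wᵀ * W) (i / L) * X * (matGrad f W * psdPow (Wᵀ * W) (1 - (i + 1) / L))).trace := by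
        rw [← hX]; simp only [Matrix.mul_assoc]
    _ = _ := by rw [Matrix.trace_mul_comm]; simp only [Matrix.mul_assoc]

end Field

theorem norm_psdPow_le {d : ℕ} {A : Matrix (Fin d) (Fin d) ℝ} (hA : A.PosSemidef) {K s : ℝ}
    (hs : 0 ≤ s) (h : spectrum ℝ A ⊆ Set.Icc 0 K) : ‖psdPow A s‖ ≤ d * K ^ s := by
  obtain ⟨U, a, hU⟩ := hA.1.exists_diagonalizes
  rw [hU.spectrum_eq] at h
  refine (norm_le_sum_of_diagonalizes (hU.psdPow s) fun i => Real.rpow_nonneg (hU.nonneg hA i) s).trans ?_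
  calc ∑ i, a i ^ s ≤ ∑ _i : Fin d, K ^ s := Finset.sum_le_sum fun i _ => by
        have := h ⟨i, rfl⟩
        exact Real.rpow_le_rpow this.1 this.2 hs
    _ = _ := by simp

/-! ### The determinant along a solution, and preservation of symmetry -/

theorem differentiable_det (d : ℕ) :
    Differentiable ℝ (fun W : Matrix (Fin d) (Fin d) ℝ => W.det) := by
  have h : ∀ i j, Differentiable ℝ (fun W : Matrix (Fin d) (Fin d) ℝ => W i j) := fun i j =>
    (LinearMap.toContinuousLinearMap (Matrix.entryLinearMap ℝ ℝ i j)).differentiable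
  simp only [Matrix.det_apply]
  refine Differentiable.fun_sum fun σ _ => ?_
  refine Differentiable.const_smul ?_ _
  intro W
  exact (HasFDerivAt.finsetProd (u := Finset.univ)
    (g := fun i (W : Matrix (Fin d) (Fin d) ℝ) => W (σ i) i)
    fun i _ => (h (σ i) i W).hasFDerivAt).differentiableAt

/-- Jacobi's formula, from det(W + rH) = det W · det(1 + r W⁻¹H) and the first-order expansion of
the second factor. -/
theorem hasFDerivAt_det_apply {d : ℕ} {W : Matrix (Fin d) (Fin d) ℝ} (hW : W.det ≠ 0)
    (H : Matrix (Fin d) (Fin d) ℝ) :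
    fderiv ℝ (fun W : Matrix (Fin d) (Fin d) ℝ => W.det) W H = W.det * (W⁻¹ * H).trace := by
  have h1 : HasDerivAt (fun r : ℝ => (W + r • H).det)
      (fderiv ℝ (fun W : Matrix (Fin d) (Fin d) ℝ => W.det) W H) 0 := by
    have h0 : HasDerivAt (fun r : ℝ => W + r • H) H 0 := by
      have := ((hasDerivAt_id (0 : ℝ)).smul_const H).const_add W
      rwa [one_smul] at this
    have h2 := (differentiable_det d (W + (0 : ℝ) • H)).hasFDerivAt.comp_hasDerivAt (0 : ℝ) h0
    rw [zero_smul, add_zero] at h2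
    exact h2
  have h3 : (fun r : ℝ => (W + r • H).det) = fun r => W.det * (1 + r • (W⁻¹ * H)).det := by
    funext r
    rw [← Matrix.det_mul, Matrix.mul_add, Matrix.mul_one, Matrix.mul_smul, ← Matrix.mul_assoc,
      Matrix.mul_nonsing_inv _ (Ne.isUnit hW), Matrix.one_mul]
  have h4 : HasDerivAt (fun r : ℝ => W.det * (1 + r • (W⁻¹ * H)).det) (W.det * (W⁻¹ * H).trace) 0 := by
    refine HasDerivAt.const_mul _ ?_
    obtain ⟨p, hp⟩ : ∃ p : Polynomial ℝ, ∀ r : ℝ,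
        (1 + r • (W⁻¹ * H)).det = 1 + (W⁻¹ * H).trace * r + p.eval r * r ^ 2 :=
      ⟨_, fun r => Matrix.det_one_add_smul r _⟩
    simp only [hp]
    have := ((hasDerivAt_id (0 : ℝ)).const_mul (W⁻¹ * H).trace).const_add 1 |>.add
      ((p.hasDerivAt 0).mul ((hasDerivAt_id (0 : ℝ)).pow 2))
    exact this.congr_deriv (by simp)
  rw [h3] at h1
  exact h1.unique h4

section Solution
variable {d : ℕ} {f : Matrix (Fin d) (Fin d) ℝ → ℝ} {L : ℕ} {W₀ : Matrix (Fin d) (Fin d) ℝ}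
  {W : ℝ → Matrix (Fin d) (Fin d) ℝ}

theorem IsEndToEndSolution.hasDerivWithinAt (h : IsEndToEndSolution f L W₀ W) {t : ℝ}
    (ht : 0 ≤ t) : HasDerivWithinAt W (endToEndField f L (W t)) (Set.Ici 0) t := h.2 t ht

theorem IsEndToEndSolution.continuousOn (h : IsEndToEndSolution f L W₀ W) :
    ContinuousOn W (Set.Ici 0) := fun _ ht => (h.hasDerivWithinAt ht).continuousWithinAt

theorem IsEndToEndSolution.exists_bound (h : IsEndToEndSolution f L W₀ W) (T : ℝ) :
    ∃ R, 0 < R ∧ ∀ t ∈ Set.Icc 0 T, ‖W t‖ ≤ R := by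
  obtain ⟨R, hR⟩ := isCompact_Icc.exists_bound_of_continuousOn
    (h.continuousOn.mono (Set.Icc_subset_Ici_self : Set.Icc 0 T ⊆ _))
  exact ⟨max R 1, by positivity, fun t ht => (hR t ht).trans (le_max_left _ _)⟩

theorem spectrum_mul_transpose_subset {X : Matrix (Fin d) (Fin d) ℝ} {R : ℝ} (hX : ‖X‖ ≤ R) :
    spectrum ℝ (X * Xᵀ) ⊆ Set.Icc 0 (R ^ 2) ∧ spectrum ℝ (Xᵀ * X) ⊆ Set.Icc 0 (R ^ 2) := by
  have hXt : ‖Xᵀ‖ ≤ R := by rwa [Matrix.frobenius_norm_transpose]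
  have hR : 0 ≤ R := (norm_nonneg _).trans hX
  have h1 : ‖X * Xᵀ‖ ≤ R ^ 2 := by
    rw [sq]; exact (norm_mul_le _ _).trans (by gcongr)
  have h2 : ‖Xᵀ * X‖ ≤ R ^ 2 := by
    rw [sq]; exact (norm_mul_le _ _).trans (by gcongr)
  exact ⟨(spectrum_subset_Icc_norm (posSemidef_mul_transpose_self X)).trans
      (Set.Icc_subset_Icc le_rfl h1),
    (spectrum_subset_Icc_norm (posSemidef_transpose_mul_self X)).trans
      (Set.Icc_subset_Icc le_rfl h2)⟩

/-- The inverse is absorbed by the power: the squared norm is the trace of (XᵀX)^(1-2/L), whose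
exponent is nonnegative. The bound is therefore uniform as X becomes singular. -/
theorem norm_psdPow_mul_inv_le (hL : 3 ≤ L) {X : Matrix (Fin d) (Fin d) ℝ} (hdet : X.det ≠ 0) {R : ℝ}
    (hX : ‖X‖ ≤ R) : ‖psdPow (Xᵀ * X) (1 - 1 / L) * X⁻¹‖ ≤ d * (d * (R ^ 2) ^ (1 - 2 / L : ℝ)) + 1 := by
  have hL' : (3 : ℝ) ≤ L := by exact_mod_cast hL
  have hP := posSemidef_transpose_mul_self X
  have e1 : (0 : ℝ) ≤ 1 - 2 / L := by
    rw [sub_nonneg, div_le_one (by linarith)]; linarith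
  have e2 : (0 : ℝ) ≤ 1 - 1 / L := by
    rw [sub_nonneg, div_le_one (by linarith)]; linarith
  have hu : IsUnit X.det := Ne.isUnit hdet
  have h1 : ‖psdPow (Xᵀ * X) (1 - 1 / L) * X⁻¹‖ ^ 2 ≤ d * (d * (R ^ 2) ^ (1 - 2 / L : ℝ)) := by
    have h2 : ‖psdPow (Xᵀ * X) (1 - 1 / L) * X⁻¹‖ ^ 2 = (psdPow (Xᵀ * X) (1 - 2 / L)).trace := by
      rw [norm_sq_eq_trace, Matrix.transpose_mul, psdPow_transpose hP.1]
      calc _ = ((X⁻¹)ᵀ * (psdPow (Xᵀ * X) (1 - 1 / L) * psdPow (Xᵀ * X) (1 - 1 / L)) * X⁻¹).trace := by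
            simp only [Matrix.mul_assoc]
        _ = ((X⁻¹)ᵀ * (psdPow (Xᵀ * X) (1 - 2 / L) * psdPow (Xᵀ * X) 1) * X⁻¹).trace := by
            rw [psdPow_mul_psdPow hP e2 e2, psdPow_mul_psdPow hP e1 zero_le_one]
            congr 4; ring
        _ = ((X⁻¹)ᵀ * (psdPow (Xᵀ * X) (1 - 2 / L) * Xᵀ) * (X * X⁻¹)).trace := by
            rw [psdPow_one hP.1]; simp only [Matrix.mul_assoc]
        _ = (psdPow (Xᵀ * X) (1 - 2 / L) * (X⁻¹ * X)ᵀ).trace := by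
            rw [Matrix.mul_nonsing_inv _ hu, Matrix.mul_one, Matrix.trace_mul_comm,
              Matrix.transpose_mul]
            simp only [Matrix.mul_assoc]
        _ = _ := by rw [Matrix.nonsing_inv_mul _ hu, Matrix.transpose_one, Matrix.mul_one]
    rw [h2]
    refine (le_abs_self _).trans ((abs_trace_le _).trans ?_)
    gcongr
    exact norm_psdPow_le hP e1 (spectrum_mul_transpose_subset hX).2
  nlinarith [sq_nonneg (‖psdPow (Xᵀ * X) (1 - 1 / L) * X⁻¹‖ - 1),
    norm_nonneg (psdPow (Xᵀ * X) (1 - 1 / L) * X⁻¹)]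

theorem abs_trace_inv_mul_endToEndField_le (hL : 3 ≤ L) {X : Matrix (Fin d) (Fin d) ℝ}
    (hdet : X.det ≠ 0) {R C : ℝ} (hX : ‖X‖ ≤ R) (hC : ‖matGrad f X‖ ≤ C) :
    |(X⁻¹ * endToEndField f L X).trace| ≤ L * (C * (d * (d * (R ^ 2) ^ (1 - 2 / L : ℝ)) + 1)) := by
  have hu : IsUnit X.det := Ne.isUnit hdet
  rw [trace_mul_endToEndField, abs_neg, abs_mul, Nat.abs_cast]
  · gcongr
    refine (abs_trace_mul_le _ _).trans ?_
    have := norm_psdPow_mul_inv_le hL hdet hX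
    gcongr
    exact (norm_nonneg _).trans hC
  · intro s
    calc X⁻¹ * psdPow (X * Xᵀ) s = X⁻¹ * (psdPow (X * Xᵀ) s * X) * X⁻¹ := by
          simp only [Matrix.mul_assoc]; rw [Matrix.mul_nonsing_inv _ hu, Matrix.mul_one]
      _ = _ := by
          rw [psdPow_mul_transpose_mul, ← Matrix.mul_assoc, Matrix.nonsing_inv_mul _ hu,
            Matrix.one_mul]

/-- The logarithmic derivative of det W is tr(W⁻¹ g(W)), which is bounded on compact time intervals,
so det W decays at most exponentially. -/
theorem IsEndToEndSolution.exists_le_det (hL : 3 ≤ L) (hf : ContDiff ℝ 3 f)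
    (h : IsEndToEndSolution f L W₀ W) (h0 : 0 < W₀.det) (T : ℝ) :
    ∃ c, 0 < c ∧ ∀ t ∈ Set.Icc 0 T, c ≤ (W t).det := by
  obtain ⟨R, hR, hWR⟩ := h.exists_bound T
  obtain ⟨C, hC, hGC, -⟩ := exists_matGrad_bound hf R
  set K : ℝ := L * (C * (d * (d * (R ^ 2) ^ (1 - 2 / L : ℝ)) + 1)) with hK
  -- The rate K + 1 in place of K makes the comparison strict. It is only tested where det W meets
  -- the positive barrier, so Jacobi's formula applies there.
  have key := image_le_of_deriv_right_lt_deriv_boundary' (a := 0) (b := T)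
    (f := fun t => -(W t).det)
    (f' := fun t => -(fderiv ℝ (fun W : Matrix (Fin d) (Fin d) ℝ => W.det) (W t)
      (endToEndField f L (W t))))
    (B := fun t => -(W₀.det / 2 * Real.exp (-(K + 1) * t)))
    (B' := fun t => -(W₀.det / 2 * (Real.exp (-(K + 1) * t) * -(K + 1)))) ?_ ?_ ?_ ?_ ?_ ?_
  · refine ⟨W₀.det / 2 * Real.exp (-(K + 1) * T), by positivity, fun t ht => ?_⟩
    have h1 := key ht
    have hK0 : 0 ≤ K := by positivity
    have h2 : Real.exp (-(K + 1) * T) ≤ Real.exp (-(K + 1) * t) :=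
      Real.exp_le_exp.mpr (by nlinarith [ht.2])
    have : W₀.det / 2 * Real.exp (-(K + 1) * T) ≤ W₀.det / 2 * Real.exp (-(K + 1) * t) := by gcongr
    linarith
  · exact ((differentiable_det d).continuous.comp_continuousOn
      (h.continuousOn.mono Set.Icc_subset_Ici_self)).neg
  · intro t ht
    have h1 := ((differentiable_det d (W t)).hasFDerivAt.comp_hasDerivWithinAt t
      (h.hasDerivWithinAt ht.1)).neg
    exact h1.mono (Set.Ici_subset_Ici.mpr ht.1)
  · simp only [h.1, mul_zero, Real.exp_zero]; linarith
  · fun_prop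
  · intro t _
    have h1 : HasDerivAt (fun t : ℝ => -(K + 1) * t) (-(K + 1)) t := by
      simpa using (hasDerivAt_id t).const_mul (-(K + 1))
    exact ((h1.exp.const_mul (W₀.det / 2)).neg).hasDerivWithinAt
  · intro t ht heq
    have hd : (W t).det = W₀.det / 2 * Real.exp (-(K + 1) * t) := by linarith
    have hd0 : 0 < (W t).det := by rw [hd]; positivity
    have ht' : t ∈ Set.Icc 0 T := Set.Ico_subset_Icc_self ht
    rw [hasFDerivAt_det_apply hd0.ne']
    have h1 := abs_trace_inv_mul_endToEndField_le (f := f) hL hd0.ne' (hWR t ht') (hGC _ (hWR t ht'))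
    have h2 := (abs_le.mp h1).1
    rw [← hK] at h2
    have e : -(W₀.det / 2 * (Real.exp (-(K + 1) * t) * -(K + 1))) = (W t).det * (K + 1) := by
      rw [hd]; ring
    rw [e]
    nlinarith

/-- While the spectra of `W Wᵀ` and `Wᵀ W` stay in `{0} ∪ [δ, K]`, a solution that starts at a
symmetric matrix stays symmetric. -/
theorem IsEndToEndSolution.transpose_eq (hf : ContDiff ℝ 3 f) (hsym : ∀ W, f W.transpose = f W)
    (h : IsEndToEndSolution f L W₀ W) (h0 : W₀ᵀ = W₀) {T δ K : ℝ} (hδ : 0 < δ) (hK : 0 ≤ K)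
    (hS : ∀ t ∈ Set.Icc 0 T, spectrum ℝ (W t * (W t)ᵀ) ⊆ insert 0 (Set.Icc δ K))
    (hS' : ∀ t ∈ Set.Icc 0 T, spectrum ℝ ((W t)ᵀ * W t) ⊆ insert 0 (Set.Icc δ K)) :
    ∀ t ∈ Set.Icc 0 T, (W t)ᵀ = W t := by
  obtain ⟨R, hR, hWR⟩ := h.exists_bound T
  obtain ⟨C, hC, hGC, hGL⟩ := exists_matGrad_bound hf R
  have hfd : Differentiable ℝ f := hf.differentiable (by norm_num)
  -- The spectral condition makes every power Lipschitz, and W Wᵀ - Wᵀ W is linear in the asymmetry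
  -- W - Wᵀ with bounded coefficients.
  have hLip : ∀ s : ℝ, 0 ≤ s → ∃ c, 0 ≤ c ∧ ∀ t ∈ Set.Icc 0 T,
      ‖psdPow (W t * (W t)ᵀ) s - psdPow ((W t)ᵀ * W t) s‖ ≤ c * ‖W t - (W t)ᵀ‖ := by
    intro s hs
    obtain ⟨c, hc, h1⟩ := exists_norm_psdPow_sub_le d δ K s hδ hK hs
    refine ⟨c * (2 * R), by positivity, fun t ht => ?_⟩
    refine (h1 _ _ (posSemidef_mul_transpose_self _).1 (posSemidef_transpose_mul_self _).1
      (hS t ht) (hS' t ht)).trans ?_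
    rw [mul_assoc]
    gcongr
    have e : W t * (W t)ᵀ - (W t)ᵀ * W t = (W t - (W t)ᵀ) * (W t)ᵀ - (W t)ᵀ * (W t - (W t)ᵀ) := by
      rw [Matrix.sub_mul, Matrix.mul_sub]; abel
    have hWt : ‖(W t)ᵀ‖ ≤ R := by rw [Matrix.frobenius_norm_transpose]; exact hWR t ht
    rw [e]
    calc _ ≤ ‖(W t - (W t)ᵀ) * (W t)ᵀ‖ + ‖(W t)ᵀ * (W t - (W t)ᵀ)‖ := norm_sub_le _ _
      _ ≤ ‖W t - (W t)ᵀ‖ * R + R * ‖W t - (W t)ᵀ‖ := by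
          gcongr
          · exact (norm_mul_le _ _).trans (by gcongr)
          · exact (norm_mul_le _ _).trans (by gcongr)
      _ = _ := by ring
  -- The field commutes with transposition, so the derivative of W - Wᵀ is the difference of the
  -- fields at W and at Wᵀ. Bounding it termwise by the asymmetry gives a Gronwall inequality with
  -- zero initial value.
  have hterm : ∀ i ∈ Finset.range L, ∃ c, 0 ≤ c ∧ ∀ t ∈ Set.Icc 0 T,
      ‖psdPow (W t * (W t)ᵀ) ((i : ℝ) / L) * matGrad f (W t) *
        psdPow ((W t)ᵀ * W t) (1 - ((i : ℝ) + 1) / L) -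
      psdPow ((W t)ᵀ * (W t)) ((i : ℝ) / L) * matGrad f (W t)ᵀ *
        psdPow (W t * (W t)ᵀ) (1 - ((i : ℝ) + 1) / L)‖ ≤ c * ‖W t - (W t)ᵀ‖ := by
    intro i hi
    obtain ⟨ha, hb, -⟩ := endToEnd_exponents hi
    obtain ⟨c1, hc1, h1⟩ := hLip _ ha
    obtain ⟨c2, hc2, h2⟩ := hLip _ hb
    set a := (i : ℝ) / L
    set b := 1 - ((i : ℝ) + 1) / L
    set B := (d : ℝ) * (R ^ 2) ^ b
    set A := (d : ℝ) * (R ^ 2) ^ a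
    have hA0 : 0 ≤ A := by positivity
    have hB0 : 0 ≤ B := by positivity
    refine ⟨c1 * (C * B) + A * (C * B) + A * C * c2, by positivity, fun t ht => ?_⟩
    have hWt : ‖(W t)ᵀ‖ ≤ R := by rw [Matrix.frobenius_norm_transpose]; exact hWR t ht
    have n1 : ‖psdPow ((W t)ᵀ * W t) b‖ ≤ B := norm_psdPow_le (posSemidef_transpose_mul_self _) hb
      (spectrum_mul_transpose_subset (hWR t ht)).2
    have n2 : ‖psdPow ((W t)ᵀ * W t) a‖ ≤ A := norm_psdPow_le (posSemidef_transpose_mul_self _) ha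
      (spectrum_mul_transpose_subset (hWR t ht)).2
    have n3 := hGC _ (hWR t ht)
    have n4 := hGC _ hWt
    have n5 := hGL _ _ (hWR t ht) hWt
    have n6 := h1 t ht
    have n7 := h2 t ht
    have n8 : 0 ≤ ‖W t - (W t)ᵀ‖ := norm_nonneg _
    generalize psdPow (W t * (W t)ᵀ) a = Sa at *
    generalize psdPow (W t * (W t)ᵀ) b = Sb at *
    generalize psdPow ((W t)ᵀ * W t) a = Ra at *
    generalize psdPow ((W t)ᵀ * W t) b = Rb at *
    generalize matGrad f (W t) = G at *
    generalize matGrad f (W t)ᵀ = G' at *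
    have e : Sa * G * Rb - Ra * G' * Sb = (Sa - Ra) * (G * Rb) + Ra * ((G - G') * Rb) -
        Ra * G' * (Sb - Rb) := by noncomm_ring
    rw [e]
    calc _ ≤ ‖(Sa - Ra) * (G * Rb)‖ + ‖Ra * ((G - G') * Rb)‖ + ‖Ra * G' * (Sb - Rb)‖ :=
          (norm_sub_le _ _).trans (add_le_add_left (norm_add_le _ _) _)
      _ ≤ c1 * ‖W t - (W t)ᵀ‖ * (C * B) + A * (C * ‖W t - (W t)ᵀ‖ * B) +
          A * C * (c2 * ‖W t - (W t)ᵀ‖) := by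
          gcongr
          · refine (norm_mul_le _ _).trans ?_
            gcongr
            exact (norm_mul_le _ _).trans (by gcongr)
          · refine (norm_mul_le _ _).trans ?_
            gcongr
            exact (norm_mul_le _ _).trans (by gcongr)
          · refine (norm_mul_le _ _).trans ?_
            gcongr
            exact (norm_mul_le _ _).trans (by gcongr)
      _ = _ := by ring
  choose! c hc hcb using hterm
  have hmain : ∀ t ∈ Set.Icc 0 T,
      ‖endToEndField f L (W t) - (endToEndField f L (W t))ᵀ‖ ≤
        (∑ i ∈ Finset.range L, c i) * ‖W t - (W t)ᵀ‖ := by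
    intro t ht
    rw [← endToEndField_transpose hfd hsym, endToEndField, endToEndField, neg_sub_neg,
      ← norm_neg, neg_sub, ← Finset.sum_sub_distrib, Finset.sum_mul]
    refine (norm_sum_le _ _).trans (Finset.sum_le_sum fun i hi => ?_)
    rw [Matrix.transpose_transpose]
    exact hcb i hi t ht
  have hTcont : Continuous (fun X : Matrix (Fin d) (Fin d) ℝ => Xᵀ) :=
    (LinearMap.toContinuousLinearMap
      (Matrix.transposeLinearEquiv (Fin d) (Fin d) ℝ ℝ).toLinearMap).continuous
  have hz := eq_zero_of_abs_deriv_le_mul_abs_self_of_eq_zero_right (a := 0) (b := T)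
    (f := fun t => W t - (W t)ᵀ) (K := ∑ i ∈ Finset.range L, c i)
    (f' := fun t => endToEndField f L (W t) - (endToEndField f L (W t))ᵀ)
    ?_ ?_ ?_ ?_
  · intro t ht
    exact (sub_eq_zero.mp (hz t ht)).symm
  · have h1 := h.continuousOn.mono (Set.Icc_subset_Ici_self : Set.Icc 0 T ⊆ _)
    exact h1.sub (hTcont.comp_continuousOn h1)
  · intro t ht
    have h1 := (h.hasDerivWithinAt ht.1).mono (Set.Ici_subset_Ici.mpr ht.1)
    refine h1.sub ?_
    exact (LinearMap.toContinuousLinearMap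
      (Matrix.transposeLinearEquiv (Fin d) (Fin d) ℝ ℝ).toLinearMap).hasFDerivAt.comp_hasDerivWithinAt t h1
  · simp [h.1, h0]
  · exact fun t ht => hmain t (Set.Ico_subset_Icc_self ht)

end Solution

/-- The vector field of the root `M = W ^ (2 / L)` of a positive semidefinite solution `W`. -/
noncomputable def rootField {d : ℕ} (f : Matrix (Fin d) (Fin d) ℝ → ℝ) (L : ℕ)
    (M : Matrix (Fin d) (Fin d) ℝ) : Matrix (Fin d) (Fin d) ℝ :=
  -(matGrad f (psdPow M (L / 2)) * psdPow M (L / 2) + psdPow M (L / 2) * matGrad f (psdPow M (L / 2)))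

/-- `M` is a positive semidefinite solution of `M' = rootField f L M` on `[a, ∞)`. -/
structure IsRootFlow {d : ℕ} (f : Matrix (Fin d) (Fin d) ℝ → ℝ) (L : ℕ)
    (M : ℝ → Matrix (Fin d) (Fin d) ℝ) (a : ℝ) : Prop where
  posSemidef : ∀ t, a ≤ t → (M t).PosSemidef
  hasDerivWithinAt : ∀ t, a ≤ t → HasDerivWithinAt M (rootField f L (M t)) (Set.Ici a) t

theorem spectrum_subset_Icc_of_le_det {d : ℕ} {A : Matrix (Fin d) (Fin d) ℝ} (hA : A.PosSemidef)
    {K c : ℝ} (hK : 1 ≤ K) (h : spectrum ℝ A ⊆ Set.Icc 0 K) (hc : c ≤ A.det) :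
    spectrum ℝ A ⊆ Set.Icc (c / K ^ d) K := by
  obtain ⟨U, a, hU⟩ := hA.1.exists_diagonalizes
  rw [hU.spectrum_eq] at h ⊢
  rw [hU.det_eq] at hc
  rintro _ ⟨i, rfl⟩
  have hi : ∀ j, a j ∈ Set.Icc 0 K := fun j => h ⟨j, rfl⟩
  refine ⟨?_, (hi i).2⟩
  rw [div_le_iff₀ (by positivity)]
  refine hc.trans ?_
  rw [← Finset.mul_prod_erase _ _ (Finset.mem_univ i)]
  refine mul_le_mul_of_nonneg_left ?_ (hi i).1
  calc ∏ j ∈ Finset.univ.erase i, a j ≤ ∏ _j ∈ Finset.univ.erase i, K :=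
        Finset.prod_le_prod (fun j _ => (hi j).1) fun j _ => (hi j).2
    _ = K ^ (d - 1) := by simp [Finset.card_erase_of_mem]
    _ ≤ K ^ d := pow_le_pow_right₀ hK (Nat.sub_le _ _)

theorem isClosed_posSemidef (d : ℕ) : IsClosed {A : Matrix (Fin d) (Fin d) ℝ | A.PosSemidef} := by
  have h : {A : Matrix (Fin d) (Fin d) ℝ | A.PosSemidef} =
      {A | Aᵀ = A} ∩ ⋂ x : Fin d → ℝ, {A | 0 ≤ x ⬝ᵥ A *ᵥ x} := by
    ext A
    simp only [Set.mem_ofPred_eq, Set.mem_inter_iff, Set.mem_iInter,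
      Matrix.posSemidef_iff_dotProduct_mulVec, isHermitian_iff_transpose, star_trivial]
  rw [h]
  refine IsClosed.inter (isClosed_eq ?_ continuous_id) (isClosed_iInter fun x => ?_)
  · exact (LinearMap.toContinuousLinearMap
      (Matrix.transposeLinearEquiv (Fin d) (Fin d) ℝ ℝ).toLinearMap).continuous
  · refine isClosed_le continuous_const ?_
    let l : Matrix (Fin d) (Fin d) ℝ →ₗ[ℝ] ℝ :=
      { toFun := fun A => x ⬝ᵥ A *ᵥ x
        map_add' := fun A B => by rw [Matrix.add_mulVec, dotProduct_add]
        map_smul' := fun c A => by simp [Matrix.smul_mulVec] }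
    exact (LinearMap.toContinuousLinearMap l).continuous

/-- The map is the derivative of M ↦ M ^ L. In an eigenbasis it multiplies the entry (k, l) by the
positive number ∑ a_k^(L-1-i) a_l^i. -/
theorem injective_sum_pow_mul_mul_pow {d L : ℕ} (hL : 0 < L) {M U : Matrix (Fin d) (Fin d) ℝ}
    {a : Fin d → ℝ} (hU : Diagonalizes M U a) (ha : ∀ i, 0 < a i) {X : Matrix (Fin d) (Fin d) ℝ}
    (hX : ∑ i ∈ Finset.range L, M ^ (L.pred - i) * X * M ^ i = 0) : X = 0 := by
  have hpow : ∀ k, M ^ k = U * diagonal (a ^ k) * Uᵀ := by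
    intro k
    induction k with
    | zero =>
      have : (diagonal (a ^ 0)) = (1 : Matrix (Fin d) (Fin d) ℝ) := by simp [Pi.one_def]
      rw [pow_zero, this, Matrix.mul_one, hU.orth']
    | succ k ih =>
      have h1 : Diagonalizes (M ^ k) U (a ^ k) := ⟨hU.orth, ih⟩
      rw [pow_succ, pow_succ]
      exact (h1.mul hU).eq
  have h1 : Uᵀ * (∑ i ∈ Finset.range L, M ^ (L.pred - i) * X * M ^ i) * U = 0 := by
    rw [hX, Matrix.mul_zero, Matrix.zero_mul]
  rw [Matrix.mul_sum, Matrix.sum_mul] at h1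
  have h2 : ∀ i, Uᵀ * (M ^ (L.pred - i) * X * M ^ i) * U =
      diagonal (a ^ (L.pred - i)) * (Uᵀ * X * U) * diagonal (a ^ i) := by
    intro i
    rw [hpow, hpow]
    calc _ = (Uᵀ * U) * diagonal (a ^ (L.pred - i)) * (Uᵀ * X * U) * diagonal (a ^ i) * (Uᵀ * U) := by
          simp only [Matrix.mul_assoc]
      _ = _ := by rw [hU.orth, Matrix.one_mul, Matrix.mul_one]
  simp only [h2] at h1
  have h3 : Uᵀ * X * U = 0 := by
    ext k l
    have h4 := congrFun (congrFun h1 k) l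
    rw [Matrix.sum_apply] at h4
    simp only [mul_diagonal, diagonal_mul, Pi.pow_apply, Matrix.zero_apply] at h4
    have h5 : (∑ i ∈ Finset.range L, a k ^ (L.pred - i) * a l ^ i) * (Uᵀ * X * U) k l = 0 := by
      rw [← h4, Finset.sum_mul]
      exact Finset.sum_congr rfl fun i _ => by ring
    refine (mul_eq_zero.mp h5).resolve_left (ne_of_gt ?_)
    exact Finset.sum_pos (fun i _ => mul_pos (pow_pos (ha k) _) (pow_pos (ha l) _))
      ⟨0, Finset.mem_range.mpr hL⟩
  calc X = (U * Uᵀ) * X * (U * Uᵀ) := by rw [hU.orth', Matrix.one_mul, Matrix.mul_one]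
    _ = U * (Uᵀ * X * U) * Uᵀ := by simp only [Matrix.mul_assoc]
    _ = 0 := by rw [h3, Matrix.mul_zero, Matrix.zero_mul]

/-! ### The root equation for positive definite solutions -/

section Root
variable {d : ℕ} {f : Matrix (Fin d) (Fin d) ℝ → ℝ} {L : ℕ} {W₀ : Matrix (Fin d) (Fin d) ℝ}
  {W : ℝ → Matrix (Fin d) (Fin d) ℝ}

theorem psdPow_natCast {A : Matrix (Fin d) (Fin d) ℝ} (hA : A.PosSemidef) (n : ℕ) :
    psdPow A n = A ^ n := by
  induction n with
  | zero => simpa using psdPow_zero hA.1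
  | succ n ih =>
    rw [Nat.cast_succ, ← psdPow_mul_psdPow hA n.cast_nonneg zero_le_one, ih, psdPow_one hA.1, pow_succ]

theorem psdPow_root (hL : 0 < L) {X : Matrix (Fin d) (Fin d) ℝ} (hX : X.PosSemidef) :
    psdPow (psdPow X (2 / L)) (L / 2) = X := by
  have hL' : (L : ℝ) ≠ 0 := by positivity
  rw [psdPow_psdPow hX, div_mul_div_cancel₀ hL', div_self two_ne_zero, psdPow_one hX.1]

theorem psdPow_root_pow (hL : 0 < L) {X : Matrix (Fin d) (Fin d) ℝ} (hX : X.PosSemidef) :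
    psdPow X (2 / L) ^ L = X * X := by
  have hL' : (L : ℝ) ≠ 0 := by positivity
  rw [← psdPow_natCast (psdPow_posSemidef hX _), psdPow_psdPow hX, div_mul_cancel₀ _ hL',
    show (2 : ℝ) = (2 : ℕ) by norm_num, psdPow_natCast hX, sq]

/-- In terms of the root all exponents become integers, and the field takes the shape of the
derivative of the L-th power. -/
theorem endToEndField_eq_sum_pow {X : Matrix (Fin d) (Fin d) ℝ} (hX : X.PosSemidef) :
    endToEndField f L X = -∑ i ∈ Finset.range L,
      psdPow X (2 / L) ^ i * matGrad f X * psdPow X (2 / L) ^ (L.pred - i) := by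
  rw [endToEndField]
  congr 1
  refine Finset.sum_congr rfl fun i hi => ?_
  have hi' : i < L := Finset.mem_range.mp hi
  have hL : (0 : ℝ) < L := by exact_mod_cast (Nat.zero_le i).trans_lt hi'
  have hXt : Xᵀ = X := isHermitian_iff_transpose.mp hX.1
  rw [hXt, psdPow_mul_self hX, psdPow_mul_self hX, ← psdPow_natCast (psdPow_posSemidef hX _),
    ← psdPow_natCast (psdPow_posSemidef hX _), psdPow_psdPow hX, psdPow_psdPow hX]
  have e1 : ((L.pred - i : ℕ) : ℝ) = L - 1 - i := by
    rw [Nat.pred_eq_sub_one, Nat.cast_sub (by omega), Nat.cast_sub (by omega)]; simp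
  have e2 : 2 * ((i : ℝ) / L) = 2 / L * i := by ring
  have e3 : 2 * (1 - ((i : ℝ) + 1) / L) = 2 / L * (L - 1 - i) := by field_simp; ring
  rw [e1, e2, e3]

/-- The determinant keeps the spectra of W Wᵀ and Wᵀ W away from 0, hence W stays symmetric; its
eigenvalues, of absolute value at least √δ, cannot change sign continuously. -/
theorem IsEndToEndSolution.posSemidef_and_spectrum (hL : 3 ≤ L) (hf : ContDiff ℝ 3 f)
    (hsym : ∀ W, f W.transpose = f W) (h : IsEndToEndSolution f L W₀ W) (h0 : W₀.PosDef) (T : ℝ) :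
    ∃ δ K, 0 < δ ∧ 0 ≤ K ∧ ∀ t ∈ Set.Icc 0 T, (W t).PosSemidef ∧ spectrum ℝ (W t) ⊆ Set.Icc δ K := by
  obtain ⟨R, hR, hWR⟩ := h.exists_bound T
  obtain ⟨c, hc, hdet⟩ := h.exists_le_det hL hf h0.det_pos T
  set K := max (R ^ 2) 1 with hK
  have hK1 : 1 ≤ K := le_max_right _ _
  set δ := c ^ 2 / K ^ d with hδdef
  have hδ : 0 < δ := by positivity
  have hspec : ∀ t ∈ Set.Icc 0 T, spectrum ℝ (W t * (W t)ᵀ) ⊆ Set.Icc δ K ∧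
      spectrum ℝ ((W t)ᵀ * W t) ⊆ Set.Icc δ K := by
    intro t ht
    have h1 := spectrum_mul_transpose_subset (hWR t ht)
    have h2 : c ^ 2 ≤ (W t).det * (W t).det := by
      rw [sq]; exact mul_self_le_mul_self hc.le (hdet t ht)
    refine ⟨spectrum_subset_Icc_of_le_det (posSemidef_mul_transpose_self _) hK1
        (h1.1.trans (Set.Icc_subset_Icc le_rfl (le_max_left _ _))) ?_,
      spectrum_subset_Icc_of_le_det (posSemidef_transpose_mul_self _) hK1
        (h1.2.trans (Set.Icc_subset_Icc le_rfl (le_max_left _ _))) ?_⟩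
    · rwa [Matrix.det_mul, Matrix.det_transpose]
    · rwa [Matrix.det_mul, Matrix.det_transpose]
  have hWt := h.transpose_eq hf hsym (isHermitian_iff_transpose.mp h0.1) (T := T) hδ
    (zero_le_one.trans hK1) (fun t ht => (hspec t ht).1.trans (Set.subset_insert _ _))
    (fun t ht => (hspec t ht).2.trans (Set.subset_insert _ _))
  have hsq : ∀ t ∈ Set.Icc 0 T, ∀ x ∈ spectrum ℝ (W t), δ ≤ x ^ 2 := by
    intro t ht x hx
    obtain ⟨U, a, hU⟩ := (isHermitian_iff_transpose.mpr (hWt t ht)).exists_diagonalizes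
    rw [hU.spectrum_eq] at hx
    obtain ⟨i, rfl⟩ := hx
    have h1 := (hspec t ht).1
    rw [hWt t ht, (hU.mul hU).spectrum_eq] at h1
    rw [sq]
    exact (h1 ⟨i, rfl⟩).1
  have hpsd : Set.Icc 0 T ⊆ {t | (W t).PosSemidef} := by
    have hcont := h.continuousOn.mono (Set.Icc_subset_Ici_self : Set.Icc 0 T ⊆ _)
    rcases lt_or_ge T 0 with hT | hT
    · rw [Set.Icc_eq_empty (not_le.mpr hT)]; exact Set.empty_subset _
    -- Continuous induction in time. Semidefiniteness is a closed condition, and it persists to the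
    -- right because eigenvalues move by less than √δ while staying outside (-√δ, √δ).
    refine IsClosed.Icc_subset_of_forall_mem_nhdsWithin ?_ ?_ ?_
    · rw [Set.inter_comm]
      exact hcont.preimage_isClosed_of_isClosed isClosed_Icc (isClosed_posSemidef d)
    · simp only [Set.mem_ofPred_eq, h.1]; exact h0.posSemidef
    · rintro t ⟨hpos, ht⟩
      have ht' : t ∈ Set.Icc 0 T := Set.Ico_subset_Icc_self ht
      have h1 : ∀ᶠ s in 𝓝[>] t, s ∈ Set.Icc 0 T := by
        filter_upwards [Ioo_mem_nhdsGT ht.2] with s hs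
        exact ⟨ht.1.trans hs.1.le, hs.2.le⟩
      have h2 : ∀ᶠ s in 𝓝[>] t, ‖W s - W t‖ < √δ := by
        have h3 : Tendsto W (𝓝[>] t) (𝓝 (W t)) :=
          ((h.continuousOn t ht.1).mono_left (nhdsWithin_mono _
            (fun s hs => ht.1.trans (le_of_lt hs))))
        have h4 := (tendsto_iff_norm_sub_tendsto_zero.mp h3)
        exact h4.eventually (gt_mem_nhds (Real.sqrt_pos.mpr hδ))
      filter_upwards [h1, h2] with s hs hs2
      have hHt := isHermitian_iff_transpose.mpr (hWt t ht')
      have hHs := isHermitian_iff_transpose.mpr (hWt s hs)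
      refine Matrix.posSemidef_iff_isHermitian_and_spectrum_nonneg.mpr ⟨hHs, ?_⟩
      intro x hx
      have h5 := spectrum_le_add_norm hHs.neg hHt.neg (m := -√δ) ?_ (-x) ?_
      · have e : -W s - -W t = -(W s - W t) := by abel
        rw [e, norm_neg] at h5
        simp only [Set.mem_ofPred_eq]; linarith
      · intro y hy
        rw [← spectrum.neg_eq] at hy
        have hy' : -y ∈ spectrum ℝ (W t) := by simpa using hy
        have h6 := (Matrix.posSemidef_iff_isHermitian_and_spectrum_nonneg.mp hpos).2 hy'
        have h7 := hsq t ht' _ hy'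
        have h8 : √δ ≤ -y := Real.sqrt_le_iff.mpr ⟨h6, h7⟩
        linarith
      · rw [← spectrum.neg_eq]; simpa using hx
  refine ⟨√δ, R, Real.sqrt_pos.mpr hδ, hR.le, fun t ht => ⟨hpsd ht, fun x hx => ?_⟩⟩
  have h1 := spectrum_subset_Icc_norm (hpsd ht) hx
  exact ⟨Real.sqrt_le_iff.mpr ⟨h1.1, hsq t ht x hx⟩, h1.2.trans (hWR t ht)⟩

/-- A solution that starts at a positive definite matrix stays positive definite, and its power
`W ^ (2 / L)` solves the root equation. -/
theorem IsEndToEndSolution.isRootFlow_of_posDef (hL : 3 ≤ L) (hf : ContDiff ℝ 3 f)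
    (hsym : ∀ W, f W.transpose = f W) (h : IsEndToEndSolution f L W₀ W) (h0 : W₀.PosDef) :
    (∀ t, 0 ≤ t → (W t).PosDef) ∧ IsRootFlow f L (fun t => psdPow (W t) (2 / L)) 0 := by
  have hL0 : 0 < L := by omega
  have hLr : (0 : ℝ) < L := by exact_mod_cast hL0
  have hpsd : ∀ t, 0 ≤ t → (W t).PosSemidef := fun t ht => by
    obtain ⟨δ, K, -, -, h1⟩ := h.posSemidef_and_spectrum hL hf hsym h0 t
    exact (h1 t ⟨ht, le_rfl⟩).1
  refine ⟨fun t ht => ?_, fun t ht => psdPow_posSemidef (hpsd t ht) _, fun t ht => ?_⟩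
  · obtain ⟨c, hc, h1⟩ := h.exists_le_det hL hf h0.det_pos t
    rw [(hpsd t ht).posDef_iff_isUnit, Matrix.isUnit_iff_isUnit_det]
    exact (hc.trans_le (h1 t ⟨ht, le_rfl⟩)).ne'.isUnit
  obtain ⟨δ, K, hδ, hK, hspec⟩ := h.posSemidef_and_spectrum hL hf hsym h0 (t + 1)
  set M := fun t => psdPow (W t) (2 / L) with hM
  have htT : t ∈ Set.Icc 0 (t + 1) := ⟨ht, by linarith⟩
  have hnear : ∀ᶠ s in 𝓝[Set.Ici 0] t, s ∈ Set.Icc 0 (t + 1) := by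
    have : ∀ᶠ s in 𝓝[Set.Ici 0] t, s < t + 1 := nhdsWithin_le_nhds (gt_mem_nhds (by linarith))
    filter_upwards [this, self_mem_nhdsWithin] with s hs hs0
    exact ⟨hs0, hs.le⟩
  have hMcont : ContinuousWithinAt M (Set.Ici 0) t := by
    obtain ⟨C, hC, hLip⟩ := exists_norm_psdPow_sub_le d δ K (2 / L) hδ hK (by positivity)
    have h1 : Tendsto (fun s => C * ‖W s - W t‖) (𝓝[Set.Ici 0] t) (𝓝 0) := by
      have := (tendsto_iff_norm_sub_tendsto_zero.mp (h.continuousOn t ht)).const_mul C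
      simpa using this
    refine tendsto_iff_norm_sub_tendsto_zero.mpr (squeeze_zero' (Eventually.of_forall fun _ =>
      norm_nonneg _) ?_ h1)
    filter_upwards [hnear] with s hs
    exact hLip _ _ (hspec s hs).1.1 (hspec t htT).1.1
      ((hspec s hs).2.trans (Set.subset_insert _ _)) ((hspec t htT).2.trans (Set.subset_insert _ _))
  obtain ⟨U, a, hU⟩ := (hspec t htT).1.1.exists_diagonalizes
  have ha : ∀ i, 0 < a i := fun i => hδ.trans_le ((hspec t htT).2 (hU.spectrum_eq ▸ ⟨i, rfl⟩)).1
  have hUM := hU.psdPow (2 / L)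
  -- Instead of differentiating a fractional power, M is recovered from M ^ L = W² by the inverse
  -- function theorem. Continuity of M, shown above, selects the right local branch.
  have hstrict := hasStrictFDerivAt_pow' (𝕜 := ℝ) L (x := M t)
  set D : Matrix (Fin d) (Fin d) ℝ →L[ℝ] Matrix (Fin d) (Fin d) ℝ := ∑ i ∈ Finset.range L,
    MulOpposite.op (M t ^ i) • M t ^ (L.pred - i) •
      ContinuousLinearMap.id ℝ (Matrix (Fin d) (Fin d) ℝ) with hD
  have hDapp : ∀ X, D X = ∑ i ∈ Finset.range L, M t ^ (L.pred - i) * X * M t ^ i := by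
    intro X
    rw [hD, _root_.sum_apply]
    rfl
  have hinj : Function.Injective D := by
    rw [injective_iff_map_eq_zero]
    intro X hX
    rw [hDapp] at hX
    exact injective_sum_pow_mul_mul_pow hL0 hUM (fun i => Real.rpow_pos_of_pos (ha i) _) hX
  let De : Matrix (Fin d) (Fin d) ℝ ≃L[ℝ] Matrix (Fin d) (Fin d) ℝ :=
    (LinearEquiv.ofInjectiveEndo (D : Matrix (Fin d) (Fin d) ℝ →ₗ[ℝ] Matrix (Fin d) (Fin d) ℝ)
      hinj).toContinuousLinearEquiv
  have hDe : (De : Matrix (Fin d) (Fin d) ℝ →L[ℝ] Matrix (Fin d) (Fin d) ℝ) = D := by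
    ext X : 1; rfl
  rw [← hDe] at hstrict
  have hWder := h.hasDerivWithinAt ht
  have hsqder : HasDerivWithinAt (fun s => W s * W s)
      (endToEndField f L (W t) * W t + W t * endToEndField f L (W t)) (Set.Ici 0) t := hWder.mul hWder
  have hloc := hstrict.to_localInverse.hasFDerivAt
  have hMt : M t ^ L = W t * W t := psdPow_root_pow hL0 (hspec t htT).1
  have hcomp : HasDerivWithinAt (fun s => hstrict.localInverse (fun x => x ^ L) De (M t) (W s * W s))
      (De.symm (endToEndField f L (W t) * W t + W t * endToEndField f L (W t))) (Set.Ici 0) t := by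
    rw [hMt] at hloc
    exact HasFDerivAt.comp_hasDerivWithinAt t hloc hsqder
  have hev : M =ᶠ[𝓝[Set.Ici 0] t]
      fun s => hstrict.localInverse (fun x => x ^ L) De (M t) (W s * W s) := by
    filter_upwards [hMcont.eventually hstrict.eventually_left_inverse, hnear] with s hs hs2
    rw [← hs]
    simp only [hM]
    rw [psdPow_root_pow hL0 (hspec s hs2).1]
  have hfin := hcomp.congr_of_eventuallyEq hev (hev.self_of_nhdsWithin ht)
  refine hfin.congr_deriv ?_
  -- It remains to see that the derivative of the L-th power sends the root field to (W²)'. With G =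
  -- ∇f(W), both sides are -∑ M^(L-1-i) (G W + W G) M^i, since W commutes with powers of M.
  rw [ContinuousLinearEquiv.symm_apply_eq]
  have : De (rootField f L (M t)) = D (rootField f L (M t)) := rfl
  rw [this, hDapp, rootField]
  simp only [hM]
  rw [psdPow_root hL0 (hspec t htT).1, endToEndField_eq_sum_pow (hspec t htT).1]
  have hcomm : ∀ k, W t * psdPow (W t) (2 / L) ^ k = psdPow (W t) (2 / L) ^ k * W t := fun k =>
    ((show Commute (W t) (psdPow (W t) (2 / L)) from
      (psdPow_commute (hspec t htT).1.1 _).symm).pow_right k)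
  have e1 : (∑ i ∈ Finset.range L, psdPow (W t) (2 / L) ^ i * matGrad f (W t) *
      psdPow (W t) (2 / L) ^ (L.pred - i)) = ∑ i ∈ Finset.range L,
      psdPow (W t) (2 / L) ^ (L.pred - i) * matGrad f (W t) * psdPow (W t) (2 / L) ^ i := by
    rw [← Finset.sum_range_reflect]
    refine Finset.sum_congr rfl fun i hi => ?_
    have := Finset.mem_range.mp hi
    rw [Nat.pred_eq_sub_one, show L - 1 - (L - 1 - i) = i by omega]
  rw [e1, Matrix.neg_mul, Matrix.mul_neg, Matrix.sum_mul, Matrix.mul_sum, ← neg_add,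
    ← Finset.sum_add_distrib, ← Finset.sum_neg_distrib]
  refine Finset.sum_congr rfl fun i _ => ?_
  have c1 := hcomm i
  have c2 := hcomm (L.pred - i)
  generalize psdPow (W t) (2 / L) ^ i = A at *
  generalize psdPow (W t) (2 / L) ^ (L.pred - i) = B at *
  rw [Matrix.mul_neg, Matrix.neg_mul, neg_inj, Matrix.mul_add, Matrix.add_mul]
  congr 1
  · simp only [Matrix.mul_assoc]; rw [c1]
  · simp only [← Matrix.mul_assoc]; rw [c2]

end Root

/-! ### Preservation of rank one, and the root equation there -/

section RankOne
variable {d : ℕ} {f : Matrix (Fin d) (Fin d) ℝ → ℝ} {L : ℕ} {W₀ : Matrix (Fin d) (Fin d) ℝ}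
  {W : ℝ → Matrix (Fin d) (Fin d) ℝ}

/-- (tr A)² - tr A² = ∑ a_i (tr A - a_i) is a sum of nonnegative terms, so each of them vanishes. -/
theorem eq_zero_or_eq_trace {A : Matrix (Fin d) (Fin d) ℝ} (hA : A.PosSemidef)
    (h : A.trace ^ 2 = (A * A).trace) : ∀ x ∈ spectrum ℝ A, x = 0 ∨ x = A.trace := by
  obtain ⟨U, a, hU⟩ := hA.1.exists_diagonalizes
  have ha := hU.nonneg hA
  rw [hU.trace_eq, (hU.mul hU).trace_eq] at h
  rw [hU.spectrum_eq, hU.trace_eq]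
  have h1 : ∑ i, a i * (∑ j, a j - a i) = 0 := by
    simp only [mul_sub, Finset.sum_sub_distrib, ← Finset.sum_mul]
    rw [sub_eq_zero, ← sq, h]; rfl
  have h2 : ∀ i, 0 ≤ a i * (∑ j, a j - a i) := fun i => mul_nonneg (ha i)
    (sub_nonneg.mpr (Finset.single_le_sum (fun j _ => ha j) (Finset.mem_univ i)))
  rintro _ ⟨i, rfl⟩
  have h3 := (Finset.sum_eq_zero_iff_of_nonneg fun i _ => h2 i).mp h1 i (Finset.mem_univ i)
  rcases mul_eq_zero.mp h3 with h4 | h4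
  · exact Or.inl h4
  · exact Or.inr (sub_eq_zero.mp h4).symm

/-- The same vanishing sum, for the squares of the eigenvalues, leaves at most one nonzero
eigenvalue. Its sign is not determined by the hypothesis but by the trace. -/
theorem mul_self_eq_trace_smul {A : Matrix (Fin d) (Fin d) ℝ} (hA : A.IsHermitian)
    (h : (A * A).trace ^ 2 = (A * A * (A * A)).trace) :
    A.trace ^ 2 = (A * A).trace ∧ A * A = A.trace • A ∧ (0 < A.trace → A.PosSemidef) := by
  obtain ⟨U, a, hU⟩ := hA.exists_diagonalizes
  have hU2 := hU.mul hU
  rw [hU2.trace_eq, (hU2.mul hU2).trace_eq] at h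
  have h1 : ∑ i, a i ^ 2 * (∑ j, a j ^ 2 - a i ^ 2) = 0 := by
    simp only [mul_sub, Finset.sum_sub_distrib, ← Finset.sum_mul]
    simp only [Pi.mul_apply] at h
    simp only [sq] at h ⊢
    rw [sub_eq_zero, h]
  have h2 : ∀ i, 0 ≤ a i ^ 2 * (∑ j, a j ^ 2 - a i ^ 2) := fun i => mul_nonneg (sq_nonneg _)
    (sub_nonneg.mpr (Finset.single_le_sum (f := fun j => a j ^ 2) (fun j _ => sq_nonneg _)
      (Finset.mem_univ i)))
  have h3 : ∀ i j, i ≠ j → a i * a j = 0 := by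
    intro i j hij
    have h4 := (Finset.sum_eq_zero_iff_of_nonneg fun i _ => h2 i).mp h1 i (Finset.mem_univ i)
    rcases mul_eq_zero.mp h4 with h5 | h5
    · rw [pow_eq_zero_iff two_ne_zero] at h5; rw [h5, zero_mul]
    · rw [← Finset.add_sum_erase _ _ (Finset.mem_univ i), add_sub_cancel_left] at h5
      have h6 := (Finset.sum_eq_zero_iff_of_nonneg (fun i _ => sq_nonneg (a i))).mp h5 j
        (Finset.mem_erase.mpr ⟨hij.symm, Finset.mem_univ j⟩)
      rw [pow_eq_zero_iff two_ne_zero] at h6; rw [h6, mul_zero]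
  have h4 : ∀ i, a i * a i = A.trace * a i := by
    intro i
    rw [hU.trace_eq, Finset.sum_mul, Finset.sum_eq_single i]
    · intro j _ hj; exact h3 j i hj
    · simp
  refine ⟨?_, ?_, fun hpos => ?_⟩
  · rw [hU2.trace_eq, sq]
    conv_lhs => rw [hU.trace_eq, ← hU.trace_eq, hU.trace_eq, Finset.mul_sum, ← hU.trace_eq]
    exact Finset.sum_congr rfl fun i _ => (h4 i).symm
  · exact hU2.congr (hU.smul _) (funext h4)
  · refine hU.posSemidef fun i => ?_
    by_contra! hneg
    nlinarith [h4 i, mul_self_nonneg (a i)]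

theorem norm_sq_mul_transpose {X B U : Matrix (Fin d) (Fin d) ℝ} {r β : Fin d → ℝ}
    (hR : Diagonalizes (Xᵀ * X) U r) (hB : Diagonalizes B U β) :
    ‖B * Xᵀ‖ ^ 2 = ∑ i, β i * β i * r i := by
  rw [norm_sq_eq_trace, Matrix.transpose_mul, Matrix.transpose_transpose,
    isHermitian_iff_transpose.mp hB.isHermitian]
  have : ((B * B) * (Xᵀ * X)).trace = ∑ i, β i * β i * r i := ((hB.mul hB).mul hR).trace_eq
  rw [← this, Matrix.mul_assoc, Matrix.trace_mul_comm X]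
  simp only [Matrix.mul_assoc]

/-- For eigenvalues r_i of XᵀX with sum T, the squared norms are ∑ r_i^(1-2/L) r_i² and ∑
r_i^(1-2/L) (r_i (T - r_i))². Bounding the powers by T^(1-2/L) and sums of squares by squares of
sums returns T and the rank defect themselves, which is what Gronwall needs. -/
theorem norm_psdPow_mul_transpose_le (hL : 3 ≤ L) (X : Matrix (Fin d) (Fin d) ℝ) :
    ‖psdPow (Xᵀ * X) (1 - 1 / L) * Xᵀ‖ ≤ ((Xᵀ * X).trace ^ (1 - 2 / L : ℝ) + 1) * (Xᵀ * X).trace ∧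
    ‖psdPow (Xᵀ * X) (1 - 1 / L) * ((Xᵀ * X).trace • 1 - Xᵀ * X) * Xᵀ‖ ≤
      ((Xᵀ * X).trace ^ (1 - 2 / L : ℝ) + 1) * ((Xᵀ * X).trace ^ 2 - (Xᵀ * X * (Xᵀ * X)).trace) := by
  have hL' : (3 : ℝ) ≤ L := by exact_mod_cast hL
  have e1 : (0 : ℝ) ≤ 1 - 2 / L := by
    rw [sub_nonneg, div_le_one (by linarith)]; linarith
  have hP := posSemidef_transpose_mul_self X
  obtain ⟨U, r, hU⟩ := hP.1.exists_diagonalizes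
  have hr := hU.nonneg hP
  have hT : (Xᵀ * X).trace = ∑ i, r i := hU.trace_eq
  have hle : ∀ i, r i ≤ ∑ j, r j := fun i => Finset.single_le_sum (fun j _ => hr j) (Finset.mem_univ i)
  have hT0 : 0 ≤ ∑ i, r i := Finset.sum_nonneg fun i _ => hr i
  have hs := hU.psdPow (1 - 1 / L)
  have hpow : ∀ i, r i ^ (1 - 1 / L : ℝ) * r i ^ (1 - 1 / L : ℝ) * r i =
      r i ^ (1 - 2 / L : ℝ) * r i ^ 2 := by
    intro i
    have e2 : (0 : ℝ) ≤ 1 - 1 / L := by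
      rw [sub_nonneg, div_le_one (by linarith)]; linarith
    rw [← Real.rpow_add_of_nonneg (hr i) e2 e2]
    conv_lhs => rw [show r i ^ ((1 - 1 / L : ℝ) + (1 - 1 / L)) * r i =
      r i ^ ((1 - 1 / L : ℝ) + (1 - 1 / L)) * r i ^ (1 : ℝ) by rw [Real.rpow_one]]
    rw [← Real.rpow_add_of_nonneg (hr i) (by linarith) zero_le_one, ← Real.rpow_natCast (r i) 2,
      ← Real.rpow_add_of_nonneg (hr i) e1 (by norm_num)]
    congr 1; push_cast; ring
  have habs : ∀ c y z : ℝ, 0 ≤ c → 0 ≤ y → z ^ 2 ≤ c * y ^ 2 → z ≤ (c + 1) * y := by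
    intro c y z hc hy h
    refine abs_le_of_sq_le_sq' (h.trans ?_) (by positivity) |>.2
    nlinarith [sq_nonneg y, mul_nonneg hc (sq_nonneg y), mul_nonneg (mul_nonneg hc hc) (sq_nonneg y)]
  constructor
  · rw [hT]
    refine habs _ _ _ (Real.rpow_nonneg hT0 _) hT0 ?_
    rw [norm_sq_mul_transpose hU hs]
    calc ∑ i, r i ^ (1 - 1 / L : ℝ) * r i ^ (1 - 1 / L : ℝ) * r i
        ≤ ∑ i, (∑ j, r j) ^ (1 - 2 / L : ℝ) * r i ^ 2 := by
          refine Finset.sum_le_sum fun i _ => ?_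
          rw [hpow]
          gcongr
          · exact hr i
          · exact hle i
      _ ≤ _ := by
          rw [← Finset.mul_sum]
          gcongr
          exact Finset.sum_sq_le_sq_sum_of_nonneg fun i _ => hr i
  · have hB := hs.mul ((hU.one.smul (∑ i, r i)).sub hU)
    have hN : (Xᵀ * X).trace ^ 2 - (Xᵀ * X * (Xᵀ * X)).trace = ∑ i, r i * (∑ j, r j - r i) := by
      rw [hT, (hU.mul hU).trace_eq, sq]
      simp only [mul_sub, Finset.sum_sub_distrib, ← Finset.sum_mul]; rfl
    have hterm : ∀ i, 0 ≤ r i * (∑ j, r j - r i) := fun i =>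
      mul_nonneg (hr i) (sub_nonneg.mpr (hle i))
    rw [hN, hT]
    refine habs _ _ _ (Real.rpow_nonneg hT0 _) (Finset.sum_nonneg fun i _ => hterm i) ?_
    rw [norm_sq_mul_transpose hU hB]
    calc _ = ∑ i, r i ^ (1 - 2 / L : ℝ) * (r i * (∑ j, r j - r i)) ^ 2 := by
          refine Finset.sum_congr rfl fun i _ => ?_
          simp only [Pi.mul_apply, Pi.sub_apply, Pi.smul_apply, Pi.one_apply, smul_eq_mul, mul_one]
          linear_combination ((∑ j, r j - r i) ^ 2) * hpow i
      _ ≤ ∑ i, (∑ j, r j) ^ (1 - 2 / L : ℝ) * (r i * (∑ j, r j - r i)) ^ 2 := by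
          refine Finset.sum_le_sum fun i _ => ?_
          gcongr
          · exact hr i
          · exact hle i
      _ ≤ _ := by
          rw [← Finset.mul_sum]
          gcongr
          exact Finset.sum_sq_le_sq_sum_of_nonneg fun i _ => hterm i

/-- Gronwall's inequality for a scalar function with `φ' ≤ K φ`. -/
theorem le_mul_exp_sub_of_deriv_le {φ φ' : ℝ → ℝ} {a b K : ℝ} (hc : ContinuousOn φ (Set.Icc a b))
    (hd : ∀ t ∈ Set.Ico a b, HasDerivWithinAt φ (φ' t) (Set.Ici t) t)
    (hb : ∀ t ∈ Set.Ico a b, φ' t ≤ K * φ t) :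
    ∀ t ∈ Set.Icc a b, φ t ≤ φ a * Real.exp (K * (t - a)) := by
  intro t ht
  have := le_gronwallBound_of_liminf_deriv_right_le (f := φ) (f' := φ') (δ := φ a) (K := K) (ε := 0)
    hc (fun x hx r hr => (hd x hx).liminf_right_slope_le hr) le_rfl
    (fun x hx => by simpa using hb x hx) t ht
  simpa [gronwallBound_ε0] using this

theorem le_mul_exp_of_deriv_le {φ φ' : ℝ → ℝ} {T K : ℝ} (hc : ContinuousOn φ (Set.Icc 0 T))
    (hd : ∀ t ∈ Set.Ico 0 T, HasDerivWithinAt φ (φ' t) (Set.Ici t) t)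
    (hb : ∀ t ∈ Set.Ico 0 T, φ' t ≤ K * φ t) : ∀ t ∈ Set.Icc 0 T, φ t ≤ φ 0 * Real.exp (K * t) := by
  simpa using le_mul_exp_sub_of_deriv_le hc hd hb

/-- Both quantities use WᵀW, so that they are available before W is known to be symmetric. The
second is the rank defect: it is zero exactly when WᵀW has at most one nonzero eigenvalue. -/
theorem IsEndToEndSolution.hasDerivWithinAt_gram (h : IsEndToEndSolution f L W₀ W) {t : ℝ}
    (ht : 0 ≤ t) :
    HasDerivWithinAt (fun s => ((W s)ᵀ * W s).trace)
      (-(2 * L * (matGrad f (W t) * (psdPow ((W t)ᵀ * W t) (1 - 1 / L) * (W t)ᵀ)).trace)) (Set.Ici 0) t ∧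
    HasDerivWithinAt (fun s => ((W s)ᵀ * W s).trace ^ 2 - ((W s)ᵀ * W s * ((W s)ᵀ * W s)).trace)
      (-(4 * L * (matGrad f (W t) * (psdPow ((W t)ᵀ * W t) (1 - 1 / L) *
        (((W t)ᵀ * W t).trace • 1 - (W t)ᵀ * W t) * (W t)ᵀ)).trace)) (Set.Ici 0) t := by
  have h1 := h.hasDerivWithinAt ht
  have h2 : HasDerivWithinAt (fun s => (W s)ᵀ) (endToEndField f L (W t))ᵀ (Set.Ici 0) t :=
    (LinearMap.toContinuousLinearMap (Matrix.transposeLinearEquiv (Fin d) (Fin d) ℝ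
      ℝ).toLinearMap).hasFDerivAt.comp_hasDerivWithinAt t h1
  have htr : ∀ {F : ℝ → Matrix (Fin d) (Fin d) ℝ} {F' : Matrix (Fin d) (Fin d) ℝ},
      HasDerivWithinAt F F' (Set.Ici 0) t →
      HasDerivWithinAt (fun s => (F s).trace) F'.trace (Set.Ici 0) t := fun hF =>
    (LinearMap.toContinuousLinearMap (Matrix.traceLinearMap (Fin d) ℝ ℝ)).hasFDerivAt.comp_hasDerivWithinAt t hF
  have h3 : HasDerivWithinAt (fun s => (W s)ᵀ * W s)
      ((endToEndField f L (W t))ᵀ * W t + (W t)ᵀ * endToEndField f L (W t)) (Set.Ici 0) t := h2.mul h1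
  have hX : ∀ s : ℝ, (W t)ᵀ * psdPow (W t * (W t)ᵀ) s = psdPow ((W t)ᵀ * W t) s * (W t)ᵀ := by
    intro s
    have := congrArg Matrix.transpose (psdPow_mul_transpose_mul (W t) s)
    rw [Matrix.transpose_mul, Matrix.transpose_mul,
      psdPow_transpose (posSemidef_mul_transpose_self _).1,
      psdPow_transpose (posSemidef_transpose_mul_self _).1] at this
    exact this
  have hX2 : ∀ s : ℝ, ((W t)ᵀ * W t * (W t)ᵀ) * psdPow (W t * (W t)ᵀ) s =
      psdPow ((W t)ᵀ * W t) s * ((W t)ᵀ * W t * (W t)ᵀ) := by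
    intro s
    rw [Matrix.mul_assoc, hX, ← Matrix.mul_assoc,
      ← psdPow_commute (posSemidef_transpose_mul_self _).1, Matrix.mul_assoc]
  have t1 := trace_mul_endToEndField (f := f) (L := L) hX
  have t2 := trace_mul_endToEndField (f := f) (L := L) hX2
  set g := endToEndField f L (W t)
  have e1 : (gᵀ * W t).trace = ((W t)ᵀ * g).trace := by
    rw [← Matrix.trace_transpose, Matrix.transpose_mul, Matrix.transpose_transpose]
  have d1 : HasDerivWithinAt (fun s => ((W s)ᵀ * W s).trace) (2 * ((W t)ᵀ * g).trace) (Set.Ici 0) t :=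
    (htr h3).congr_deriv (by rw [Matrix.trace_add, e1]; ring)
  refine ⟨d1.congr_deriv (by rw [t1]; ring), ?_⟩
  have d2 : HasDerivWithinAt (fun s => ((W s)ᵀ * W s * ((W s)ᵀ * W s)).trace)
      (4 * ((W t)ᵀ * W t * (W t)ᵀ * g).trace) (Set.Ici 0) t := by
    have h4 : HasDerivWithinAt (fun s => (W s)ᵀ * W s * ((W s)ᵀ * W s))
        ((gᵀ * W t + (W t)ᵀ * g) * ((W t)ᵀ * W t) + (W t)ᵀ * W t * (gᵀ * W t + (W t)ᵀ * g))
        (Set.Ici 0) t := h3.mul h3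
    refine (htr h4).congr_deriv ?_
    have e2 : (gᵀ * W t * ((W t)ᵀ * W t)).trace = ((W t)ᵀ * W t * (W t)ᵀ * g).trace := by
      rw [← Matrix.trace_transpose]
      simp only [Matrix.transpose_mul, Matrix.transpose_transpose, Matrix.mul_assoc]
    have e3 : ((W t)ᵀ * g * ((W t)ᵀ * W t)).trace = ((W t)ᵀ * W t * (W t)ᵀ * g).trace := by
      rw [Matrix.trace_mul_comm]; simp only [Matrix.mul_assoc]
    rw [Matrix.trace_add]
    simp only [Matrix.add_mul, Matrix.mul_add, Matrix.trace_add]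
    rw [e2, e3, Matrix.trace_mul_comm _ (gᵀ * W t), Matrix.trace_mul_comm _ ((W t)ᵀ * g), e2, e3]
    ring
  refine ((d1.pow 2).sub d2).congr_deriv ?_
  rw [t1, t2]
  simp only [Matrix.mul_sub, Matrix.sub_mul, Matrix.trace_sub, Matrix.mul_smul, Matrix.smul_mul,
    Matrix.trace_smul, Matrix.mul_one, smul_eq_mul, Matrix.mul_assoc]
  push_cast
  ring

/-- Gronwall from below keeps tr WᵀW positive, and from above keeps the rank defect at 0. So the
spectra of W Wᵀ and Wᵀ W are {0} and a number bounded away from 0, which yields symmetry; tr W never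
vanishes, hence keeps its sign. -/
theorem IsEndToEndSolution.rankOne (hL : 3 ≤ L) (hf : ContDiff ℝ 3 f)
    (hsym : ∀ W, f W.transpose = f W) (h : IsEndToEndSolution f L W₀ W) (h0 : W₀.PosSemidef)
    (h1 : W₀ * W₀ = W₀.trace • W₀) (h2 : 0 < W₀.trace) :
    ∀ t, 0 ≤ t → (W t).PosSemidef ∧ W t * W t = (W t).trace • W t ∧ 0 < (W t).trace := by
  intro T hT
  obtain ⟨R, hR, hWR⟩ := h.exists_bound T
  obtain ⟨C, hC, hGC, -⟩ := exists_matGrad_bound hf R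
  have h0t : W₀ᵀ = W₀ := isHermitian_iff_transpose.mp h0.1
  set K : ℝ := 4 * L * (C * ((R ^ 2) ^ (1 - 2 / L : ℝ) + 1)) with hK
  have hL' : (3 : ℝ) ≤ L := by exact_mod_cast hL
  have e1 : (0 : ℝ) ≤ 1 - 2 / L := by
    rw [sub_nonneg, div_le_one (by linarith)]; linarith
  have htr : ∀ t ∈ Set.Icc 0 T, ((W t)ᵀ * W t).trace ≤ R ^ 2 := by
    intro t ht
    rw [← norm_sq_eq_trace]
    exact pow_le_pow_left₀ (norm_nonneg _) (hWR t ht) 2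
  have htr0 : ∀ t, 0 ≤ ((W t)ᵀ * W t).trace := fun t => by
    rw [← norm_sq_eq_trace]; positivity
  have he0 : ∀ X : Matrix (Fin d) (Fin d) ℝ, X.PosSemidef → 0 ≤ X.trace ^ 2 - (X * X).trace := by
    intro X hX
    obtain ⟨U, a, hU⟩ := hX.1.exists_diagonalizes
    rw [hU.trace_eq, (hU.mul hU).trace_eq, sub_nonneg]
    simpa [sq] using Finset.sum_sq_le_sq_sum_of_nonneg fun i (_ : i ∈ Finset.univ) => hU.nonneg hX i
  have hfac : ∀ t ∈ Set.Icc 0 T, ((W t)ᵀ * W t).trace ^ (1 - 2 / L : ℝ) + 1 ≤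
      (R ^ 2) ^ (1 - 2 / L : ℝ) + 1 := fun t ht => by
    have := Real.rpow_le_rpow (htr0 t) (htr t ht) e1
    linarith
  have hlow := le_mul_exp_of_deriv_le (T := T) (K := -K)
    (φ := fun t => -((W t)ᵀ * W t).trace)
    (fun t ht => ((h.hasDerivWithinAt_gram ht.1).1.continuousWithinAt.mono Set.Icc_subset_Ici_self).neg)
    (fun t ht => ((h.hasDerivWithinAt_gram ht.1).1.mono (Set.Ici_subset_Ici.mpr ht.1)).neg) ?_
  have hup := le_mul_exp_of_deriv_le (T := T) (K := K)
    (φ := fun t => ((W t)ᵀ * W t).trace ^ 2 - ((W t)ᵀ * W t * ((W t)ᵀ * W t)).trace)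
    (fun t ht => (h.hasDerivWithinAt_gram ht.1).2.continuousWithinAt.mono Set.Icc_subset_Ici_self)
    (fun t ht => (h.hasDerivWithinAt_gram ht.1).2.mono (Set.Ici_subset_Ici.mpr ht.1)) ?_
  rotate_left
  · intro t ht
    have ht' : t ∈ Set.Icc 0 T := Set.Ico_subset_Icc_self ht
    have b1 := abs_trace_mul_le (matGrad f (W t)) (psdPow ((W t)ᵀ * W t) (1 - 1 / L) *
        (((W t)ᵀ * W t).trace • 1 - (W t)ᵀ * W t) * (W t)ᵀ)
    have b2 := (norm_psdPow_mul_transpose_le hL (W t)).2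
    have b3 := hGC _ (hWR t ht')
    have b4 := he0 _ (posSemidef_transpose_mul_self (W t))
    have b5 := hfac t ht'
    have b6 : |(matGrad f (W t) * (psdPow ((W t)ᵀ * W t) (1 - 1 / L) *
        (((W t)ᵀ * W t).trace • 1 - (W t)ᵀ * W t) * (W t)ᵀ)).trace| ≤
        C * (((R ^ 2) ^ (1 - 2 / L : ℝ) + 1) *
          (((W t)ᵀ * W t).trace ^ 2 - ((W t)ᵀ * W t * ((W t)ᵀ * W t)).trace)) := by
      refine b1.trans ?_
      gcongr
      exact b2.trans (by gcongr)
    have b7 := (abs_le.mp b6).1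
    rw [hK]
    nlinarith
  · intro t ht
    have ht' : t ∈ Set.Icc 0 T := Set.Ico_subset_Icc_self ht
    have b1 := abs_trace_mul_le (matGrad f (W t)) (psdPow ((W t)ᵀ * W t) (1 - 1 / L) * (W t)ᵀ)
    have b2 := (norm_psdPow_mul_transpose_le hL (W t)).1
    have b3 := hGC _ (hWR t ht')
    have b4 := htr0 t
    have b5 := hfac t ht'
    have b6 : |(matGrad f (W t) * (psdPow ((W t)ᵀ * W t) (1 - 1 / L) * (W t)ᵀ)).trace| ≤
        C * (((R ^ 2) ^ (1 - 2 / L : ℝ) + 1) * ((W t)ᵀ * W t).trace) := by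
      refine b1.trans ?_
      gcongr
      exact b2.trans (by gcongr)
    have b7 := (abs_le.mp b6).2
    have b8 : 0 ≤ C * (((R ^ 2) ^ (1 - 2 / L : ℝ) + 1) * ((W t)ᵀ * W t).trace) := by positivity
    rw [hK]
    nlinarith
  have hW0sq : ((W 0)ᵀ * W 0) = W₀.trace • W₀ := by rw [h.1, h0t, h1]
  have htr00 : ((W 0)ᵀ * W 0).trace = W₀.trace ^ 2 := by
    rw [hW0sq, Matrix.trace_smul, smul_eq_mul, sq]
  have he00 : ((W 0)ᵀ * W 0).trace ^ 2 - ((W 0)ᵀ * W 0 * ((W 0)ᵀ * W 0)).trace = 0 := by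
    rw [htr00, hW0sq, Matrix.smul_mul, Matrix.mul_smul, h1]
    simp only [Matrix.trace_smul, smul_eq_mul]; ring
  set δ := W₀.trace ^ 2 * Real.exp (-K * T) with hδ
  have hδ0 : 0 < δ := by positivity
  have hK0 : 0 ≤ K := by positivity
  have hδt : ∀ t ∈ Set.Icc 0 T, δ ≤ ((W t)ᵀ * W t).trace := by
    intro t ht
    have a1 := hlow t ht
    simp only [htr00] at a1
    have a2 : Real.exp (-K * T) ≤ Real.exp (-K * t) := Real.exp_le_exp.mpr (by nlinarith [ht.2])
    have a3 : δ ≤ W₀.trace ^ 2 * Real.exp (-K * t) := by rw [hδ]; gcongr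
    linarith
  have he : ∀ t ∈ Set.Icc 0 T, ((W t)ᵀ * W t).trace ^ 2 = ((W t)ᵀ * W t * ((W t)ᵀ * W t)).trace := by
    intro t ht
    have a1 := hup t ht
    simp only [he00, zero_mul] at a1
    have a2 := he0 _ (posSemidef_transpose_mul_self (W t))
    linarith
  have he' : ∀ t ∈ Set.Icc 0 T, (W t * (W t)ᵀ).trace ^ 2 = (W t * (W t)ᵀ * (W t * (W t)ᵀ)).trace := by
    intro t ht
    rw [Matrix.trace_mul_comm, he t ht, Matrix.mul_assoc, Matrix.trace_mul_comm]
    simp only [Matrix.mul_assoc]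
  have hWt := h.transpose_eq hf hsym h0t (T := T) (δ := δ) (K := R ^ 2) hδ0 (by positivity)
    (fun t ht x hx => by
      rcases eq_zero_or_eq_trace (posSemidef_mul_transpose_self _) (he' t ht) x hx with h3 | h3
      · exact Or.inl h3
      · rw [Matrix.trace_mul_comm] at h3
        exact Or.inr ⟨h3 ▸ hδt t ht, h3 ▸ htr t ht⟩)
    (fun t ht x hx => by
      rcases eq_zero_or_eq_trace (posSemidef_transpose_mul_self _) (he t ht) x hx with h3 | h3
      · exact Or.inl h3
      · exact Or.inr ⟨h3 ▸ hδt t ht, h3 ▸ htr t ht⟩)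
  have hstruct : ∀ t ∈ Set.Icc 0 T, (W t).trace ^ 2 = (W t * W t).trace ∧
      W t * W t = (W t).trace • W t ∧ (0 < (W t).trace → (W t).PosSemidef) := by
    intro t ht
    have a1 := he t ht
    rw [hWt t ht] at a1
    exact mul_self_eq_trace_smul (isHermitian_iff_transpose.mpr (hWt t ht)) a1
  have hne : ∀ t ∈ Set.Icc 0 T, (W t).trace ≠ 0 := by
    intro t ht h3
    have a1 := (hstruct t ht).1
    have a2 := hδt t ht
    rw [hWt t ht, ← a1, h3] at a2
    simp at a2; linarith
  have hTT : T ∈ Set.Icc 0 T := ⟨hT, le_rfl⟩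
  have htrcont : ContinuousOn (fun t => (W t).trace) (Set.Icc 0 T) :=
    (LinearMap.toContinuousLinearMap (Matrix.traceLinearMap (Fin d) ℝ ℝ)).continuous.comp_continuousOn
      (h.continuousOn.mono Set.Icc_subset_Ici_self)
  have hpos : 0 < (W T).trace := by
    by_contra! hle
    have := intermediate_value_Icc' hT htrcont
    obtain ⟨t, ht, h3⟩ := this ⟨hle, by rw [h.1]; exact h2.le⟩
    exact hne t ht h3
  exact ⟨(hstruct T hTT).2.2 hpos, (hstruct T hTT).2.1, hpos⟩

theorem mul_mul_self_of_rankOne {X : Matrix (Fin d) (Fin d) ℝ} (hX : X.IsHermitian)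
    (h : X * X = X.trace • X) (hpos : 0 < X.trace) (G : Matrix (Fin d) (Fin d) ℝ) :
    X * G * X = (G * X).trace • X := by
  obtain ⟨u, -, hu⟩ := exists_eq_smul_vecMulVec hX hpos h rfl
  generalize X.trace = τ at hu
  subst hu
  have key : vecMulVec u u * G * vecMulVec u u = (u ⬝ᵥ G *ᵥ u) • vecMulVec u u := by
    rw [Matrix.vecMulVec_mul, Matrix.vecMulVec_mul_vecMulVec, ← Matrix.dotProduct_mulVec,
      Matrix.vecMulVec_smul]
  rw [Matrix.smul_mul, Matrix.smul_mul, Matrix.mul_smul, Matrix.mul_smul, key, Matrix.trace_smul,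
    Matrix.mul_vecMulVec, Matrix.trace_vecMulVec, dotProduct_comm u, smul_smul, smul_smul, smul_smul]
  congr 1
  simp only [smul_eq_mul]; ring

/-- The summands i = 0 and i = L - 1 contain a zeroth power, which is the identity and not the
projector to the range, so they keep the full products with ∇f. The other L - 2 collapse to
multiples of X. -/
theorem endToEndField_of_rankOne (hL : 3 ≤ L) {X : Matrix (Fin d) (Fin d) ℝ} (hX : X.PosSemidef)
    (h : X * X = X.trace • X) (hpos : 0 < X.trace) :
    endToEndField f L X = -(X.trace ^ (1 - 2 / L : ℝ) • (matGrad f X * X + X * matGrad f X) +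
      ((L - 2) * X.trace ^ (-(2 / L) : ℝ) * (matGrad f X * X).trace) • X) := by
  have hL' : (3 : ℝ) ≤ L := by exact_mod_cast hL
  have hXt : Xᵀ = X := isHermitian_iff_transpose.mp hX.1
  obtain ⟨n, rfl⟩ : ∃ n, L = n + 2 := ⟨L - 2, by omega⟩
  have hn : (0 : ℝ) < ((n + 2 : ℕ) : ℝ) := by positivity
  have hpow : ∀ s : ℝ, 0 < s → psdPow (X * X) s = X.trace ^ (2 * s - 1) • X := fun s hs => by
    rw [psdPow_mul_self hX, psdPow_of_mul_self_eq_smul hX.1 hpos h (by positivity)]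
  have hz : psdPow (X * X) 0 = 1 := by rw [psdPow_mul_self hX, mul_zero, psdPow_zero hX.1]
  have e1 : 1 - ((((0 : ℕ) : ℝ)) + 1) / ((n + 2 : ℕ) : ℝ) = 1 - 1 / ((n + 2 : ℕ) : ℝ) := by simp
  have e2 : (((n + 1 : ℕ) : ℝ)) / ((n + 2 : ℕ) : ℝ) = 1 - 1 / ((n + 2 : ℕ) : ℝ) := by
    field_simp; push_cast; ring
  have e3 : 1 - ((((n + 1 : ℕ) : ℝ)) + 1) / ((n + 2 : ℕ) : ℝ) = 0 := by
    rw [sub_eq_zero, eq_comm, div_eq_one_iff_eq hn.ne']; push_cast; ring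
  have e4 : (((0 : ℕ) : ℝ)) / ((n + 2 : ℕ) : ℝ) = 0 := by simp
  have e5 : 0 < 1 - 1 / ((n + 2 : ℕ) : ℝ) := by
    rw [sub_pos, div_lt_one hn]; linarith
  rw [endToEndField, hXt, Finset.sum_range_succ, Finset.sum_range_succ', e1, e2, e3, e4, hz, hpow _ e5]
  have hmid : ∀ k ∈ Finset.range n, psdPow (X * X) (((k + 1 : ℕ) : ℝ) / ((n + 2 : ℕ) : ℝ)) * matGrad f X *
      psdPow (X * X) (1 - (((k + 1 : ℕ) : ℝ) + 1) / ((n + 2 : ℕ) : ℝ)) =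
      (X.trace ^ (-(2 / ((n + 2 : ℕ) : ℝ))) * (matGrad f X * X).trace) • X := by
    intro k hk
    have hk' : (k : ℝ) + 1 ≤ n := by exact_mod_cast Finset.mem_range.mp hk
    have p1 : 0 < ((k + 1 : ℕ) : ℝ) / ((n + 2 : ℕ) : ℝ) := by positivity
    have p2 : 0 < 1 - (((k + 1 : ℕ) : ℝ) + 1) / ((n + 2 : ℕ) : ℝ) := by
      rw [sub_pos, div_lt_one hn]; push_cast; linarith
    rw [hpow _ p1, hpow _ p2, Matrix.smul_mul, Matrix.smul_mul, Matrix.mul_smul,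
      mul_mul_self_of_rankOne hX.1 h hpos, smul_smul, smul_smul, ← Real.rpow_add hpos]
    congr 3
    field_simp
    push_cast
    ring
  rw [Finset.sum_congr rfl hmid, Finset.sum_const, Finset.card_range, Matrix.one_mul, Matrix.mul_one,
    Matrix.mul_smul, Matrix.smul_mul, ← Nat.cast_smul_eq_nsmul ℝ, smul_smul, smul_add]
  have e6 : 2 * (1 - 1 / ((n + 2 : ℕ) : ℝ)) - 1 = 1 - 2 / ((n + 2 : ℕ) : ℝ) := by ring
  have e7 : ((n + 2 : ℕ) : ℝ) - 2 = n := by push_cast; ring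
  rw [e6, e7, mul_assoc]
  abel

/-- A solution that starts at a positive semidefinite matrix of rank one keeps this form, and its
power `W ^ (2 / L)` solves the root equation. -/
theorem IsEndToEndSolution.isRootFlow_of_rankOne (hL : 3 ≤ L) (hf : ContDiff ℝ 3 f)
    (hsym : ∀ W, f W.transpose = f W) (h : IsEndToEndSolution f L W₀ W) (h0 : W₀.PosSemidef)
    (h1 : W₀ * W₀ = W₀.trace • W₀) (h2 : 0 < W₀.trace) :
    IsRootFlow f L (fun t => psdPow (W t) (2 / L)) 0 := by
  have hr := h.rankOne hL hf hsym h0 h1 h2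
  have hL' : (3 : ℝ) ≤ L := by exact_mod_cast hL
  -- In rank one the root is a scalar multiple of W, so the product rule suffices in place of the
  -- inverse function theorem.
  have hM : ∀ t, 0 ≤ t → psdPow (W t) (2 / L) = (W t).trace ^ (2 / L - 1 : ℝ) • W t := fun t ht =>
    psdPow_of_mul_self_eq_smul (hr t ht).1.1 (hr t ht).2.2 (hr t ht).2.1 (by positivity)
  refine ⟨fun t ht => psdPow_posSemidef (hr t ht).1 _, fun t ht => ?_⟩
  obtain ⟨hpsd, hsq, hpos⟩ := hr t ht
  have d1 := h.hasDerivWithinAt ht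
  have d2 : HasDerivWithinAt (fun s => (W s).trace) (endToEndField f L (W t)).trace (Set.Ici 0) t :=
    (LinearMap.toContinuousLinearMap (Matrix.traceLinearMap (Fin d) ℝ ℝ)).hasFDerivAt.comp_hasDerivWithinAt
      t d1
  have d3 := (d2.rpow_const (p := (2 / L - 1 : ℝ)) (Or.inl hpos.ne')).smul d1
  have d4 := d3.congr (f₁ := fun s => psdPow (W s) (2 / L)) (fun s hs => hM s hs) (hM t ht)
  refine d4.congr_deriv ?_
  rw [rootField, psdPow_root (by omega) hpsd, endToEndField_of_rankOne hL hpsd hsq hpos]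
  have etr : (matGrad f (W t) * W t + W t * matGrad f (W t)).trace = 2 * (matGrad f (W t) * W t).trace := by
    rw [Matrix.trace_add, Matrix.trace_mul_comm (W t)]; ring
  simp only [Matrix.trace_neg, Matrix.trace_add, Matrix.trace_smul, smul_eq_mul] at etr ⊢
  rw [etr]
  set τ := (W t).trace
  set γ := (matGrad f (W t) * W t).trace
  have r1 : τ ^ (2 / L - 1 - 1 : ℝ) = τ ^ (2 / L : ℝ) / τ ^ 2 := by
    rw [show (2 / L - 1 - 1 : ℝ) = 2 / L - (2 : ℕ) by push_cast; ring, Real.rpow_sub hpos,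
      Real.rpow_natCast]
  have r2 : τ ^ (2 / L - 1 : ℝ) = τ ^ (2 / L : ℝ) / τ := by rw [Real.rpow_sub hpos, Real.rpow_one]
  have r3 : τ ^ (1 - 2 / L : ℝ) = τ / τ ^ (2 / L : ℝ) := by rw [Real.rpow_sub hpos, Real.rpow_one]
  have r4 : τ ^ (-(2 / L) : ℝ) = (τ ^ (2 / L : ℝ))⁻¹ := Real.rpow_neg hpos.le _
  have rpos : 0 < τ ^ (2 / L : ℝ) := Real.rpow_pos_of_pos hpos _
  rw [r1, r2, r3, r4]
  generalize τ ^ (2 / L : ℝ) = β at rpos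
  generalize matGrad f (W t) * W t + W t * matGrad f (W t) = Z
  rw [smul_neg, smul_add, smul_smul, smul_smul, neg_add, add_assoc, ← neg_smul _ (W t), ← add_smul]
  have c1 : β / τ * (τ / β) = 1 := by field_simp
  -- The multiples of W cancel: the middle summands of the field against the derivative of the
  -- scalar (tr W)^(2/L-1).
  have c2 : -(β / τ * ((L - 2) * β⁻¹ * γ)) +
      -(τ / β * (2 * γ) + (L - 2) * β⁻¹ * γ * τ) * (2 / L - 1) * (β / τ ^ 2) = 0 := by
    field_simp; ring
  rw [c1, c2, one_smul, zero_smul, add_zero]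

end RankOne

/-! ### Lipschitz estimates for the root field and continuous dependence -/

section Estimates
variable {d : ℕ} {f : Matrix (Fin d) (Fin d) ℝ → ℝ} {L : ℕ}

theorem IsRootFlow.continuousOn {M : ℝ → Matrix (Fin d) (Fin d) ℝ} {a : ℝ} (h : IsRootFlow f L M a) :
    ContinuousOn M (Set.Ici a) := fun t ht => (h.hasDerivWithinAt t ht).continuousWithinAt

theorem IsRootFlow.mono {M : ℝ → Matrix (Fin d) (Fin d) ℝ} {a b : ℝ} (h : IsRootFlow f L M a)
    (hab : a ≤ b) : IsRootFlow f L M b :=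
  ⟨fun t ht => h.posSemidef t (hab.trans ht), fun t ht =>
    (h.hasDerivWithinAt t (hab.trans ht)).mono (Set.Ici_subset_Ici.mpr hab)⟩

theorem IsRootFlow.comp_add {M : ℝ → Matrix (Fin d) (Fin d) ℝ} {a : ℝ} (h : IsRootFlow f L M a)
    (c : ℝ) : IsRootFlow f L (fun s => M (c + s)) (a - c) := by
  refine ⟨fun t ht => h.posSemidef _ (by linarith), fun t ht => ?_⟩
  have h1 := h.hasDerivWithinAt (c + t) (by linarith)
  have h2 : HasDerivWithinAt (fun s : ℝ => c + s) 1 (Set.Ici (a - c)) t :=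
    ((hasDerivAt_id t).const_add c).hasDerivWithinAt
  have h3 := HasDerivWithinAt.scomp t h1 h2 (fun s hs => by
    have : a - c ≤ s := hs
    show a ≤ c + s
    linarith)
  rw [one_smul] at h3
  exact h3

/-- The gradient differs from ∇f(0) only by O(R^p), because W = M^p has this size. So ∇f(0) with its
spectral norm contributes the leading constants, and everything else goes into a C of higher order
in R that does not depend on R. -/
theorem exists_rootField_bounds (hL : 3 ≤ L) (hf : ContDiff ℝ 3 f)
    (hsym : ∀ W, f W.transpose = f W) {R₀ : ℝ} (hR₀ : 0 ≤ R₀) :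
    ∃ C, 0 < C ∧ ∀ R, 0 ≤ R → R ≤ R₀ → ∀ M D : Matrix (Fin d) (Fin d) ℝ, M.PosSemidef → D.PosSemidef →
      spectrum ℝ M ⊆ Set.Icc 0 R → spectrum ℝ D ⊆ Set.Icc 0 R →
      ‖rootField f L M - rootField f L D‖ ≤
        (2 * spectralNorm₂ (matGrad f 0) + C * R ^ (L / 2 : ℝ)) *
          ((L / 2 : ℝ) * R ^ (L / 2 - 1 : ℝ) * ‖M - D‖) ∧
      ‖rootField f L M -
        -(matGrad f 0 * psdPow D (L / 2) + psdPow D (L / 2) * matGrad f 0)‖ ≤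
        2 * spectralNorm₂ (matGrad f 0) * ((L / 2 : ℝ) * R ^ (L / 2 - 1 : ℝ) * ‖M - D‖) +
          C * (R ^ (L / 2 : ℝ) * R ^ (L / 2 : ℝ)) := by
  have hL' : (3 : ℝ) ≤ L := by exact_mod_cast hL
  have hp : (1 : ℝ) ≤ L / 2 := by linarith
  set p : ℝ := L / 2
  have hp0 : 0 ≤ p := by linarith
  obtain ⟨C₀, hC₀, -, hGL⟩ := exists_matGrad_bound hf (d * R₀ ^ p)
  have hG0 : (matGrad f 0)ᵀ = matGrad f 0 := by
    rw [← matGrad_transpose (hf.differentiable (by norm_num)) hsym, Matrix.transpose_zero]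
  have hμ : 0 ≤ spectralNorm₂ (matGrad f 0) := norm_nonneg _
  have hρ : (0 : ℝ) ≤ d * R₀ ^ p := by positivity
  refine ⟨4 * C₀ * d + 2 * C₀ * d * d + 1, by positivity, fun R hR hRR M D hM hD hMR hDR => ?_⟩
  have hRp : 0 ≤ R ^ p := Real.rpow_nonneg hR _
  have hRp' : R ^ p ≤ R₀ ^ p := Real.rpow_le_rpow hR hRR hp0
  have n1 : ‖psdPow M p‖ ≤ d * R ^ p := norm_psdPow_le hM hp0 hMR
  have n2 : ‖psdPow D p‖ ≤ d * R ^ p := norm_psdPow_le hD hp0 hDR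
  have hb : (d : ℝ) * R ^ p ≤ d * R₀ ^ p := by gcongr
  have n3 := norm_psdPow_sub_le hM hD hp hR hMR hDR
  have l1 := hGL (psdPow M p) 0 (n1.trans hb) (by simpa using hρ)
  have l2 := hGL (psdPow M p) (psdPow D p) (n1.trans hb) (n2.trans hb)
  rw [sub_zero] at l1
  have s1 := norm_mul_le_spectralNorm (matGrad f 0) (psdPow M p - psdPow D p)
  have s2 := norm_mul_le_spectralNorm' hG0 (psdPow M p - psdPow D p)
  set μ := spectralNorm₂ (matGrad f 0)
  set y := p * R ^ (p - 1) * ‖M - D‖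
  have hy : 0 ≤ y := by positivity
  simp only [rootField]
  change ‖-(matGrad f (psdPow M p) * psdPow M p + psdPow M p * matGrad f (psdPow M p)) -
    -(matGrad f (psdPow D p) * psdPow D p + psdPow D p * matGrad f (psdPow D p))‖ ≤ _ ∧
    ‖-(matGrad f (psdPow M p) * psdPow M p + psdPow M p * matGrad f (psdPow M p)) - _‖ ≤ _
  generalize psdPow M p = W at *
  generalize psdPow D p = V at *
  generalize matGrad f W = G at *
  generalize matGrad f V = H at *
  generalize matGrad f 0 = G₀ at *
  have a1 : ‖(G - G₀) * (W - V)‖ ≤ C₀ * (d * R ^ p) * y :=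
    (norm_mul_le _ _).trans (by gcongr; exact l1.trans (by gcongr))
  have a2 : ‖(W - V) * (G - G₀)‖ ≤ C₀ * (d * R ^ p) * y :=
    (norm_mul_le _ _).trans (by rw [mul_comm]; gcongr; exact l1.trans (by gcongr))
  have a3 : ‖(G - H) * V‖ ≤ C₀ * (d * R ^ p) * y :=
    (norm_mul_le _ _).trans (by
      calc _ ≤ (C₀ * y) * (d * R ^ p) := by gcongr; exact l2.trans (by gcongr)
        _ = _ := by ring)
  have a4 : ‖V * (G - H)‖ ≤ C₀ * (d * R ^ p) * y :=
    (norm_mul_le _ _).trans (by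
      calc _ ≤ (d * R ^ p) * (C₀ * y) := by gcongr; exact l2.trans (by gcongr)
        _ = _ := by ring)
  have a5 : ‖(G - G₀) * W‖ ≤ C₀ * (d * R ^ p) * (d * R ^ p) :=
    (norm_mul_le _ _).trans (by gcongr; exact l1.trans (by gcongr))
  have a6 : ‖W * (G - G₀)‖ ≤ C₀ * (d * R ^ p) * (d * R ^ p) :=
    (norm_mul_le _ _).trans (by rw [mul_comm]; gcongr; exact l1.trans (by gcongr))
  have s1' : ‖G₀ * (W - V)‖ ≤ μ * y := s1.trans (by gcongr)
  have s2' : ‖(W - V) * G₀‖ ≤ μ * y := s2.trans (by gcongr)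
  have hd0 : (0 : ℝ) ≤ d := Nat.cast_nonneg d
  constructor
  · have e : -(G * W + W * G) - -(H * V + V * H) = -((G₀ * (W - V) + (G - G₀) * (W - V) + (G - H) * V) +
        ((W - V) * G₀ + (W - V) * (G - G₀) + V * (G - H))) := by noncomm_ring
    rw [e, norm_neg]
    refine (norm_add_le _ _).trans ?_
    have b1 := norm_add₃_le (a := G₀ * (W - V)) (b := (G - G₀) * (W - V)) (c := (G - H) * V)
    have b2 := norm_add₃_le (a := (W - V) * G₀) (b := (W - V) * (G - G₀)) (c := V * (G - H))
    have b3 : 0 ≤ (2 * C₀ * d * d + 1) * R ^ p * y := by positivity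
    nlinarith
  · have e : -(G * W + W * G) - -(G₀ * V + V * G₀) = -((G₀ * (W - V) + (G - G₀) * W) +
        ((W - V) * G₀ + W * (G - G₀))) := by noncomm_ring
    rw [e, norm_neg]
    refine (norm_add_le _ _).trans ?_
    have b1 := norm_add_le (G₀ * (W - V)) ((G - G₀) * W)
    have b2 := norm_add_le ((W - V) * G₀) (W * (G - G₀))
    have b3 : 0 ≤ (4 * C₀ * d + 1) * (R ^ p * R ^ p) := by positivity
    nlinarith

/-- Continuous dependence on the initial value, on a compact time interval. -/
theorem IsRootFlow.exists_forall_norm_sub_lt (hL : 3 ≤ L) (hf : ContDiff ℝ 3 f)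
    (hsym : ∀ W, f W.transpose = f W) {N : ℝ → Matrix (Fin d) (Fin d) ℝ} {a b : ℝ}
    (hN : IsRootFlow f L N a) {e : ℝ} (he : 0 < e) :
    ∃ δ, 0 < δ ∧ ∀ M, IsRootFlow f L M a → ‖M a - N a‖ < δ → ∀ s ∈ Set.Icc a b, ‖M s - N s‖ < e := by
  obtain ⟨R, hR⟩ := isCompact_Icc.exists_bound_of_continuousOn
    (hN.continuousOn.mono (Set.Icc_subset_Ici_self : Set.Icc a b ⊆ _))
  set R₁ := max R 0 + 1
  have hR₁ : 0 ≤ R₁ := by positivity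
  obtain ⟨C, hC, hF⟩ := exists_rootField_bounds (f := f) hL hf hsym hR₁
  set K := (2 * spectralNorm₂ (matGrad f 0) + C * R₁ ^ (L / 2 : ℝ)) * ((L / 2 : ℝ) * R₁ ^ (L / 2 - 1 : ℝ))
  have hμ : 0 ≤ spectralNorm₂ (matGrad f 0) := norm_nonneg _
  have hK : 0 ≤ K := by positivity
  -- The exponential factor pays for the growth over [a, b]. Staying below 1 as well keeps M in the
  -- ball of radius R₁, where K is a Lipschitz constant.
  set δ := min e 1 / 2 * Real.exp (-((K + 1) * (b - a)))
  have hδ : 0 < δ := by positivity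
  refine ⟨δ, hδ, fun M hM hMa => ?_⟩
  have hBlt : ∀ s ∈ Set.Icc a b, δ * Real.exp ((K + 1) * (s - a)) < min e 1 := by
    intro s hs
    rw [show δ * Real.exp ((K + 1) * (s - a)) =
      min e 1 / 2 * Real.exp (-((K + 1) * (b - a)) + (K + 1) * (s - a)) by
        rw [Real.exp_add, ← mul_assoc]]
    have : Real.exp (-((K + 1) * (b - a)) + (K + 1) * (s - a)) ≤ 1 := by
      rw [Real.exp_le_one_iff]; nlinarith [hs.2]
    have hm : 0 < min e 1 := by positivity
    nlinarith
  have key := image_norm_le_of_norm_deriv_right_lt_deriv_boundary' (a := a) (b := b)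
    (f := fun s => M s - N s) (f' := fun s => rootField f L (M s) - rootField f L (N s))
    (B := fun s => δ * Real.exp ((K + 1) * (s - a)))
    (B' := fun s => δ * (Real.exp ((K + 1) * (s - a)) * (K + 1))) ?_ ?_ ?_ ?_ ?_ ?_
  · intro s hs
    exact ((key hs).trans_lt (hBlt s hs)).trans_le (min_le_left _ _)
  · exact (hM.continuousOn.mono Set.Icc_subset_Ici_self).sub (hN.continuousOn.mono Set.Icc_subset_Ici_self)
  · intro s hs
    exact ((hM.hasDerivWithinAt s hs.1).sub (hN.hasDerivWithinAt s hs.1)).mono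
      (Set.Ici_subset_Ici.mpr hs.1)
  · simpa using hMa.le
  · fun_prop
  · intro s _
    have h1 : HasDerivAt (fun s : ℝ => (K + 1) * (s - a)) (K + 1) s := by
      simpa using ((hasDerivAt_id s).sub_const a).const_mul (K + 1)
    exact (h1.exp.const_mul δ).hasDerivWithinAt
  · intro s hs heq
    have hs' : s ∈ Set.Icc a b := Set.Ico_subset_Icc_self hs
    have h1 : ‖M s - N s‖ < 1 := by
      rw [heq]; exact (hBlt s hs').trans_le (min_le_right _ _)
    have hNs : ‖N s‖ ≤ R₁ := by
      have h3 := (hR s hs').trans (le_max_left R 0)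
      simp only [R₁]; linarith
    have hMs : ‖M s‖ ≤ R₁ := by
      have h2 : ‖M s‖ ≤ ‖M s - N s‖ + ‖N s‖ := by
        simpa using norm_add_le (M s - N s) (N s)
      have h3 := (hR s hs').trans (le_max_left R 0)
      simp only [R₁]; linarith
    have h4 := (hF R₁ hR₁ le_rfl (M s) (N s) (hM.posSemidef s hs.1) (hN.posSemidef s hs.1)
      ((spectrum_subset_Icc_norm (hM.posSemidef s hs.1)).trans (Set.Icc_subset_Icc le_rfl hMs))
      ((spectrum_subset_Icc_norm (hN.posSemidef s hs.1)).trans (Set.Icc_subset_Icc le_rfl hNs))).1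
    rw [← mul_assoc] at h4
    refine h4.trans_lt ?_
    rw [heq]
    have : 0 < δ * Real.exp ((K + 1) * (s - a)) := by positivity
    change K * _ < _
    nlinarith

end Estimates

/-! ### The scalar escape profile -/

section Escape

/-- The solution `m(s) = (2 μ (p - 1) (-s)) ^ (-1 / (p - 1))` of `m' = 2 μ m ^ p` on `(-∞, 0)`. -/
noncomputable def escape (μ p s : ℝ) : ℝ := (2 * μ * (p - 1) * -s) ^ (-(p - 1)⁻¹)

variable {μ p : ℝ}

theorem escape_pos (hμ : 0 < μ) (hp : 1 < p) {s : ℝ} (hs : s < 0) : 0 < escape μ p s := by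
  have h1 : 0 < p - 1 := sub_pos.mpr hp
  have h2 : 0 < -s := neg_pos.mpr hs
  exact Real.rpow_pos_of_pos (by positivity) _

theorem hasDerivAt_escape (hμ : 0 < μ) (hp : 1 < p) {s : ℝ} (hs : s < 0) :
    HasDerivAt (escape μ p) (2 * μ * escape μ p s ^ p) s := by
  have h1 : 0 < p - 1 := sub_pos.mpr hp
  have h2 : 0 < -s := neg_pos.mpr hs
  have h3 : 0 < 2 * μ * (p - 1) * -s := by positivity
  have h4 : HasDerivAt (fun s : ℝ => 2 * μ * (p - 1) * -s) (2 * μ * (p - 1) * -1) s :=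
    (hasDerivAt_neg s).const_mul _
  refine (h4.rpow_const (p := -(p - 1)⁻¹) (Or.inl h3.ne')).congr_deriv ?_
  rw [escape, ← Real.rpow_mul h3.le]
  have e : -(p - 1)⁻¹ - 1 = -(p - 1)⁻¹ * p := by field_simp; ring
  rw [e]
  field_simp

theorem escape_mono (hμ : 0 < μ) (hp : 1 < p) {s t : ℝ} (hst : s ≤ t) (ht : t < 0) :
    escape μ p s ≤ escape μ p t := by
  have h1 : 0 < p - 1 := sub_pos.mpr hp
  have h2 : 0 < -t := neg_pos.mpr ht
  refine Real.rpow_le_rpow_of_nonpos (by positivity) ?_ (by have := inv_pos.mpr h1; linarith)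
  gcongr

theorem escape_eq (hμ : 0 < μ) (hp : 1 < p) {ρ : ℝ} (hρ : 0 < ρ) :
    escape μ p (-(ρ ^ (-(p - 1)) / (2 * μ * (p - 1)))) = ρ := by
  have h1 : 0 < p - 1 := sub_pos.mpr hp
  rw [escape, neg_neg, mul_div_cancel₀ _ (by positivity), ← Real.rpow_mul hρ.le]
  have : -(p - 1) * -(p - 1)⁻¹ = 1 := by field_simp
  rw [this, Real.rpow_one]

theorem exists_escape_le (hμ : 0 < μ) (hp : 1 < p) {m₀ : ℝ} (hm : 0 < m₀) :
    ∃ K, 0 < K ∧ ∀ s ≤ -K, escape μ p s ≤ m₀ := by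
  have h1 : 0 < p - 1 := sub_pos.mpr hp
  refine ⟨m₀ ^ (-(p - 1)) / (2 * μ * (p - 1)), by positivity, fun s hs => ?_⟩
  have h2 : 0 < m₀ ^ (-(p - 1)) / (2 * μ * (p - 1)) := by positivity
  have := escape_mono hμ hp hs (by linarith)
  rwa [escape_eq hμ hp hm] at this

end Escape

/-! ### Error and separation of orbits during the escape -/

section Tracking
variable {d : ℕ} {f : Matrix (Fin d) (Fin d) ℝ → ℝ} {L : ℕ} {μ : ℝ}

theorem rpow_split {m p : ℝ} (hm : 0 < m) :
    m ^ (p + 1) = m ^ p * m ∧ m ^ (p - 1) = m ^ p / m := by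
  exact ⟨Real.rpow_add_one hm.ne' p, Real.rpow_sub_one hm.ne' p⟩

/-- In the escape phase a root flow stays close to the solution `D` of the equation linearized
at the gradient: the error is `O(m ^ (p + 1))`, where `m` is the size of `D`. -/
theorem exists_tracking_bound (hL : 3 ≤ L) (hf : ContDiff ℝ 3 f) (hsym : ∀ W, f W.transpose = f W)
    (hμ : 0 < μ) (hnorm : spectralNorm₂ (matGrad f 0) = μ) :
    ∃ C m₀, 0 < C ∧ 0 < m₀ ∧ m₀ ≤ 1 ∧ ∀ (M D : ℝ → Matrix (Fin d) (Fin d) ℝ) (a b : ℝ),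
      b < 0 → escape μ (L / 2) b ≤ m₀ → IsRootFlow f L M a →
      (∀ s ∈ Set.Icc a b, (D s).PosSemidef ∧
        spectrum ℝ (D s) ⊆ Set.Icc 0 (escape μ (L / 2) s) ∧
        HasDerivWithinAt D (-(matGrad f 0 * psdPow (D s) (L / 2) + psdPow (D s) (L / 2) * matGrad f 0))
          (Set.Ici a) s) →
      M a = D a → ∀ s ∈ Set.Icc a b, ‖M s - D s‖ ≤ C * escape μ (L / 2) s ^ (L / 2 + 1 : ℝ) := by
  have hL' : (3 : ℝ) ≤ L := by exact_mod_cast hL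
  have hp : (1 : ℝ) < L / 2 := by linarith
  obtain ⟨C', hC', hF⟩ := exists_rootField_bounds (f := f) hL hf hsym zero_le_one
  rw [hnorm] at hF
  set p : ℝ := L / 2 with hpdef
  -- The barrier C m^(p+1) has slope 2μ(p+1)C m^(2p). The linearized error uses up 2μpC m^(2p) and
  -- the nonlinear remainder C' m^(2p), so C' < 2μC suffices at leading order; smallness of m
  -- handles the factors 1 + C m^p.
  set C := C' / μ + 1 with hC
  have hC0 : 0 < C := by positivity
  have hev : ∀ᶠ x : ℝ in 𝓝 0, 2 * μ * p * C * (1 + C * x) ^ (p - 1) +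
      C' * ((1 + C * x) ^ p * (1 + C * x) ^ p) < 2 * μ * (p + 1) * C ∧ 1 + C * x < 2 := by
    have c1 : ContinuousAt (fun x : ℝ => 1 + C * x) 0 := by fun_prop
    have c2 : ∀ q : ℝ, 0 ≤ q → ContinuousAt (fun x : ℝ => (1 + C * x) ^ q) 0 := fun q hq =>
      c1.rpow_const (Or.inr hq)
    have c3 : ContinuousAt (fun x : ℝ => 2 * μ * p * C * (1 + C * x) ^ (p - 1) +
      C' * ((1 + C * x) ^ p * (1 + C * x) ^ p)) 0 :=
      ((c2 (p - 1) (by linarith)).const_mul _).add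
        (((c2 p (by linarith)).mul (c2 p (by linarith))).const_mul _)
    refine (c3.eventually_lt continuousAt_const ?_).and (c1.eventually_lt continuousAt_const ?_)
    · simp only [mul_zero, add_zero, Real.one_rpow, mul_one]
      have : C' < 2 * μ * C := by rw [hC]; field_simp; linarith
      nlinarith
    · simp
  obtain ⟨x₀, hx₀, hball⟩ := Metric.eventually_nhds_iff.mp hev
  refine ⟨C, min (1 / 2) (x₀ / 2), hC0, by positivity,
    (min_le_left _ _).trans (by norm_num), fun M D a b hb hmb hM hD hMD => ?_⟩
  have hm : ∀ s ∈ Set.Icc a b, 0 < escape μ p s ∧ escape μ p s ≤ 1 / 2 ∧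
      0 < escape μ p s ^ p ∧ escape μ p s ^ p < x₀ := by
    intro s hs
    have h1 := escape_pos hμ hp (hs.2.trans_lt hb)
    have h2 := (escape_mono hμ hp hs.2 hb).trans hmb
    have h3 : escape μ p s ^ p ≤ escape μ p s ^ (1 : ℝ) :=
      Real.rpow_le_rpow_of_exponent_ge h1 (h2.trans ((min_le_left _ _).trans (by norm_num))) hp.le
    rw [Real.rpow_one] at h3
    exact ⟨h1, h2.trans (min_le_left _ _), Real.rpow_pos_of_pos h1 _,
      (h3.trans (h2.trans (min_le_right _ _))).trans_lt (by linarith)⟩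
  rcases lt_or_ge b a with hab | hab
  · intro s hs; exact absurd (hs.1.trans hs.2) (not_le.mpr hab)
  refine image_norm_le_of_norm_deriv_right_lt_deriv_boundary' (a := a) (b := b)
    (f := fun s => M s - D s) (f' := fun s => rootField f L (M s) -
      -(matGrad f 0 * psdPow (D s) p + psdPow (D s) p * matGrad f 0))
    (B := fun s => C * escape μ p s ^ (p + 1))
    (B' := fun s => C * (2 * μ * escape μ p s ^ p * (p + 1) * escape μ p s ^ (p + 1 - 1))) ?_ ?_ ?_ ?_ ?_ ?_
  · exact (hM.continuousOn.mono Set.Icc_subset_Ici_self).sub fun s hs =>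
      (hD s hs).2.2.continuousWithinAt.mono Set.Icc_subset_Ici_self
  · intro s hs
    exact ((hM.hasDerivWithinAt s hs.1).sub (hD s (Set.Ico_subset_Icc_self hs)).2.2).mono
      (Set.Ici_subset_Ici.mpr hs.1)
  · rw [hMD, sub_self, norm_zero]
    have := (hm a ⟨le_rfl, hab⟩).1
    positivity
  · intro s hs
    exact (((hasDerivAt_escape hμ hp (hs.2.trans_lt hb)).rpow_const
      (Or.inl (hm s hs).1.ne')).const_mul C).continuousAt.continuousWithinAt
  · intro s hs
    exact (((hasDerivAt_escape hμ hp (hs.2.trans hb)).rpow_const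
      (Or.inl (hm s (Set.Ico_subset_Icc_self hs)).1.ne')).const_mul C).hasDerivWithinAt
  · intro s hs heq
    have hs' : s ∈ Set.Icc a b := Set.Ico_subset_Icc_self hs
    obtain ⟨m0, m1, X0, X1⟩ := hm s hs'
    obtain ⟨hDp, hDs, -⟩ := hD s hs'
    obtain ⟨r1, r2⟩ := rpow_split (p := p) m0
    have hx := hball (y := escape μ p s ^ p) (by rw [dist_zero_right, Real.norm_eq_abs, abs_of_pos X0]; exact X1)
    rw [r1] at heq
    rw [add_sub_cancel_right]
    set m := escape μ p s
    have hθ0 : 0 < 1 + C * m ^ p := by positivity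
    have hR : m * (1 + C * m ^ p) ≤ 1 := by nlinarith [hx.2]
    have hspec : spectrum ℝ (M s) ⊆ Set.Icc 0 (m * (1 + C * m ^ p)) := fun x hx => by
      refine ⟨(Matrix.posSemidef_iff_isHermitian_and_spectrum_nonneg.mp (hM.posSemidef s hs.1)).2 hx, ?_⟩
      have := spectrum_le_add_norm (hM.posSemidef s hs.1).1 hDp.1 (m := m) (fun y hy => (hDs hy).2) x hx
      rw [heq] at this
      linarith
    have hDs' : spectrum ℝ (D s) ⊆ Set.Icc 0 (m * (1 + C * m ^ p)) :=
      hDs.trans (Set.Icc_subset_Icc le_rfl (by nlinarith [mul_pos m0 (mul_pos hC0 X0)]))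
    have h1 := (hF _ (by positivity) hR (M s) (D s) (hM.posSemidef s hs.1) hDp hspec hDs').2
    refine h1.trans_lt ?_
    rw [heq, Real.mul_rpow m0.le hθ0.le, Real.mul_rpow m0.le hθ0.le, r2]
    generalize m ^ p = X at *
    generalize (1 + C * X) ^ p = Y at *
    generalize (1 + C * X) ^ (p - 1) = Z at *
    have e1 : 2 * μ * (p * (X / m * Z) * (C * (X * m))) + C' * (X * Y * (X * Y)) =
        X ^ 2 * (2 * μ * p * C * Z + C' * (Y * Y)) := by field_simp
    have e2 : C * (2 * μ * X * (p + 1) * X) = X ^ 2 * (2 * μ * (p + 1) * C) := by ring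
    rw [e1, e2]
    exact mul_lt_mul_of_pos_left hx.1 (by positivity)

/-- Two root flows of the size of the escape profile separate at most like its `p`-th power. -/
theorem exists_separation_bound (hL : 3 ≤ L) (hf : ContDiff ℝ 3 f) (hsym : ∀ W, f W.transpose = f W)
    (hμ : 0 < μ) (hnorm : spectralNorm₂ (matGrad f 0) = μ) {C₁ : ℝ} (hC₁ : 0 < C₁) :
    ∃ C m₀, 0 < C ∧ 0 < m₀ ∧ m₀ ≤ 1 ∧ ∀ (M N : ℝ → Matrix (Fin d) (Fin d) ℝ) (a b δ : ℝ),
      b < 0 → escape μ (L / 2) b ≤ m₀ → IsRootFlow f L M a → IsRootFlow f L N a →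
      (∀ s ∈ Set.Icc a b,
        spectrum ℝ (M s) ⊆ Set.Icc 0 (escape μ (L / 2) s * (1 + C₁ * escape μ (L / 2) s ^ (L / 2 : ℝ))) ∧
        spectrum ℝ (N s) ⊆ Set.Icc 0 (escape μ (L / 2) s * (1 + C₁ * escape μ (L / 2) s ^ (L / 2 : ℝ)))) →
      0 < δ → ‖M a - N a‖ ≤ δ → ∀ s ∈ Set.Icc a b,
        ‖M s - N s‖ ≤ C * (escape μ (L / 2) s ^ (L / 2 : ℝ) / escape μ (L / 2) a ^ (L / 2 : ℝ)) * δ := by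
  have hL' : (3 : ℝ) ≤ L := by exact_mod_cast hL
  have hp : (1 : ℝ) < L / 2 := by linarith
  obtain ⟨C', hC', hF⟩ := exists_rootField_bounds (f := f) hL hf hsym zero_le_one
  rw [hnorm] at hF
  set p : ℝ := L / 2 with hpdef
  set k := p * 2 ^ (p - 1) * C₁ with hk
  have hk0 : 0 < k := by positivity
  -- The separation grows at the rate 2μp m^(p-1), that of m^p, up to a relative error O(m^p). The
  -- barrier m^p exp(C₂ m^p) absorbs this error at the cost of a bounded factor; C₂ is read off from
  -- (2μ + C' 2^p X)(1 + kX) < 2μ(1 + C₂X) for X = m^p ≤ 1.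
  set C₂ := (2 * μ * k + C' * 2 ^ p + k * (C' * 2 ^ p) + 1) / (2 * μ) with hC₂
  have hC₂0 : 0 < C₂ := by positivity
  refine ⟨Real.exp C₂, min (1 / 2) (1 / C₁), by positivity, by positivity,
    (min_le_left _ _).trans (by norm_num), fun M N a b δ hb hmb hM hN hspec hδ hMN => ?_⟩
  have hm : ∀ s ∈ Set.Icc a b, 0 < escape μ p s ∧ escape μ p s ≤ 1 / 2 ∧
      0 < escape μ p s ^ p ∧ escape μ p s ^ p ≤ 1 ∧ C₁ * escape μ p s ^ p ≤ 1 := by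
    intro s hs
    have h1 := escape_pos hμ hp (hs.2.trans_lt hb)
    have h2 := (escape_mono hμ hp hs.2 hb).trans hmb
    have h3 : escape μ p s ^ p ≤ escape μ p s ^ (1 : ℝ) :=
      Real.rpow_le_rpow_of_exponent_ge h1 (h2.trans ((min_le_left _ _).trans (by norm_num))) hp.le
    rw [Real.rpow_one] at h3
    have h4 := h2.trans (min_le_left _ _)
    have h5 := (h3.trans h2).trans (min_le_right _ _)
    refine ⟨h1, h4, Real.rpow_pos_of_pos h1 _, by linarith, ?_⟩
    rwa [le_div_iff₀ hC₁, mul_comm] at h5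
  rcases lt_or_ge b a with hab | hab
  · intro s hs; exact absurd (hs.1.trans hs.2) (not_le.mpr hab)
  obtain ⟨ma0, -, Xa0, Xa1, -⟩ := hm a ⟨le_rfl, hab⟩
  set c := δ / escape μ p a ^ p with hc
  have hc0 : 0 < c := by positivity
  have hX' : ∀ s ∈ Set.Icc a b, HasDerivAt (fun s => escape μ p s ^ p)
      (2 * μ * p * (escape μ p s ^ p) ^ 2 / escape μ p s) s := by
    intro s hs
    have h1 := (hasDerivAt_escape hμ hp (hs.2.trans_lt hb)).rpow_const (p := p) (Or.inl (hm s hs).1.ne')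
    refine h1.congr_deriv ?_
    rw [(rpow_split (hm s hs).1).2]
    ring
  have hB' : ∀ s ∈ Set.Icc a b, HasDerivAt
      (fun s => c * (escape μ p s ^ p * Real.exp (C₂ * escape μ p s ^ p)))
      (c * (2 * μ * p * (escape μ p s ^ p) ^ 2 / escape μ p s * Real.exp (C₂ * escape μ p s ^ p) +
        escape μ p s ^ p * (Real.exp (C₂ * escape μ p s ^ p) *
          (C₂ * (2 * μ * p * (escape μ p s ^ p) ^ 2 / escape μ p s))))) s := fun s hs =>
    ((hX' s hs).mul ((hX' s hs).const_mul C₂).exp).const_mul c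
  have key := image_norm_le_of_norm_deriv_right_lt_deriv_boundary' (a := a) (b := b)
    (f := fun s => M s - N s) (f' := fun s => rootField f L (M s) - rootField f L (N s))
    (B := fun s => c * (escape μ p s ^ p * Real.exp (C₂ * escape μ p s ^ p)))
    (B' := fun s => c * (2 * μ * p * (escape μ p s ^ p) ^ 2 / escape μ p s * Real.exp (C₂ * escape μ p s ^ p) +
        escape μ p s ^ p * (Real.exp (C₂ * escape μ p s ^ p) *
          (C₂ * (2 * μ * p * (escape μ p s ^ p) ^ 2 / escape μ p s))))) ?_ ?_ ?_ ?_ ?_ ?_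
  · intro s hs
    obtain ⟨m0, m1, X0, X1, X2⟩ := hm s hs
    refine (key hs).trans ?_
    have : Real.exp (C₂ * escape μ p s ^ p) ≤ Real.exp C₂ := Real.exp_le_exp.mpr (by nlinarith)
    calc c * (escape μ p s ^ p * Real.exp (C₂ * escape μ p s ^ p))
        ≤ c * (escape μ p s ^ p * Real.exp C₂) := by gcongr
      _ = _ := by rw [hc]; ring
  · exact (hM.continuousOn.mono Set.Icc_subset_Ici_self).sub (hN.continuousOn.mono Set.Icc_subset_Ici_self)
  · intro s hs
    exact ((hM.hasDerivWithinAt s hs.1).sub (hN.hasDerivWithinAt s hs.1)).mono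
      (Set.Ici_subset_Ici.mpr hs.1)
  · refine hMN.trans ?_
    rw [← mul_assoc, hc, div_mul_cancel₀ _ Xa0.ne']
    exact le_mul_of_one_le_right hδ.le (Real.one_le_exp (by positivity))
  · exact fun s hs => (hB' s hs).continuousAt.continuousWithinAt
  · exact fun s hs => (hB' s (Set.Ico_subset_Icc_self hs)).hasDerivWithinAt
  · intro s hs heq
    have hs' : s ∈ Set.Icc a b := Set.Ico_subset_Icc_self hs
    obtain ⟨m0, m1, X0, X1, X2⟩ := hm s hs'
    obtain ⟨hMs, hNs⟩ := hspec s hs'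
    have r2 := (rpow_split (p := p) m0).2
    set m := escape μ p s
    have hθ1 : 1 ≤ 1 + C₁ * m ^ p := by have := mul_pos hC₁ X0; linarith
    have hθ2 : 1 + C₁ * m ^ p ≤ 2 := by linarith
    have hθ0 : 0 < 1 + C₁ * m ^ p := by linarith
    have h1 := (hF _ (by positivity) (by nlinarith) (M s) (N s) (hM.posSemidef s hs.1)
      (hN.posSemidef s hs.1) hMs hNs).1
    refine h1.trans_lt ?_
    have hY : (1 + C₁ * m ^ p) ^ p ≤ 2 ^ p := Real.rpow_le_rpow hθ0.le hθ2 (by linarith)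
    have hZ : (1 + C₁ * m ^ p) ^ (p - 1) ≤ 1 + k * m ^ p := by
      have z1 : (1 + C₁ * m ^ p) ^ (p - 1) ≤ (1 + C₁ * m ^ p) ^ p :=
        Real.rpow_le_rpow_of_exponent_le hθ1 (by linarith)
      have z2 := abs_rpow_sub_rpow_le hp.le (R := 2) (x := 1 + C₁ * m ^ p) (y := 1)
        ⟨hθ0.le, hθ2⟩ ⟨zero_le_one, one_le_two⟩
      rw [Real.one_rpow, add_sub_cancel_left, abs_of_pos (mul_pos hC₁ X0)] at z2
      have z3 := (abs_le.mp z2).2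
      rw [hk]; linarith
    have hY0 : 0 < (1 + C₁ * m ^ p) ^ p := Real.rpow_pos_of_pos hθ0 _
    have hZ0 : 0 < (1 + C₁ * m ^ p) ^ (p - 1) := Real.rpow_pos_of_pos hθ0 _
    have h2p : (0 : ℝ) < 2 ^ p := by positivity
    rw [heq, Real.mul_rpow m0.le hθ0.le, Real.mul_rpow m0.le hθ0.le, r2]
    have hE : 0 < Real.exp (C₂ * m ^ p) := Real.exp_pos _
    generalize Real.exp (C₂ * m ^ p) = E at *
    generalize m ^ p = X at *
    generalize (1 + C₁ * X) ^ p = Y at *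
    generalize (1 + C₁ * X) ^ (p - 1) = Z at *
    have e1 : (2 * μ + C' * (X * Y)) * (p * (X / m * Z) * (c * (X * E))) =
        c * E * p * X ^ 2 / m * ((2 * μ + C' * (X * Y)) * Z) := by field_simp
    have e2 : c * (2 * μ * p * X ^ 2 / m * E + X * (E * (C₂ * (2 * μ * p * X ^ 2 / m)))) =
        c * E * p * X ^ 2 / m * (2 * μ * (1 + C₂ * X)) := by field_simp
    rw [e1, e2]
    refine mul_lt_mul_of_pos_left ?_ (by positivity)
    have e3 : 2 * μ * (1 + C₂ * X) = 2 * μ + (2 * μ * k + C' * 2 ^ p + k * (C' * 2 ^ p) + 1) * X := by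
      rw [hC₂]; field_simp
    rw [e3]
    calc (2 * μ + C' * (X * Y)) * Z ≤ (2 * μ + C' * (X * 2 ^ p)) * (1 + k * X) := by gcongr
      _ = 2 * μ + (2 * μ * k + C' * 2 ^ p) * X + k * (C' * 2 ^ p) * X * X := by ring
      _ ≤ 2 * μ + (2 * μ * k + C' * 2 ^ p) * X + k * (C' * 2 ^ p) * X * 1 := by gcongr
      _ < _ := by nlinarith

end Tracking

/-! ### The spectral gap of the gradient at 0 -/

section SpectralGap
variable {d : ℕ}

/-- The symmetric matrix `A` has the simple top eigenvalue `μ`, with unit eigenvector `v` and with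
a gap `γ` below it; `U` diagonalizes `A`. -/
structure SpectralGap (A : Matrix (Fin d) (Fin d) ℝ) (μ : ℝ) (v : Fin d → ℝ)
    (U : Matrix (Fin d) (Fin d) ℝ) (a : Fin d → ℝ) (i₀ : Fin d) (γ : ℝ) : Prop where
  diagonalizes : Diagonalizes A U a
  top : a i₀ = μ
  gap : ∀ i, i ≠ i₀ → a i ≤ μ - γ
  pos : 0 < γ
  le : γ ≤ μ
  proj : Diagonalizes (vecMulVec v v) U (Pi.single i₀ 1)

/-- The coordinates y of v in the eigenbasis satisfy (a i - μ) y i = 0, and the gap kills all but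
one of them. Thus vvᵀ is the projector to the top eigenvector and is diagonalized by the same U. -/
theorem exists_spectralGap [NeZero d] {A : Matrix (Fin d) (Fin d) ℝ} (hA : A.IsHermitian) {μ : ℝ}
    (hμ : μ = eigDesc A 0) (hpos : 0 < μ) (hgap : ∀ h : 1 < d, eigDesc A ⟨1, h⟩ < μ)
    {v : Fin d → ℝ} (hv : v ⬝ᵥ v = 1) (hvtop : A.mulVec v = μ • v) :
    ∃ U a i₀ γ, SpectralGap A μ v U a i₀ γ := by
  obtain ⟨U, hU, -⟩ := Diagonalizes.exists_of_isHermitian hA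
  set e : Fin (Fintype.card (Fin d)) ≃ Fin d := Fintype.equivOfCardEq (Fintype.card_fin _) with he
  have hev : ∀ k, hA.eigenvalues (e k) = hA.eigenvalues₀ k := fun k => by
    simp [Matrix.IsHermitian.eigenvalues, he]
  have hdesc : ∀ k, eigDesc A k = hA.eigenvalues₀ (Fin.cast (Fintype.card_fin d).symm k) := fun k => by
    rw [eigDesc, dif_pos hA]
  set i₀ : Fin d := e (Fin.cast (Fintype.card_fin d).symm 0) with hi₀
  have htop : hA.eigenvalues i₀ = μ := by rw [hi₀, hev, hμ, hdesc]
  obtain ⟨γ, hγ0, hγμ, hγ⟩ : ∃ γ, 0 < γ ∧ γ ≤ μ ∧ ∀ i, i ≠ i₀ → hA.eigenvalues i ≤ μ - γ := by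
    rcases lt_or_ge 1 d with h | h
    -- The minimum with μ secures γ ≤ μ also when the second eigenvalue is negative, so that μ - γ
    -- remains nonnegative.
    · refine ⟨min (μ - eigDesc A ⟨1, h⟩) μ, lt_min (sub_pos.mpr (hgap h)) hpos, min_le_right _ _,
        fun i hi => ?_⟩
      obtain ⟨k, rfl⟩ := e.surjective i
      have hk : (k : ℕ) ≠ 0 := fun hk => hi (by
        rw [hi₀]; congr 1; ext; simp [hk])
      have h1 : hA.eigenvalues₀ k ≤ hA.eigenvalues₀ (Fin.cast (Fintype.card_fin d).symm ⟨1, h⟩) :=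
        hA.eigenvalues₀_antitone (by rw [Fin.le_def]; simp; omega)
      rw [hev]
      rw [← hdesc] at h1
      linarith [min_le_left (μ - eigDesc A ⟨1, h⟩) μ]
    · refine ⟨μ, hpos, le_rfl, fun i hi => absurd ?_ hi⟩
      have : d = 1 := le_antisymm h (Nat.one_le_iff_ne_zero.mpr (NeZero.ne d))
      ext; omega
  refine ⟨U, hA.eigenvalues, i₀, γ, hU, htop, hγ, hγ0, hγμ, hU.orth, ?_⟩
  set y := Uᵀ *ᵥ v with hy
  have hUy : U *ᵥ y = v := by rw [hy, mulVec_mulVec, hU.orth', one_mulVec]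
  have hyy : y ⬝ᵥ y = 1 := by
    rw [hy, dotProduct_mulVec, vecMul_transpose, mulVec_mulVec, hU.orth', one_mulVec, hv]
  have hay : ∀ i, hA.eigenvalues i * y i = μ * y i := fun i => by
    have h1 : Uᵀ *ᵥ (A *ᵥ v) = diagonal hA.eigenvalues *ᵥ y := by
      conv_lhs => rw [hU.eq]
      rw [← mulVec_mulVec, ← mulVec_mulVec, mulVec_mulVec, hU.orth, one_mulVec]
    rw [hvtop, mulVec_smul, ← hy] at h1
    have h2 := congrFun h1 i
    rw [mulVec_diagonal] at h2
    simpa using h2.symm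
  have hy0 : ∀ i, i ≠ i₀ → y i = 0 := fun i hi => by
    have h1 := hγ i hi
    have h2 := hay i
    by_contra h3
    have := mul_right_cancel₀ h3 h2
    linarith
  have hy1 : y i₀ * y i₀ = 1 := by
    rw [dotProduct, Finset.sum_eq_single i₀] at hyy
    · exact hyy
    · intro i _ hi; simp [hy0 i hi]
    · simp
  have h1 : vecMulVec y y = diagonal (Pi.single i₀ 1) := by
    ext i j
    rw [vecMulVec_apply]
    by_cases hi : i = i₀
    · by_cases hj : j = i₀
      · subst hi; rw [hj, hy1]; simp
      · rw [hy0 j hj, mul_zero, diagonal_apply_ne]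
        rintro rfl; exact hj hi
    · rw [hy0 i hi, zero_mul]
      by_cases hij : i = j
      · subst hij; simp [hi]
      · rw [diagonal_apply_ne _ hij]
  rw [← h1, mul_vecMulVec, vecMulVec_mul, vecMul_transpose, hUy]

end SpectralGap

/-! ### Scalar equations for the other eigenvalues -/

section LinearEscape
variable {μ p : ℝ}

/-- The solution of `l' = 2 a l ^ p` that takes at time `-T` the same value as `escape μ p`. -/
noncomputable def linearEscape (μ p T a s : ℝ) : ℝ :=
  (2 * (p - 1) * (μ * T - a * (s + T))) ^ (-(p - 1)⁻¹)

theorem linearEscape_self (T s : ℝ) : linearEscape μ p T μ s = escape μ p s := by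
  rw [linearEscape, escape]; congr 1; ring

theorem linearEscape_neg (T a : ℝ) : linearEscape μ p T a (-T) = escape μ p (-T) := by
  rw [linearEscape, escape]; congr 1; ring

variable {T a s : ℝ}

theorem linearEscape_base_pos (hμ : 0 < μ) (ha : a ≤ μ) (h1 : -T ≤ s) (h2 : s < 0) :
    0 < μ * T - a * (s + T) := by nlinarith

theorem linearEscape_pos (hμ : 0 < μ) (hp : 1 < p) (ha : a ≤ μ) (h1 : -T ≤ s) (h2 : s < 0) :
    0 < linearEscape μ p T a s := by
  have h3 : 0 < p - 1 := sub_pos.mpr hp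
  have h4 := linearEscape_base_pos hμ ha h1 h2
  exact Real.rpow_pos_of_pos (by positivity) _

theorem hasDerivAt_linearEscape (hμ : 0 < μ) (hp : 1 < p) (ha : a ≤ μ) (h1 : -T ≤ s) (h2 : s < 0) :
    HasDerivAt (linearEscape μ p T a) (2 * a * linearEscape μ p T a s ^ p) s := by
  have h3 : 0 < p - 1 := sub_pos.mpr hp
  have h4 := linearEscape_base_pos hμ ha h1 h2
  have h5 : 0 < 2 * (p - 1) * (μ * T - a * (s + T)) := by positivity
  have h6 : HasDerivAt (fun s : ℝ => 2 * (p - 1) * (μ * T - a * (s + T))) (2 * (p - 1) * (-(a * 1))) s :=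
    ((((hasDerivAt_id s).add_const T).const_mul a).const_sub _).const_mul _
  refine (h6.rpow_const (p := -(p - 1)⁻¹) (Or.inl h5.ne')).congr_deriv ?_
  rw [linearEscape, ← Real.rpow_mul h5.le]
  have e : -(p - 1)⁻¹ - 1 = -(p - 1)⁻¹ * p := by field_simp; ring
  rw [e]
  field_simp

theorem linearEscape_le (hμ : 0 < μ) (hp : 1 < p) (ha : a ≤ μ) (h1 : -T ≤ s) (h2 : s < 0) :
    linearEscape μ p T a s ≤ escape μ p s := by
  have h3 : 0 < p - 1 := sub_pos.mpr hp
  rw [← linearEscape_self T]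
  have h4 := linearEscape_base_pos hμ le_rfl h1 h2
  refine Real.rpow_le_rpow_of_nonpos (by positivity) ?_ (by have := inv_pos.mpr h3; linarith)
  have : 0 ≤ s + T := by linarith
  gcongr

/-- With a smaller eigenvalue the blow-up comes later: until time 0 the base of the power keeps at
least the fraction γ/μ of its initial value, so the solution stays within a constant factor of its
initial size. -/
theorem linearEscape_le_of_gap (hp : 1 < p) {γ : ℝ} (hγ : 0 < γ) (hγμ : γ ≤ μ)
    (ha : a ≤ μ - γ) (h1 : -T ≤ s) (h2 : s < 0) :
    linearEscape μ p T a s ≤ (γ / μ) ^ (-(p - 1)⁻¹) * escape μ p (-T) := by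
  have h3 : 0 < p - 1 := sub_pos.mpr hp
  have hT : 0 < T := by linarith
  have hμ : 0 < μ := hγ.trans_le hγμ
  rw [escape, ← Real.mul_rpow (by positivity) (by rw [neg_neg]; positivity)]
  have e : γ / μ * (2 * μ * (p - 1) * - -T) = 2 * (p - 1) * (γ * T) := by field_simp
  rw [e]
  refine Real.rpow_le_rpow_of_nonpos (by positivity) ?_ (by have := inv_pos.mpr h3; linarith)
  have : γ * T ≤ μ * T - a * (s + T) := by nlinarith
  gcongr

end LinearEscape

/-! ### Orbits that start at a multiple of a spectral projector -/

section Orbits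
variable {d : ℕ} {f : Matrix (Fin d) (Fin d) ℝ → ℝ} {L : ℕ} {μ : ℝ} {v : Fin d → ℝ}
  {U : Matrix (Fin d) (Fin d) ℝ} {a : Fin d → ℝ} {i₀ : Fin d} {γ : ℝ}

/-- Conjugation of a diagonal matrix, as a continuous linear map of the diagonal. -/
noncomputable def conjDiagonal (U : Matrix (Fin d) (Fin d) ℝ) :
    (Fin d → ℝ) →L[ℝ] Matrix (Fin d) (Fin d) ℝ :=
  LinearMap.toContinuousLinearMap
    (LinearMap.mulRight ℝ Uᵀ ∘ₗ LinearMap.mulLeft ℝ U ∘ₗ Matrix.diagonalLinearMap (Fin d) ℝ ℝ)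

theorem conjDiagonal_apply (e : Fin d → ℝ) : conjDiagonal U e = U * diagonal e * Uᵀ := rfl

/-- A root flow that starts at `ε • X`, where `X` is a spectral projector of `-∇f(0)` that contains
the top eigenvector, stays close to the solution of the linearized equation. -/
theorem exists_orbit_tracking_bound (hL : 3 ≤ L) (hf : ContDiff ℝ 3 f)
    (hsym : ∀ W, f W.transpose = f W) (hμ : 0 < μ) (hnorm : spectralNorm₂ (matGrad f 0) = μ)
    (hS : SpectralGap (-matGrad f 0) μ v U a i₀ γ) :
    ∃ C m₀, 0 < C ∧ 0 < m₀ ∧ m₀ ≤ 1 ∧ ∀ (X : Matrix (Fin d) (Fin d) ℝ) (χ : Fin d → ℝ)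
      (M : ℝ → Matrix (Fin d) (Fin d) ℝ) (T b : ℝ), Diagonalizes X U χ →
      (∀ i, χ i = 0 ∨ χ i = 1) → χ i₀ = 1 → IsRootFlow f L M (-T) →
      M (-T) = escape μ (L / 2) (-T) • X → b < 0 → escape μ (L / 2) b ≤ m₀ →
      ∀ s ∈ Set.Icc (-T) b, ∃ D e, Diagonalizes D U e ∧
        ‖M s - D‖ ≤ C * escape μ (L / 2) s ^ (L / 2 + 1 : ℝ) ∧ e i₀ = escape μ (L / 2) s ∧
        (∀ i, 0 ≤ e i ∧ e i ≤ escape μ (L / 2) s) ∧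
        ∀ i, i ≠ i₀ → e i ≤ χ i * (C * escape μ (L / 2) (-T)) := by
  have hL' : (3 : ℝ) ≤ L := by exact_mod_cast hL
  have hp : (1 : ℝ) < L / 2 := by linarith
  obtain ⟨C, m₀, hC, hm₀, hm₁, hE⟩ := exists_tracking_bound hL hf hsym hμ hnorm
  set p : ℝ := L / 2 with hpdef
  have haμ : ∀ i, a i ≤ μ := fun i => by
    by_cases hi : i = i₀
    · rw [hi, hS.top]
    · linarith [hS.gap i hi, hS.pos]
  have hγ0 := hS.pos
  refine ⟨C + (γ / μ) ^ (-(p - 1)⁻¹), m₀, by positivity, hm₀, hm₁, fun X χ M T b hX hχ hχ₀ hM hM0 hb hmb => ?_⟩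
  intro s hs
  have hneg : ∀ r ∈ Set.Icc (-T) b, r < 0 := fun r hr => hr.2.trans_lt hb
  have hχ0 : ∀ i, 0 ≤ χ i := fun i => by rcases hχ i with h | h <;> rw [h]; norm_num
  have hχ1 : ∀ i, χ i ≤ 1 := fun i => by rcases hχ i with h | h <;> rw [h]; norm_num
  have hbd : ∀ r ∈ Set.Icc (-T) b, ∀ i, 0 ≤ χ i * linearEscape μ p T (a i) r ∧
      χ i * linearEscape μ p T (a i) r ≤ escape μ p r := fun r hr i => by
    have h1 := linearEscape_pos hμ hp (haμ i) hr.1 (hneg r hr)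
    have h2 := linearEscape_le hμ hp (haμ i) hr.1 (hneg r hr)
    exact ⟨mul_nonneg (hχ0 i) h1.le, by nlinarith [hχ1 i]⟩
  -- The initial value commutes with ∇f(0), so the linearized equation decouples into l' = 2 a_i l^p
  -- on the range of X; off this range the eigenvalue stays 0.
  have hDiag : ∀ r, Diagonalizes (conjDiagonal U fun i => χ i * linearEscape μ p T (a i) r) U
      (fun i => χ i * linearEscape μ p T (a i) r) := fun r => ⟨hS.diagonalizes.orth, rfl⟩
  have key := hE M (fun r => conjDiagonal U fun i => χ i * linearEscape μ p T (a i) r) (-T) b hb hmb hM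
    (fun r hr => ⟨(hDiag r).posSemidef fun i => (hbd r hr i).1, ?_, ?_⟩) ?_ s hs
  · refine ⟨_, _, hDiag s, key.trans ?_, ?_, fun i => hbd s hs i, fun i hi => ?_⟩
    · have := escape_pos hμ hp (hneg s hs)
      gcongr
      have : 0 ≤ (γ / μ) ^ (-(p - 1)⁻¹) := by positivity
      linarith
    · rw [hχ₀, one_mul, hS.top, linearEscape_self]
    · have h1 := linearEscape_le_of_gap hp hS.pos hS.le (hS.gap i hi) hs.1 (hneg s hs)
      have h2 := escape_pos hμ hp (hneg (-T) ⟨le_rfl, hs.1.trans hs.2⟩)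
      have := hχ0 i
      gcongr
      exact h1.trans (by nlinarith)
  · rw [(hDiag r).spectrum_eq]
    rintro _ ⟨i, rfl⟩
    exact hbd r hr i
  · have h1 : HasDerivAt (fun r i => χ i * linearEscape μ p T (a i) r)
        (fun i => χ i * (2 * a i * linearEscape μ p T (a i) r ^ p)) r :=
      hasDerivAt_pi.mpr fun i => (hasDerivAt_linearEscape hμ hp (haμ i) hr.1 (hneg r hr)).const_mul _
    have h2 := ((conjDiagonal U).hasFDerivAt.comp_hasDerivAt r h1).hasDerivWithinAt (s := Set.Ici (-T))
    refine h2.congr_deriv ?_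
    have h3 := (hDiag r).psdPow p
    have h4 : -(matGrad f 0 * psdPow (conjDiagonal U fun i => χ i * linearEscape μ p T (a i) r) p +
        psdPow (conjDiagonal U fun i => χ i * linearEscape μ p T (a i) r) p * matGrad f 0) =
        -matGrad f 0 * psdPow (conjDiagonal U fun i => χ i * linearEscape μ p T (a i) r) p +
        psdPow (conjDiagonal U fun i => χ i * linearEscape μ p T (a i) r) p * -matGrad f 0 := by
      noncomm_ring
    rw [h4, ((hS.diagonalizes.mul h3).add (h3.mul hS.diagonalizes)).eq]
    rw [conjDiagonal_apply]
    congr 3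
    funext i
    simp only [Pi.add_apply, Pi.mul_apply]
    rcases hχ i with h | h
    · rw [h, zero_mul, zero_mul, Real.zero_rpow (by linarith)]; ring
    · rw [h, one_mul, one_mul]; ring
  · rw [hM0]
    refine (hX.smul _).congr (hDiag _) (funext fun i => ?_)
    rw [linearEscape_neg, Pi.smul_apply, smul_eq_mul, mul_comm]

end Orbits

/-! ### The orbits of αvvᵀ and of αI during the escape -/

section RootOrbit
variable {d : ℕ} {f : Matrix (Fin d) (Fin d) ℝ → ℝ} {L : ℕ} {μ : ℝ} {v : Fin d → ℝ}
  {U : Matrix (Fin d) (Fin d) ℝ} {a : Fin d → ℝ} {i₀ : Fin d} {γ : ℝ}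

/-- The time that the rank-one trajectory needs to escape from `α • v vᵀ`. -/
noncomputable def delay (L : ℕ) (μ α : ℝ) : ℝ :=
  α ^ (-(1 - 1 / ((L : ℝ) / 2))) / (2 * μ * ((L : ℝ) / 2 - 1))

/-- The power `W ^ (2 / L)` of the solution that starts at `α • X`, with time counted from `delay`. -/
noncomputable def rootOrbit (f : Matrix (Fin d) (Fin d) ℝ → ℝ) (L : ℕ) (μ : ℝ)
    (X : Matrix (Fin d) (Fin d) ℝ) (α s : ℝ) : Matrix (Fin d) (Fin d) ℝ :=
  psdPow (flow f L (α • X) (delay L μ α + s)) (2 / L)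

theorem flow_spec (hflow : ∀ W₀ : Matrix (Fin d) (Fin d) ℝ, W₀.PosSemidef →
      ∃ W : ℝ → Matrix (Fin d) (Fin d) ℝ, IsEndToEndSolution f L W₀ W)
    {X : Matrix (Fin d) (Fin d) ℝ} (hX : X.PosSemidef) : IsEndToEndSolution f L X (flow f L X) :=
  Classical.epsilon_spec (hflow X hX)

theorem delay_eq (hL : 3 ≤ L) {α : ℝ} (hα : 0 < α) :
    delay L μ α = (α ^ (2 / L : ℝ)) ^ (-((L / 2 : ℝ) - 1)) / (2 * μ * ((L : ℝ) / 2 - 1)) := by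
  have hL' : (3 : ℝ) ≤ L := by exact_mod_cast hL
  rw [delay, ← Real.rpow_mul hα.le]
  congr 2
  field_simp

/-- The delay is exactly what makes the profile start at α^(2/L), the root of the initial size α. -/
theorem escape_neg_delay (hL : 3 ≤ L) (hμ : 0 < μ) {α : ℝ} (hα : 0 < α) :
    escape μ (L / 2) (-delay L μ α) = α ^ (2 / L : ℝ) := by
  have hL' : (3 : ℝ) ≤ L := by exact_mod_cast hL
  rw [delay_eq hL hα]
  exact escape_eq hμ (by linarith) (by positivity)

theorem delay_anti (hL : 3 ≤ L) (hμ : 0 < μ) {α β : ℝ} (hα : 0 < α) (h : α ≤ β) :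
    delay L μ β ≤ delay L μ α := by
  have hL' : (3 : ℝ) ≤ L := by exact_mod_cast hL
  have : 0 < (L : ℝ) / 2 - 1 := by linarith
  have h1 : -(1 - 1 / ((L : ℝ) / 2)) ≤ 0 := by
    have : 1 / ((L : ℝ) / 2) ≤ 1 := (div_le_one (by positivity)).mpr (by linarith)
    linarith
  have h2 := Real.rpow_le_rpow_of_nonpos hα h h1
  rw [delay, delay]
  gcongr

theorem tendsto_delay (hL : 3 ≤ L) (hμ : 0 < μ) : Tendsto (delay L μ) (𝓝[>] 0) atTop := by
  have hL' : (3 : ℝ) ≤ L := by exact_mod_cast hL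
  have h1 : 0 < (L : ℝ) / 2 - 1 := by linarith
  have h2 : -(1 - 1 / ((L : ℝ) / 2)) < 0 := by
    have : 1 / ((L : ℝ) / 2) < 1 := (div_lt_one (by positivity)).mpr (by linarith)
    linarith
  exact (tendsto_rpow_neg_nhdsGT_zero h2).atTop_div_const (by positivity)

theorem tendsto_rpow_nhdsGT_zero {y : ℝ} (hy : 0 < y) :
    Tendsto (fun α : ℝ => α ^ y) (𝓝[>] 0) (𝓝 0) := by
  have h := (Real.continuousAt_rpow_const 0 y (Or.inr hy.le)).tendsto
  rw [Real.zero_rpow hy.ne'] at h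
  exact h.mono_left nhdsWithin_le_nhds

theorem vecMulVec_mul_self (hv : v ⬝ᵥ v = 1) : vecMulVec v v * vecMulVec v v = vecMulVec v v := by
  rw [vecMulVec_mul_vecMulVec, hv, one_smul]

theorem trace_vecMulVec_self (hv : v ⬝ᵥ v = 1) : (vecMulVec v v).trace = 1 := by
  rw [trace_vecMulVec, hv]

theorem posSemidef_vecMulVec (v : Fin d → ℝ) : (vecMulVec v v).PosSemidef := by
  have := posSemidef_vecMulVec_self_star v
  simpa using this

theorem SpectralGap.unit (hS : SpectralGap (-matGrad f 0) μ v U a i₀ γ) : v ⬝ᵥ v = 1 := by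
  have := hS.proj.trace_eq
  rw [trace_vecMulVec] at this
  simpa using this

variable (hL : 3 ≤ L) (hf : ContDiff ℝ 3 f) (hsym : ∀ W, f W.transpose = f W)
  (hflow : ∀ W₀ : Matrix (Fin d) (Fin d) ℝ, W₀.PosSemidef →
      ∃ W : ℝ → Matrix (Fin d) (Fin d) ℝ, IsEndToEndSolution f L W₀ W)
include hL hf hsym hflow

theorem isRootFlow_rootOrbit_vecMulVec (hv : v ⬝ᵥ v = 1) {α : ℝ} (hα : 0 < α) :
    IsRootFlow f L (rootOrbit f L μ (vecMulVec v v) α) (-delay L μ α) := by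
  have h := (flow_spec hflow ((posSemidef_vecMulVec v).smul hα.le)).isRootFlow_of_rankOne hL hf hsym
    ((posSemidef_vecMulVec v).smul hα.le) ?_ ?_
  · have h1 := h.comp_add (delay L μ α)
    rw [zero_sub] at h1
    exact h1
  · rw [trace_smul, trace_vecMulVec_self hv, Matrix.smul_mul, Matrix.mul_smul, vecMulVec_mul_self hv]
    simp
  · rw [trace_smul, trace_vecMulVec_self hv]
    simpa

theorem isRootFlow_rootOrbit_one {α : ℝ} (hα : 0 < α) :
    IsRootFlow f L (rootOrbit f L μ (1 : Matrix (Fin d) (Fin d) ℝ) α) (-delay L μ α) := by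
  have h := ((flow_spec hflow (PosSemidef.one.smul hα.le)).isRootFlow_of_posDef hL hf hsym
    (PosDef.one.smul hα)).2
  have h1 := h.comp_add (delay L μ α)
  rw [zero_sub] at h1
  exact h1

omit hf hsym in
theorem rootOrbit_neg_delay (hμ : 0 < μ) {χ : Fin d → ℝ} {X : Matrix (Fin d) (Fin d) ℝ}
    (hX : Diagonalizes X U χ) (hχ : ∀ i, χ i = 0 ∨ χ i = 1) {α : ℝ} (hα : 0 < α) :
    rootOrbit f L μ X α (-delay L μ α) = escape μ (L / 2) (-delay L μ α) • X := by
  have hL' : (3 : ℝ) ≤ L := by exact_mod_cast hL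
  have hχ0 : ∀ i, 0 ≤ χ i := fun i => by rcases hχ i with h | h <;> rw [h]; norm_num
  rw [rootOrbit, add_neg_cancel, escape_neg_delay hL hμ hα,
    (flow_spec hflow ((hX.posSemidef hχ0).smul hα.le)).1]
  refine ((hX.smul α).psdPow _).congr (hX.smul _) (funext fun i => ?_)
  have : (0 : ℝ) < 2 / L := by positivity
  rcases hχ i with h | h <;> simp [h, Real.zero_rpow this.ne']

/-- Both the rank-one orbit and the orbit of the identity follow the escape profile. -/
theorem exists_rootOrbit_bounds (hμ : 0 < μ) (hnorm : spectralNorm₂ (matGrad f 0) = μ)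
    (hS : SpectralGap (-matGrad f 0) μ v U a i₀ γ) :
    ∃ C m₀, 0 < C ∧ 0 < m₀ ∧ m₀ ≤ 1 ∧ ∀ α b, 0 < α → b < 0 → escape μ (L / 2) b ≤ m₀ →
      ∀ s ∈ Set.Icc (-delay L μ α) b,
        ‖rootOrbit f L μ (vecMulVec v v) α s - escape μ (L / 2) s • vecMulVec v v‖ ≤
          C * escape μ (L / 2) s ^ (L / 2 + 1 : ℝ) ∧
        ‖rootOrbit f L μ 1 α s - escape μ (L / 2) s • vecMulVec v v‖ ≤
          C * (escape μ (L / 2) s ^ (L / 2 + 1 : ℝ) + α ^ (2 / L : ℝ)) ∧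
        spectrum ℝ (rootOrbit f L μ (vecMulVec v v) α s) ⊆
          Set.Icc 0 (escape μ (L / 2) s * (1 + C * escape μ (L / 2) s ^ (L / 2 : ℝ))) ∧
        spectrum ℝ (rootOrbit f L μ 1 α s) ⊆
          Set.Icc 0 (escape μ (L / 2) s * (1 + C * escape μ (L / 2) s ^ (L / 2 : ℝ))) := by
  have hL' : (3 : ℝ) ≤ L := by exact_mod_cast hL
  have hp : (1 : ℝ) < L / 2 := by linarith
  obtain ⟨C, m₀, hC, hm₀, hm₁, hE⟩ := exists_orbit_tracking_bound hL hf hsym hμ hnorm hS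
  have hv := hS.unit
  have hone : Diagonalizes (1 : Matrix (Fin d) (Fin d) ℝ) U 1 := hS.proj.one
  have hχ : ∀ i, (Pi.single i₀ 1 : Fin d → ℝ) i = 0 ∨ (Pi.single i₀ 1 : Fin d → ℝ) i = 1 := fun i => by
    by_cases h : i = i₀
    · right; rw [h]; simp
    · left; simp [h]
  have hχ1 : ∀ i : Fin d, (1 : Fin d → ℝ) i = 0 ∨ (1 : Fin d → ℝ) i = 1 := fun i => Or.inr rfl
  set p : ℝ := L / 2 with hpdef
  refine ⟨C + d * C, m₀, by positivity, hm₀, hm₁, fun α b hα hb hmb s hs => ?_⟩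
  have hM := isRootFlow_rootOrbit_vecMulVec (μ := μ) hL hf hsym hflow hv hα
  have hN := isRootFlow_rootOrbit_one (μ := μ) hL hf hsym hflow hα
  have m0 := escape_pos hμ hp (hs.2.trans_lt hb)
  have e0 : 0 ≤ escape μ p (-delay L μ α) := (escape_pos hμ hp ((hs.1.trans hs.2).trans_lt hb)).le
  obtain ⟨D, e, hD, hD1, hD2, hD3, hD4⟩ := hE _ _ _ _ b hS.proj hχ (by simp) hM
    (rootOrbit_neg_delay hL hflow hμ hS.proj hχ hα) hb hmb s hs
  obtain ⟨E, g, hE, hE1, hE2, hE3, hE4⟩ := hE _ _ _ _ b hone hχ1 rfl hN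
    (rootOrbit_neg_delay hL hflow hμ hone hχ1 hα) hb hmb s hs
  have hspec : ∀ (M D : Matrix (Fin d) (Fin d) ℝ) (e : Fin d → ℝ), M.PosSemidef → Diagonalizes D U e →
      ‖M - D‖ ≤ C * escape μ p s ^ (p + 1) → (∀ i, 0 ≤ e i ∧ e i ≤ escape μ p s) →
      spectrum ℝ M ⊆ Set.Icc 0 (escape μ p s * (1 + (C + d * C) * escape μ p s ^ p)) := by
    intro M D e hM hD h1 h2 x hx
    refine ⟨(Matrix.posSemidef_iff_isHermitian_and_spectrum_nonneg.mp hM).2 hx, ?_⟩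
    have h3 := spectrum_le_add_norm hM.1 hD.isHermitian (m := escape μ p s) (by
      rw [hD.spectrum_eq]; rintro _ ⟨i, rfl⟩; exact (h2 i).2) x hx
    rw [(rpow_split m0).1] at h1
    have : 0 ≤ d * C * (escape μ p s ^ p * escape μ p s) := by positivity
    nlinarith
  have hd : (0 : ℝ) ≤ d * C * escape μ p s ^ (p + 1) := by positivity
  refine ⟨?_, ?_, hspec _ D e (hM.posSemidef s hs.1) hD hD1 hD3, hspec _ E g (hN.posSemidef s hs.1) hE hE1 hE3⟩
  -- For the projector vvᵀ the bound on the other eigenvalues is 0, so the linearized solution is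
  -- exactly m vvᵀ.
  · have : D = escape μ p s • vecMulVec v v := hD.congr (hS.proj.smul _) (funext fun i => by
      by_cases h : i = i₀
      · rw [h, hD2]; simp
      · have h1 := hD4 i h
        rw [Pi.single_eq_of_ne h, zero_mul] at h1
        simp [le_antisymm h1 (hD3 i).1, h])
    rw [← this]
    refine hD1.trans ?_
    linarith
  · rw [← escape_neg_delay hL hμ hα]
    -- For the identity, subtracting m vvᵀ removes the top eigenvalue and leaves the ones held at
    -- O(α^(2/L)) by the gap.
    have h1 := hE.sub (hS.proj.smul (escape μ p s))
    have h2 : ∀ i, 0 ≤ (g - escape μ p s • (Pi.single i₀ 1 : Fin d → ℝ)) i ∧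
        (g - escape μ p s • (Pi.single i₀ 1 : Fin d → ℝ)) i ≤ C * escape μ p (-delay L μ α) := fun i => by
      by_cases h : i = i₀
      · rw [h, Pi.sub_apply, hE2]; simp; positivity
      · have h1 := hE4 i h
        have h2 := (hE3 i).1
        simp [h] at h1 ⊢
        exact ⟨h2, h1⟩
    have h3 := norm_le_sum_of_diagonalizes h1 fun i => (h2 i).1
    have h4 : ∑ i, (g - escape μ p s • (Pi.single i₀ 1 : Fin d → ℝ)) i ≤ d * (C * escape μ p (-delay L μ α)) :=
      (Finset.sum_le_sum fun i _ => (h2 i).2).trans (by simp)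
    have h5 := norm_sub_le_norm_sub_add_norm_sub (rootOrbit f L μ 1 α s) E (escape μ p s • vecMulVec v v)
    have : 0 ≤ C * escape μ p (-delay L μ α) := by positivity
    calc _ ≤ C * escape μ p s ^ (p + 1) + d * (C * escape μ p (-delay L μ α)) := by linarith
      _ ≤ _ := by nlinarith

/-- The rank-one orbits form a Cauchy family as `α → 0`, and the orbit of the identity approaches them. -/
theorem exists_rootOrbit_sub_bounds (hμ : 0 < μ) (hnorm : spectralNorm₂ (matGrad f 0) = μ)
    (hS : SpectralGap (-matGrad f 0) μ v U a i₀ γ) :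
    ∃ C m₀, 0 < C ∧ 0 < m₀ ∧ m₀ ≤ 1 ∧
      (∀ α b, 0 < α → b < 0 → escape μ (L / 2) b ≤ m₀ → -delay L μ α ≤ b →
        ‖rootOrbit f L μ (vecMulVec v v) α b - escape μ (L / 2) b • vecMulVec v v‖ ≤
          C * escape μ (L / 2) b ^ (L / 2 + 1 : ℝ)) ∧
      (∀ α β b, 0 < α → α ≤ β → b < 0 → escape μ (L / 2) b ≤ m₀ → -delay L μ β ≤ b →
        ‖rootOrbit f L μ (vecMulVec v v) α b - rootOrbit f L μ (vecMulVec v v) β b‖ ≤ C * β ^ (2 / L : ℝ)) ∧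
      (∀ α s b, 0 < α → b < 0 → escape μ (L / 2) b ≤ m₀ → -delay L μ α ≤ s → s ≤ b →
        escape μ (L / 2) s ^ (L / 2 + 1 : ℝ) = α ^ (2 / L : ℝ) →
        ‖rootOrbit f L μ 1 α s - escape μ (L / 2) s • vecMulVec v v‖ ≤ C * α ^ (2 / L : ℝ) ∧
        ‖rootOrbit f L μ 1 α b - rootOrbit f L μ (vecMulVec v v) α b‖ ≤ C * escape μ (L / 2) s) := by
  have hL' : (3 : ℝ) ≤ L := by exact_mod_cast hL
  have hp : (1 : ℝ) < L / 2 := by linarith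
  obtain ⟨C₁, m₁, hC₁, hm₁, hm₁', hB⟩ := exists_rootOrbit_bounds hL hf hsym hflow hμ hnorm hS
  obtain ⟨C₂, m₂, hC₂, hm₂, hm₂', hE⟩ := exists_separation_bound hL hf hsym hμ hnorm hC₁
  have hv := hS.unit
  have hχ : ∀ i, (Pi.single i₀ 1 : Fin d → ℝ) i = 0 ∨ (Pi.single i₀ 1 : Fin d → ℝ) i = 1 := fun i => by
    by_cases h : i = i₀
    · right; rw [h]; simp
    · left; simp [h]
  set p : ℝ := L / 2 with hpdef
  refine ⟨C₁ + 2 * C₁ + C₂ * C₁ + C₂ * (3 * C₁), min m₁ m₂, by positivity, by positivity,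
    (min_le_left _ _).trans hm₁', fun α b hα hb hmb hs => ?_, fun α β b hα hαβ hb hmb hs => ?_,
    fun α s b hα hb hmb hs hsb hse => ?_⟩
  · have h1 := (hB α b hα hb (hmb.trans (min_le_left _ _)) b ⟨hs, le_rfl⟩).1
    have : 0 < escape μ p b ^ (p + 1) := Real.rpow_pos_of_pos (escape_pos hμ hp hb) _
    refine h1.trans ?_
    gcongr
    have : 0 < C₂ * C₁ := by positivity
    nlinarith
  · have hβ := hα.trans_le hαβ
    have hmb1 := hmb.trans (min_le_left _ _)
    have hTT : -delay L μ α ≤ -delay L μ β := neg_le_neg (delay_anti hL hμ hα hαβ)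
    have hM := (isRootFlow_rootOrbit_vecMulVec (μ := μ) hL hf hsym hflow hv hα).mono hTT
    have hN := isRootFlow_rootOrbit_vecMulVec (μ := μ) hL hf hsym hflow hv hβ
    have me := escape_neg_delay hL hμ hβ
    have ε0 : 0 < β ^ (2 / L : ℝ) := by positivity
    have m0 := escape_pos hμ hp hb
    have m1 : escape μ p b ^ p ≤ 1 := Real.rpow_le_one m0.le (hmb1.trans hm₁') (by linarith)
    -- When the orbit of β starts, at ε = β^(2/L) times vvᵀ, the orbit of α is O(ε^(p+1))-close.
    -- Amplification by at most a constant times ε^(-p) leaves O(ε).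
    have h0 := (hB α b hα hb hmb1 (-delay L μ β) ⟨hTT, hs⟩).1
    rw [← rootOrbit_neg_delay hL hflow hμ hS.proj hχ hβ, me, (rpow_split ε0).1] at h0
    have h1 := hE _ _ (-delay L μ β) b (C₁ * ((β ^ (2 / L : ℝ)) ^ p * β ^ (2 / L : ℝ))) hb
      (hmb.trans (min_le_right _ _)) hM hN
      (fun s hs => ⟨(hB α b hα hb hmb1 s ⟨hTT.trans hs.1, hs.2⟩).2.2.1, (hB β b hβ hb hmb1 s hs).2.2.1⟩)
      (by positivity) h0 b ⟨hs, le_rfl⟩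
    refine h1.trans ?_
    rw [me]
    have hε : 0 < (β ^ (2 / L : ℝ)) ^ p := by positivity
    calc C₂ * (escape μ p b ^ p / (β ^ (2 / L : ℝ)) ^ p) * (C₁ * ((β ^ (2 / L : ℝ)) ^ p * β ^ (2 / L : ℝ)))
        = C₂ * C₁ * β ^ (2 / L : ℝ) * escape μ p b ^ p := by field_simp
      _ ≤ C₂ * C₁ * β ^ (2 / L : ℝ) * 1 := by gcongr
      _ ≤ _ := by
        rw [mul_one]
        gcongr
        have : 0 < C₂ * C₁ := by positivity
        nlinarith
  · have hmb1 := hmb.trans (min_le_left _ _)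
    have hM := (isRootFlow_rootOrbit_one (μ := μ) hL hf hsym hflow hα).mono hs
    have hN := (isRootFlow_rootOrbit_vecMulVec (μ := μ) hL hf hsym hflow hv hα).mono hs
    have m0 := escape_pos hμ hp hb
    have m0' := escape_pos hμ hp (hsb.trans_lt hb)
    have m1 : escape μ p b ^ p ≤ 1 := Real.rpow_le_one m0.le (hmb1.trans hm₁') (by linarith)
    obtain ⟨h1, h2, -, -⟩ := hB α b hα hb hmb1 s ⟨hs, hsb⟩
    rw [hse] at h1 h2
    have hα' : 0 < α ^ (2 / L : ℝ) := by positivity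
    -- At time s both error terms have the size α^(2/L) = m(s)^(p+1). Amplification of order
    -- m(s)^(-p) leaves O(m(s)).
    have h3 : ‖rootOrbit f L μ 1 α s - rootOrbit f L μ (vecMulVec v v) α s‖ ≤ 3 * C₁ * α ^ (2 / L : ℝ) := by
      have := norm_sub_le_norm_sub_add_norm_sub (rootOrbit f L μ 1 α s) (escape μ p s • vecMulVec v v)
        (rootOrbit f L μ (vecMulVec v v) α s)
      rw [norm_sub_rev (escape μ p s • vecMulVec v v)] at this
      linarith
    have h4 := hE _ _ s b (3 * C₁ * α ^ (2 / L : ℝ)) hb (hmb.trans (min_le_right _ _)) hM hN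
      (fun r hr => ⟨(hB α b hα hb hmb1 r ⟨hs.trans hr.1, hr.2⟩).2.2.2,
        (hB α b hα hb hmb1 r ⟨hs.trans hr.1, hr.2⟩).2.2.1⟩) (by positivity) h3 b ⟨hsb, le_rfl⟩
    have hC : 0 < C₂ * C₁ := by positivity
    constructor
    · refine h2.trans ?_
      nlinarith [mul_pos hC₁ hα', mul_pos hC hα']
    · refine h4.trans ?_
      rw [← hse, (rpow_split m0').1]
      have hε : 0 < escape μ p s ^ p := by positivity
      calc C₂ * (escape μ p b ^ p / escape μ p s ^ p) * (3 * C₁ * (escape μ p s ^ p * escape μ p s))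
          = C₂ * (3 * C₁) * escape μ p s * escape μ p b ^ p := by field_simp
        _ ≤ C₂ * (3 * C₁) * escape μ p s * 1 := by gcongr
        _ ≤ _ := by
          rw [mul_one]
          gcongr
          nlinarith

end RootOrbit

/-! ### Convergence of both families to one trajectory -/

section Trajectory
variable {d : ℕ} {f : Matrix (Fin d) (Fin d) ℝ → ℝ} {L : ℕ} {μ : ℝ} {v : Fin d → ℝ}
  {U : Matrix (Fin d) (Fin d) ℝ} {a : Fin d → ℝ} {i₀ : Fin d} {γ : ℝ}

theorem tendsto_psdPow {ι : Type*} {l : Filter ι} {u : ι → Matrix (Fin d) (Fin d) ℝ}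
    {A : Matrix (Fin d) (Fin d) ℝ} (hu : Tendsto u l (𝓝 A)) (hpsd : ∀ᶠ i in l, (u i).PosSemidef)
    (hA : A.PosSemidef) {s : ℝ} (hs : 1 ≤ s) :
    Tendsto (fun i => psdPow (u i) s) l (𝓝 (psdPow A s)) := by
  rw [tendsto_iff_norm_sub_tendsto_zero] at hu ⊢
  have h1 : Tendsto (fun i => s * (‖A‖ + 1) ^ (s - 1) * ‖u i - A‖) l (𝓝 0) := by
    simpa using hu.const_mul (s * (‖A‖ + 1) ^ (s - 1))
  refine squeeze_zero' (Eventually.of_forall fun i => norm_nonneg _) ?_ h1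
  filter_upwards [hpsd, hu.eventually_lt_const zero_lt_one] with i hi h2
  have h3 : ‖u i‖ ≤ ‖A‖ + 1 := by
    have := norm_add_le A (u i - A)
    rw [add_sub_cancel] at this
    linarith
  exact norm_psdPow_sub_le hi hA hs (by positivity)
    ((spectrum_subset_Icc_norm hi).trans (Set.Icc_subset_Icc le_rfl h3))
    ((spectrum_subset_Icc_norm hA).trans (Set.Icc_subset_Icc le_rfl (by linarith)))

/-- A family in a complete space is convergent at `0⁺` if its oscillation below `β` tends to zero
with `β`. -/
theorem exists_tendsto_nhdsGT_zero {E : Type*} [NormedAddCommGroup E] [CompleteSpace E] {u : ℝ → E}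
    {g : ℝ → ℝ} (hg : Tendsto g (𝓝[>] 0) (𝓝 0))
    (h : ∀ᶠ β in 𝓝[>] (0 : ℝ), ∀ α, 0 < α → α ≤ β → ‖u α - u β‖ ≤ g β) :
    ∃ x, Tendsto u (𝓝[>] 0) (𝓝 x) := by
  refine cauchy_map_iff_exists_tendsto.mp (Metric.cauchy_iff.mpr ⟨inferInstance, fun e he => ?_⟩)
  obtain ⟨β, ⟨hβ, hβg⟩, hβ0⟩ := ((h.and (hg.eventually_lt_const (half_pos he))).and
    self_mem_nhdsWithin).exists
  refine ⟨u '' Set.Ioc 0 β, image_mem_map (Ioc_mem_nhdsGT hβ0), ?_⟩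
  rintro _ ⟨x, hx, rfl⟩ _ ⟨y, hy, rfl⟩
  have h1 := hβ x hx.1 hx.2
  have h2 := hβ y hy.1 hy.2
  have h3 := dist_triangle_right (u x) (u y) (u β)
  rw [dist_eq_norm (u x) (u β), dist_eq_norm (u y) (u β)] at h3
  linarith

theorem psdPow_mul_self_of_rankOne {A : Matrix (Fin d) (Fin d) ℝ} (hA : A.PosSemidef)
    (h : A * A = A.trace • A) (ht : 0 < A.trace) {s : ℝ} (hs : 0 < s) :
    psdPow A s * psdPow A s = (psdPow A s).trace • psdPow A s ∧ 0 < (psdPow A s).trace := by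
  rw [psdPow_of_mul_self_eq_smul hA.1 ht h hs, trace_smul, Matrix.smul_mul, Matrix.mul_smul, h]
  refine ⟨?_, by rw [smul_eq_mul]; positivity⟩
  simp only [smul_smul, smul_eq_mul]
  ring_nf

theorem norm_vecMulVec_self (hv : v ⬝ᵥ v = 1) : ‖vecMulVec v v‖ = 1 := by
  have : ‖vecMulVec v v‖ ^ 2 = 1 := by
    rw [norm_sq_eq_trace, transpose_vecMulVec, vecMulVec_mul_self hv, trace_vecMulVec_self hv]
  exact (pow_eq_one_iff_of_nonneg (norm_nonneg _) two_ne_zero).mp this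

variable (hL : 3 ≤ L) (hf : ContDiff ℝ 3 f) (hsym : ∀ W, f W.transpose = f W)
  (hflow : ∀ W₀ : Matrix (Fin d) (Fin d) ℝ, W₀.PosSemidef →
      ∃ W : ℝ → Matrix (Fin d) (Fin d) ℝ, IsEndToEndSolution f L W₀ W)
include hL hf hsym hflow

/-- The time at which the orbit of the identity is compared with the rank-one orbit. -/
noncomputable def matchTime (L : ℕ) (μ α : ℝ) : ℝ := -delay L μ (α ^ (1 / (L / 2 + 1) : ℝ))

omit hf hsym hflow in
-- The exponent 1/(L/2 + 1) balances the nonlinear error m^(p+1) against the mass α^(2/L) in the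
-- other directions. The time still tends to -∞ and the profile there to 0.
theorem matchTime_spec (hμ : 0 < μ) :
    (∀ α, 0 < α → escape μ (L / 2) (matchTime L μ α) ^ (L / 2 + 1 : ℝ) = α ^ (2 / L : ℝ)) ∧
    (∀ α, 0 < α → α ≤ 1 → -delay L μ α ≤ matchTime L μ α) ∧
    Tendsto (matchTime L μ) (𝓝[>] 0) atBot ∧
    Tendsto (fun α => escape μ (L / 2) (matchTime L μ α)) (𝓝[>] 0) (𝓝 0) := by
  have hL' : (3 : ℝ) ≤ L := by exact_mod_cast hL
  have e1 : ∀ α, 0 < α → escape μ (L / 2) (matchTime L μ α) = α ^ (1 / (L / 2 + 1) * (2 / L) : ℝ) :=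
    fun α hα => by
      rw [matchTime, escape_neg_delay hL hμ (by positivity), ← Real.rpow_mul hα.le]
  have hq : (0 : ℝ) < 1 / (L / 2 + 1) := by positivity
  refine ⟨fun α hα => ?_, fun α hα h1 => ?_, ?_, ?_⟩
  · rw [e1 α hα, ← Real.rpow_mul hα.le]
    congr 1
    field_simp
  · refine neg_le_neg (delay_anti hL hμ hα ?_)
    have h2 : (1 / (L / 2 + 1) : ℝ) ≤ 1 := by
      rw [div_le_one (by positivity)]; linarith
    simpa using Real.rpow_le_rpow_of_exponent_ge hα h1 h2
  · refine tendsto_neg_atTop_atBot.comp ((tendsto_delay hL hμ).comp ?_)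
    refine tendsto_nhdsWithin_iff.mpr ⟨tendsto_rpow_nhdsGT_zero hq, ?_⟩
    filter_upwards [self_mem_nhdsWithin] with α hα
    exact Real.rpow_pos_of_pos hα _
  · refine (tendsto_rpow_nhdsGT_zero (y := 1 / (L / 2 + 1) * (2 / L)) (by positivity)).congr' ?_
    filter_upwards [self_mem_nhdsWithin] with α hα
    exact (e1 α hα).symm

/-- The orbits of `v vᵀ` and of the identity have the same limit as `α → 0`. -/
theorem exists_tendsto_rootOrbit (hμ : 0 < μ) (hnorm : spectralNorm₂ (matGrad f 0) = μ)
    (hS : SpectralGap (-matGrad f 0) μ v U a i₀ γ) (t : ℝ) :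
    ∃ N : Matrix (Fin d) (Fin d) ℝ, N.PosSemidef ∧
      Tendsto (fun α => rootOrbit f L μ (vecMulVec v v) α t) (𝓝[>] 0) (𝓝 N) ∧
      Tendsto (fun α => rootOrbit f L μ 1 α t) (𝓝[>] 0) (𝓝 N) ∧
      ∃ R, ∀ᶠ α in 𝓝[>] (0 : ℝ), ∀ s ∈ Set.Icc (-delay L μ α) t, ‖rootOrbit f L μ 1 α s‖ ≤ R := by
  have hL' : (3 : ℝ) ≤ L := by exact_mod_cast hL
  have hp : (1 : ℝ) < L / 2 := by linarith
  have hv := hS.unit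
  obtain ⟨C, m₀, hC, hm₀, hm₁, hB1, hB2, hB3⟩ := exists_rootOrbit_sub_bounds hL hf hsym hflow hμ hnorm hS
  obtain ⟨C', m₀', hC', hm₀', -, hB'⟩ := exists_rootOrbit_bounds hL hf hsym hflow hμ hnorm hS
  set p : ℝ := L / 2 with hpdef
  -- A fixed time, early enough for all escape estimates and for the profile to dominate its own
  -- error C m^(p+1).
  obtain ⟨s₀, hs₀, hst, hms, hmC, hms'⟩ : ∃ s₀ < 0, s₀ ≤ t ∧ escape μ p s₀ ≤ m₀ ∧ C * escape μ p s₀ < 1 ∧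
      escape μ p s₀ ≤ m₀' := by
    obtain ⟨K, hK, h1⟩ := exists_escape_le hμ hp (m₀ := min (min m₀ m₀') (1 / (2 * C))) (by positivity)
    refine ⟨min t (-K), by have := min_le_right t (-K); linarith, min_le_left _ _,
      (h1 _ (min_le_right _ _)).trans ((min_le_left _ _).trans (min_le_left _ _)), ?_,
      (h1 _ (min_le_right _ _)).trans ((min_le_left _ _).trans (min_le_right _ _))⟩
    have h2 := (h1 (min t (-K)) (min_le_right _ _)).trans (min_le_right _ _)
    rw [le_div_iff₀ (by positivity)] at h2
    linarith
  have m0 := escape_pos hμ hp hs₀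
  have hdel : ∀ᶠ α in 𝓝[>] (0 : ℝ), -delay L μ α ≤ s₀ := by
    filter_upwards [(tendsto_delay hL hμ).eventually_ge_atTop (-s₀)] with α hα
    linarith
  have hpos : ∀ᶠ α in 𝓝[>] (0 : ℝ), 0 < α := self_mem_nhdsWithin
  have hfM : ∀ᶠ α in 𝓝[>] (0 : ℝ), IsRootFlow f L (rootOrbit f L μ (vecMulVec v v) α) s₀ := by
    filter_upwards [hdel, hpos] with α h1 h2
    exact (isRootFlow_rootOrbit_vecMulVec hL hf hsym hflow hv h2).mono h1
  have hfN : ∀ᶠ α in 𝓝[>] (0 : ℝ), IsRootFlow f L (rootOrbit f L μ 1 α) s₀ := by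
    filter_upwards [hdel, hpos] with α h1 h2
    exact (isRootFlow_rootOrbit_one hL hf hsym hflow h2).mono h1
  obtain ⟨M, hM⟩ : ∃ M, Tendsto (fun α => rootOrbit f L μ (vecMulVec v v) α s₀) (𝓝[>] 0) (𝓝 M) := by
    refine exists_tendsto_nhdsGT_zero (g := fun β => C * β ^ (2 / L : ℝ)) ?_ ?_
    · simpa using (tendsto_rpow_nhdsGT_zero (y := (2 / L : ℝ)) (by positivity)).const_mul C
    · filter_upwards [hdel] with β hβ α hα hαβ
      exact hB2 α β s₀ hα hαβ hs₀ hms hβ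
  have hM' : Tendsto (fun α => rootOrbit f L μ 1 α s₀) (𝓝[>] 0) (𝓝 M) := by
    obtain ⟨t1, t2, t3, t4⟩ := matchTime_spec (L := L) hL hμ
    have h1 : Tendsto (fun α => rootOrbit f L μ 1 α s₀ - rootOrbit f L μ (vecMulVec v v) α s₀)
        (𝓝[>] 0) (𝓝 0) := by
      refine squeeze_zero_norm' (a := fun α => C * escape μ p (matchTime L μ α)) ?_ ?_
      · filter_upwards [hpos, t3.eventually_le_atBot s₀,
          eventually_nhdsWithin_of_eventually_nhds (eventually_le_nhds zero_lt_one)] with α h1 h2 h3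
        exact (hB3 α (matchTime L μ α) s₀ h1 hs₀ hms (t2 α h1 h3) h2 (t1 α h1)).2
      · simpa using t4.const_mul C
    simpa using h1.add hM
  have hrank : ∀ᶠ α in 𝓝[>] (0 : ℝ), (rootOrbit f L μ (vecMulVec v v) α s₀) *
      (rootOrbit f L μ (vecMulVec v v) α s₀) =
      (rootOrbit f L μ (vecMulVec v v) α s₀).trace • rootOrbit f L μ (vecMulVec v v) α s₀ := by
    filter_upwards [hdel, hpos] with α h1 hα
    obtain ⟨r1, r2, r3⟩ := (flow_spec hflow ((posSemidef_vecMulVec v).smul hα.le)).rankOne hL hf hsym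
      ((posSemidef_vecMulVec v).smul hα.le) (by
        rw [trace_smul, trace_vecMulVec_self hv, Matrix.smul_mul, Matrix.mul_smul, vecMulVec_mul_self hv]
        simp) (by rw [trace_smul, trace_vecMulVec_self hv]; simpa) (delay L μ α + s₀) (by linarith)
    exact (psdPow_mul_self_of_rankOne r1 r2 r3 (by positivity)).1
  have hMpsd : M.PosSemidef := (isClosed_posSemidef d).mem_of_tendsto hM
    (hfM.mono fun α h => h.posSemidef s₀ le_rfl)
  have hMsq : M * M = M.trace • M := by
    have htr : Tendsto (fun α => (rootOrbit f L μ (vecMulVec v v) α s₀).trace) (𝓝[>] 0) (𝓝 M.trace) :=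
      ((LinearMap.toContinuousLinearMap (Matrix.traceLinearMap (Fin d) ℝ ℝ)).continuous.tendsto M).comp hM
    exact tendsto_nhds_unique_of_eventuallyEq (hM.mul hM) (htr.smul hM) hrank
  -- The limit at s₀ is not 0, since its distance from m vvᵀ is less than m. A positive trace is
  -- what the rank-one theory needs to continue from M.
  have hMtr : 0 < M.trace := by
    have h1 : ‖M - escape μ p s₀ • vecMulVec v v‖ ≤ C * escape μ p s₀ ^ (p + 1) := by
      refine le_of_tendsto (hM.sub_const _).norm ?_
      filter_upwards [hdel, hpos] with α h1 h2
      exact hB1 α s₀ h2 hs₀ hms h1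
    have h2 : ‖escape μ p s₀ • vecMulVec v v‖ = escape μ p s₀ := by
      rw [norm_smul, norm_vecMulVec_self hv, mul_one, Real.norm_of_nonneg m0.le]
    have h3 : escape μ p s₀ ^ (p + 1) ≤ escape μ p s₀ ^ (2 : ℝ) :=
      Real.rpow_le_rpow_of_exponent_ge m0 (hms.trans hm₁) (by linarith)
    rw [Real.rpow_two] at h3
    have h4 : C * escape μ p s₀ ^ (p + 1) < escape μ p s₀ := by
      calc _ ≤ C * escape μ p s₀ ^ 2 := by gcongr
        _ = C * escape μ p s₀ * escape μ p s₀ := by ring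
        _ < 1 * escape μ p s₀ := by gcongr
        _ = _ := one_mul _
    have h5 := norm_sub_norm_le (escape μ p s₀ • vecMulVec v v) M
    rw [norm_sub_rev, h2] at h5
    linarith [norm_le_trace hMpsd]
  have hWpsd := psdPow_posSemidef hMpsd p
  obtain ⟨hWsq, hWtr⟩ := psdPow_mul_self_of_rankOne hMpsd hMsq hMtr (s := p) (by linarith)
  -- A solution is restarted from the limit at time s₀. Continuous dependence on [s₀, t] then
  -- transports the convergence of both families to time t.
  obtain ⟨W, hW⟩ := hflow _ hWpsd
  have hN := (hW.isRootFlow_of_rankOne hL hf hsym hWpsd hWsq hWtr).comp_add (-s₀)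
  rw [zero_sub, neg_neg] at hN
  have hN0 : psdPow (W (-s₀ + s₀)) (2 / L) = M := by
    rw [neg_add_cancel, hW.1, psdPow_psdPow hMpsd, hpdef,
      show (L / 2 * (2 / L) : ℝ) = 1 by field_simp, psdPow_one hMpsd.1]
  have key : ∀ u : ℝ → ℝ → Matrix (Fin d) (Fin d) ℝ, (∀ᶠ α in 𝓝[>] (0 : ℝ), IsRootFlow f L (u α) s₀) →
      Tendsto (fun α => u α s₀) (𝓝[>] 0) (𝓝 M) →
      Tendsto (fun α => u α t) (𝓝[>] 0) (𝓝 (psdPow (W (-s₀ + t)) (2 / L))) := by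
    intro u hu huM
    rw [Metric.tendsto_nhds]
    intro e he
    obtain ⟨δ, hδ, h1⟩ := IsRootFlow.exists_forall_norm_sub_lt hL hf hsym hN (b := t) he
    filter_upwards [hu, Metric.tendsto_nhds.mp huM δ hδ] with α h2 h3
    rw [dist_eq_norm] at h3 ⊢
    exact h1 _ h2 (by simpa only [hN0] using h3) t ⟨hst, le_rfl⟩
  refine ⟨_, hN.posSemidef t hst, key _ hfM hM, key _ hfN hM', ?_⟩
  obtain ⟨R, hR⟩ := isCompact_Icc.exists_bound_of_continuousOn
    (hN.continuousOn.mono (Set.Icc_subset_Ici_self : Set.Icc s₀ t ⊆ _))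
  obtain ⟨δ, hδ, h1⟩ := IsRootFlow.exists_forall_norm_sub_lt hL hf hsym hN (b := t) zero_lt_one
  refine ⟨max (R + 1) (1 + C' * (1 + 1)), ?_⟩
  filter_upwards [hfN, Metric.tendsto_nhds.mp hM' δ hδ, hpos,
    eventually_nhdsWithin_of_eventually_nhds (eventually_le_nhds zero_lt_one)] with α h2 h3 hα hα1 s hs
  rw [dist_eq_norm] at h3
  rcases le_total s s₀ with h | h
  · have h4 := (hB' α s₀ hα hs₀ hms' s ⟨hs.1, h⟩).2.1
    have m0 := escape_pos hμ hp (h.trans_lt hs₀)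
    have m1 : escape μ p s ≤ 1 := (escape_mono hμ hp h hs₀).trans (hms.trans hm₁)
    have m2 : escape μ p s ^ (p + 1) ≤ 1 := Real.rpow_le_one m0.le m1 (by linarith)
    have m3 : α ^ (2 / L : ℝ) ≤ 1 := Real.rpow_le_one hα.le hα1 (by positivity)
    have h5 := norm_add_le (escape μ p s • vecMulVec v v)
      (rootOrbit f L μ 1 α s - escape μ p s • vecMulVec v v)
    rw [add_sub_cancel, norm_smul, norm_vecMulVec_self hv, mul_one, Real.norm_of_nonneg m0.le] at h5
    have h6 : C' * (escape μ p s ^ (p + 1) + α ^ (2 / L : ℝ)) ≤ C' * (1 + 1) := by gcongr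
    exact le_max_of_le_right (by linarith)
  · have h4 := h1 _ h2 (by simpa only [hN0] using h3) s ⟨h, hs.2⟩
    have h5 := hR s ⟨h, hs.2⟩
    have h6 := norm_sub_norm_le (rootOrbit f L μ 1 α s) (psdPow (W (-s₀ + s)) (2 / L))
    exact le_max_of_le_left (by linarith)

/-- The solutions that start at `α v vᵀ` and at `α I` converge to the same trajectory. -/
theorem exists_tendsto_flow (hμ : 0 < μ) (hnorm : spectralNorm₂ (matGrad f 0) = μ)
    (hS : SpectralGap (-matGrad f 0) μ v U a i₀ γ) (t : ℝ) :
    ∃ N : Matrix (Fin d) (Fin d) ℝ,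
      Tendsto (fun α => flow f L (α • vecMulVec v v) (delay L μ α + t)) (𝓝[>] 0) (𝓝 N) ∧
      Tendsto (fun α => flow f L (α • (1 : Matrix (Fin d) (Fin d) ℝ)) (delay L μ α + t)) (𝓝[>] 0) (𝓝 N) ∧
      ∃ R, ∀ᶠ α in 𝓝[>] (0 : ℝ), ∀ s ∈ Set.Icc (-delay L μ α) t,
        ‖flow f L (α • (1 : Matrix (Fin d) (Fin d) ℝ)) (delay L μ α + s)‖ ≤ R := by
  have hL' : (3 : ℝ) ≤ L := by exact_mod_cast hL
  have hv := hS.unit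
  obtain ⟨N, hN, h1, h2, R, hR⟩ := exists_tendsto_rootOrbit hL hf hsym hflow hμ hnorm hS t
  have hpos : ∀ᶠ α in 𝓝[>] (0 : ℝ), 0 < α := self_mem_nhdsWithin
  have hdel : ∀ᶠ α in 𝓝[>] (0 : ℝ), 0 ≤ delay L μ α + t := by
    filter_upwards [(tendsto_delay hL hμ).eventually_ge_atTop (-t)] with α hα
    linarith
  have hroot : ∀ α s, 0 < α → 0 ≤ delay L μ α + s → psdPow (rootOrbit f L μ 1 α s) (L / 2) =
      flow f L (α • (1 : Matrix (Fin d) (Fin d) ℝ)) (delay L μ α + s) := fun α s hα h1 =>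
    psdPow_root (by omega) (((flow_spec hflow (PosSemidef.one.smul hα.le)).isRootFlow_of_posDef
        hL hf hsym (PosDef.one.smul hα)).1 _ h1).posSemidef
  refine ⟨psdPow N (L / 2), ?_, ?_, d * R ^ (L / 2 : ℝ), ?_⟩
  · refine (tendsto_psdPow h1 ?_ hN (s := (L / 2 : ℝ)) (by linarith)).congr' ?_
    · filter_upwards [hdel, hpos] with α h1 h2
      exact (isRootFlow_rootOrbit_vecMulVec hL hf hsym hflow hv h2).posSemidef t (by linarith)
    · filter_upwards [hdel, hpos] with α h1 hα
      exact psdPow_root (by omega)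
        ((flow_spec hflow ((posSemidef_vecMulVec v).smul hα.le)).rankOne hL hf hsym
          ((posSemidef_vecMulVec v).smul hα.le) (by
            rw [trace_smul, trace_vecMulVec_self hv, Matrix.smul_mul, Matrix.mul_smul, vecMulVec_mul_self hv]
            simp) (by rw [trace_smul, trace_vecMulVec_self hv]; simpa) (delay L μ α + t) h1).1
  · refine (tendsto_psdPow h2 ?_ hN (s := (L / 2 : ℝ)) (by linarith)).congr' ?_
    · filter_upwards [hdel, hpos] with α h1 h2
      exact (isRootFlow_rootOrbit_one hL hf hsym hflow h2).posSemidef t (by linarith)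
    · filter_upwards [hdel, hpos] with α h1 hα
      exact hroot α t hα h1
  · filter_upwards [hR, hpos] with α h1 hα s hs
    rw [← hroot α s hα (by linarith [hs.1])]
    have h2 := (isRootFlow_rootOrbit_one (μ := μ) hL hf hsym hflow hα).posSemidef s hs.1
    exact norm_psdPow_le h2 (by positivity)
      ((spectrum_subset_Icc_norm h2).trans (Set.Icc_subset_Icc le_rfl (h1 s hs)))

end Trajectory

/-! ### Mass outside the largest eigenvalue -/

section TailMass
variable {d : ℕ}

/-- `tr W - tr (W ^ 2) / tr W`, which vanishes exactly at the matrices of rank one and controls the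
mass outside of the largest eigenvalue. -/
noncomputable def tailMass (W : Matrix (Fin d) (Fin d) ℝ) : ℝ := W.trace - (W * W).trace / W.trace

section Scalar
variable {w : Fin d → ℝ} {i₁ : Fin d}

/-- With T the sum, N the sum of squares and s = T - max, the number T² - N lies between 2 max·s and
2Ts, and max ≥ T/d. So s, which need not be differentiable in the matrix, may be replaced by the
smooth T - N/T. -/
theorem sum_sub_max_bounds (hw : ∀ i, 0 ≤ w i) (hmax : ∀ i, w i ≤ w i₁) (hT : 0 < ∑ i, w i) :
    0 ≤ ∑ i, w i - w i₁ ∧ (∀ i, i ≠ i₁ → w i ≤ ∑ i, w i - w i₁) ∧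
    2 / d * (∑ i, w i - w i₁) ≤ ∑ i, w i - (∑ i, w i ^ 2) / ∑ i, w i ∧
    ∑ i, w i - (∑ i, w i ^ 2) / ∑ i, w i ≤ 2 * (∑ i, w i - w i₁) ∧
    ∑ i, w i ^ 2 ≤ w i₁ ^ 2 + (∑ i, w i - w i₁) ^ 2 := by
  set T := ∑ i, w i with hTd
  set N := ∑ i, w i ^ 2 with hNd
  set s := T - w i₁ with hs
  have e1 : ∑ i ∈ Finset.univ.erase i₁, w i = s := by
    rw [hs, hTd, ← Finset.add_sum_erase _ w (Finset.mem_univ i₁)]; ring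
  have e2 : N = w i₁ ^ 2 + ∑ i ∈ Finset.univ.erase i₁, w i ^ 2 := by
    rw [hNd, ← Finset.add_sum_erase _ (fun i => w i ^ 2) (Finset.mem_univ i₁)]
  have s0 : 0 ≤ s := e1 ▸ Finset.sum_nonneg fun i _ => hw i
  have n1 : ∑ i ∈ Finset.univ.erase i₁, w i ^ 2 ≤ s ^ 2 :=
    e1 ▸ Finset.sum_sq_le_sq_sum_of_nonneg fun i _ => hw i
  have n2 : ∑ i ∈ Finset.univ.erase i₁, w i ^ 2 ≤ w i₁ * s := by
    rw [← e1, Finset.mul_sum]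
    exact Finset.sum_le_sum fun i _ => by nlinarith [hw i, hmax i]
  have n3 : 0 ≤ ∑ i ∈ Finset.univ.erase i₁, w i ^ 2 := Finset.sum_nonneg fun i _ => sq_nonneg _
  have hTm : T ≤ d * w i₁ := by
    rw [hTd]; exact (Finset.sum_le_sum fun i _ => hmax i).trans (by simp)
  have hd : (0 : ℝ) < d := by
    have : 0 < d := i₁.pos
    exact_mod_cast this
  have hTs : T = w i₁ + s := by rw [hs]; ring
  refine ⟨s0, fun i hi => ?_, ?_, ?_, by rw [e2]; linarith⟩
  · rw [← e1]
    exact Finset.single_le_sum (f := w) (fun j _ => hw j) (Finset.mem_erase.mpr ⟨hi, Finset.mem_univ i⟩)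
  · rw [le_sub_iff_add_le, ← le_sub_iff_add_le', div_le_iff₀ hT, e2]
    have h1 : 2 / d * s * T ≤ 2 * w i₁ * s := by
      rw [div_mul_eq_mul_div, div_mul_eq_mul_div, div_le_iff₀ hd]
      nlinarith
    nlinarith
  · rw [sub_le_iff_le_add, ← sub_le_iff_le_add', le_div_iff₀ hT, e2]
    nlinarith [hw i₁]

/-- The weight is ((T - w)² + N - w²)/T². At the largest eigenvalue it is at most 2s²/T², which
compensates w^(1+κ) when κ ≤ 1; elsewhere it is at most 2 and w itself is at most s. -/
theorem tail_weight_bounds {κ : ℝ} (h0 : 0 ≤ κ) (h1 : κ ≤ 1) (hw : ∀ i, 0 ≤ w i)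
    (hmax : ∀ i, w i ≤ w i₁) (hT : 0 < ∑ i, w i) (i : Fin d) :
    0 ≤ w i ^ (1 + κ) * (1 + (∑ i, w i ^ 2) / (∑ i, w i) ^ 2 - 2 / (∑ i, w i) * w i) ∧
    w i ^ (1 + κ) * (1 + (∑ i, w i ^ 2) / (∑ i, w i) ^ 2 - 2 / (∑ i, w i) * w i) ≤
      2 * (∑ i, w i - w i₁) ^ (1 + κ) := by
  obtain ⟨s0, s1, -, -, s4⟩ := sum_sub_max_bounds hw hmax hT
  have hN : w i ^ 2 ≤ ∑ i, w i ^ 2 :=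
    Finset.single_le_sum (f := fun i => w i ^ 2) (fun j _ => sq_nonneg _) (Finset.mem_univ i)
  have hNT : ∑ i, w i ^ 2 ≤ (∑ i, w i) ^ 2 := Finset.sum_sq_le_sq_sum_of_nonneg fun i _ => hw i
  have hwT : w i₁ ≤ ∑ i, w i := by linarith
  set T := ∑ i, w i
  set N := ∑ i, w i ^ 2
  set s := T - w i₁ with hs
  have e : ∀ x : ℝ, 1 + N / T ^ 2 - 2 / T * x = ((T - x) ^ 2 + (N - x ^ 2)) / T ^ 2 := fun x => by
    field_simp; ring
  have hr : ∀ j, 0 ≤ w j ^ (1 + κ) := fun j => Real.rpow_nonneg (hw j) _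
  refine ⟨mul_nonneg (hr i) ?_, ?_⟩
  · rw [e]
    have : 0 ≤ N - w i ^ 2 := by linarith
    positivity
  · by_cases hi : i = i₁
    · subst hi
      rw [e]
      have h3 : (T - w i) ^ 2 + (N - w i ^ 2) ≤ 2 * s ^ 2 := by linarith
      have h4 : w i ^ (1 + κ) ≤ T ^ (1 + κ) := Real.rpow_le_rpow (hw i) hwT (by linarith)
      have h5 : s ^ 2 = s ^ (1 + κ) * s ^ (1 - κ) := by
        rw [← Real.rpow_add_of_nonneg s0 (by linarith) (by linarith), ← Real.rpow_two]
        congr 1; ring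
      have h6 : T ^ 2 = T ^ (1 + κ) * T ^ (1 - κ) := by
        rw [← Real.rpow_add hT, ← Real.rpow_two]
        congr 1; ring
      have h7 : s ^ (1 - κ) ≤ T ^ (1 - κ) := Real.rpow_le_rpow s0 (by linarith [hw i]) (by linarith)
      have h8 : 0 ≤ s ^ (1 + κ) := Real.rpow_nonneg s0 _
      rw [← mul_div_assoc, div_le_iff₀ (by positivity)]
      calc _ ≤ T ^ (1 + κ) * (2 * s ^ 2) := by
            have : 0 ≤ T ^ (1 + κ) := Real.rpow_nonneg hT.le _
            have := hr i
            have : 0 ≤ N - w i ^ 2 := by linarith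
            gcongr
        _ = 2 * s ^ (1 + κ) * (T ^ (1 + κ) * s ^ (1 - κ)) := by rw [h5]; ring
        _ ≤ 2 * s ^ (1 + κ) * (T ^ (1 + κ) * T ^ (1 - κ)) := by gcongr
        _ = _ := by rw [h6]
    · have h3 : w i ^ (1 + κ) ≤ s ^ (1 + κ) := Real.rpow_le_rpow (hw i) (s1 i hi) (by linarith)
      have h4 : N / T ^ 2 ≤ 1 := (div_le_one (by positivity)).mpr hNT
      have h5 : 0 ≤ 2 / T * w i := by have := hw i; positivity
      calc _ ≤ w i ^ (1 + κ) * 2 := mul_le_mul_of_nonneg_left (by linarith) (hr i)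
        _ ≤ s ^ (1 + κ) * 2 := by gcongr
        _ = _ := mul_comm _ _

end Scalar

theorem Diagonalizes.tailMass_eq {W U : Matrix (Fin d) (Fin d) ℝ} {w : Fin d → ℝ}
    (h : Diagonalizes W U w) : tailMass W = ∑ i, w i - (∑ i, w i ^ 2) / ∑ i, w i := by
  rw [tailMass, h.trace_eq, (h.mul h).trace_eq]
  simp only [Pi.mul_apply, sq]

theorem tailMass_nonneg {W : Matrix (Fin d) (Fin d) ℝ} (hW : W.PosSemidef) (hT : 0 < W.trace) :
    0 ≤ tailMass W := by
  obtain ⟨U, w, hU⟩ := hW.1.exists_diagonalizes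
  rw [hU.tailMass_eq, sub_nonneg, div_le_iff₀ (hU.trace_eq ▸ hT), ← sq]
  exact Finset.sum_sq_le_sq_sum_of_nonneg fun i _ => hU.nonneg hW i

theorem Diagonalizes.exists_max {W U : Matrix (Fin d) (Fin d) ℝ} {w : Fin d → ℝ}
    (h : Diagonalizes W U w) (hT : 0 < W.trace) : ∃ i₁, ∀ i, w i ≤ w i₁ := by
  have : Nonempty (Fin d) := by
    rw [h.trace_eq] at hT
    by_contra hne
    rw [not_nonempty_iff] at hne
    simp at hT
  exact Finite.exists_max w

/-- The matrix that governs the evolution of `tailMass` is of size `tailMass ^ (1 + κ)`. -/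
theorem norm_tail_weight_le {W : Matrix (Fin d) (Fin d) ℝ} (hW : W.PosSemidef) (hT : 0 < W.trace)
    {κ : ℝ} (h0 : 0 ≤ κ) (h1 : κ ≤ 1) :
    ‖psdPow W (1 + κ) * ((1 + (W * W).trace / W.trace ^ 2) • (1 : Matrix (Fin d) (Fin d) ℝ) - (2 / W.trace) • W)‖ ≤
      d * (2 * (d / 2 * tailMass W) ^ (1 + κ)) := by
  obtain ⟨U, w, hU⟩ := hW.1.exists_diagonalizes
  obtain ⟨i₁, hmax⟩ := hU.exists_max hT
  have hw := hU.nonneg hW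
  have hN : (W * W).trace = ∑ i, w i ^ 2 := by
    rw [(hU.mul hU).trace_eq]; simp only [Pi.mul_apply, sq]
  rw [hU.trace_eq] at hT
  rw [hU.tailMass_eq, hU.trace_eq, hN]
  have key := (hU.psdPow (1 + κ)).mul ((hU.one.smul (1 + (∑ i, w i ^ 2) / (∑ i, w i) ^ 2)).sub
    (hU.smul (2 / ∑ i, w i)))
  have e : ∀ i, ((fun i => w i ^ (1 + κ)) * ((1 + (∑ i, w i ^ 2) / (∑ i, w i) ^ 2) • (1 : Fin d → ℝ) -
      (2 / ∑ i, w i) • w)) i =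
      w i ^ (1 + κ) * (1 + (∑ i, w i ^ 2) / (∑ i, w i) ^ 2 - 2 / (∑ i, w i) * w i) := fun i => by
    simp
  have hb := tail_weight_bounds h0 h1 hw hmax hT
  obtain ⟨s0, -, s2, -, -⟩ := sum_sub_max_bounds hw hmax hT
  have hd : (0 : ℝ) < d := by
    have : 0 < d := i₁.pos
    exact_mod_cast this
  refine (norm_le_sum_of_diagonalizes key fun i => by rw [e]; exact (hb i).1).trans ?_
  have h2 : ∀ i ∈ Finset.univ, ((fun i => w i ^ (1 + κ)) *
      ((1 + (∑ i, w i ^ 2) / (∑ i, w i) ^ 2) • (1 : Fin d → ℝ) - (2 / ∑ i, w i) • w)) i ≤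
      2 * (d / 2 * (∑ i, w i - (∑ i, w i ^ 2) / ∑ i, w i)) ^ (1 + κ) := fun i _ => by
    rw [e]
    refine (hb i).2.trans ?_
    gcongr
    calc _ = d / 2 * (2 / d * (∑ i, w i - w i₁)) := by field_simp
      _ ≤ _ := by gcongr
  exact (Finset.sum_le_sum h2).trans (by simp)

/-- If `M` is close to a multiple of `v vᵀ`, then `M ^ p` has small tail mass. -/
theorem tailMass_psdPow_le {M : Matrix (Fin d) (Fin d) ℝ} (hM : M.PosSemidef) (hT : 0 < M.trace)
    {v : Fin d → ℝ} (hv : v ⬝ᵥ v = 1) {ρ δ p : ℝ} (hp : 0 < p) (h : ‖M - ρ • vecMulVec v v‖ ≤ δ) :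
    tailMass (psdPow M p) ≤ 2 * (d * ((d + 1) * δ) ^ p) := by
  obtain ⟨U, w, hU⟩ := hM.1.exists_diagonalizes
  obtain ⟨i₁, hmax⟩ := hU.exists_max hT
  have hw := hU.nonneg hM
  -- The top eigenvalue is at least vᵀMv, and in tr M - vᵀMv = tr(M(1 - vvᵀ)) any multiple of vvᵀ
  -- drops out. Hence ρ does not enter the bound.
  have hs : M.trace - w i₁ ≤ (d + 1) * δ := by
    have h1 : (w i₁ • (1 : Matrix (Fin d) (Fin d) ℝ) - M).PosSemidef :=
      ((hU.one.smul (w i₁)).sub hU).posSemidef fun i => by simpa using hmax i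
    have h2 : 0 ≤ w i₁ - v ⬝ᵥ M *ᵥ v := by
      have := h1.dotProduct_mulVec_nonneg v
      rw [sub_mulVec, dotProduct_sub, smul_mulVec, one_mulVec, dotProduct_smul] at this
      simpa [hv] using this
    have h3 : M.trace - v ⬝ᵥ M *ᵥ v = ((M - ρ • vecMulVec v v) * (1 - vecMulVec v v)).trace := by
      rw [Matrix.sub_mul, Matrix.mul_sub, Matrix.mul_one, Matrix.smul_mul, Matrix.mul_sub, Matrix.mul_one,
        vecMulVec_mul_self hv, sub_self, smul_zero, sub_zero, trace_sub, mul_vecMulVec, trace_vecMulVec,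
        dotProduct_comm]
    rw [Matrix.mul_sub, Matrix.mul_one, trace_sub] at h3
    have h4 := abs_trace_le (M - ρ • vecMulVec v v)
    have h5 := abs_trace_mul_le (M - ρ • vecMulVec v v) (vecMulVec v v)
    rw [norm_vecMulVec_self hv, mul_one] at h5
    have h6 := (abs_le.mp h4).2
    have h7 := (abs_le.mp h5).1
    have : (0 : ℝ) ≤ d := d.cast_nonneg
    nlinarith
  have hd0 : 0 ≤ M.trace - w i₁ := by
    rw [hU.trace_eq] at hT ⊢; exact (sum_sub_max_bounds hw hmax hT).1
  have hδ : 0 ≤ (d + 1) * δ := hd0.trans hs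
  have hwp := hU.psdPow p
  have hmax' : ∀ i, w i ^ p ≤ w i₁ ^ p := fun i => Real.rpow_le_rpow (hw i) (hmax i) hp.le
  have hw' : ∀ i, 0 ≤ w i ^ p := fun i => Real.rpow_nonneg (hw i) _
  have hT' : 0 < ∑ i, w i ^ p := by
    rw [hU.trace_eq] at hT
    obtain ⟨i, -, hi⟩ := Finset.exists_lt_of_sum_lt (by simpa using hT : ∑ i : Fin d, (0 : ℝ) < ∑ i, w i)
    exact Finset.sum_pos' (fun i _ => hw' i) ⟨i, Finset.mem_univ i, Real.rpow_pos_of_pos hi _⟩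
  rw [hwp.tailMass_eq]
  refine (sum_sub_max_bounds hw' hmax' hT').2.2.2.1.trans ?_
  gcongr
  rw [← Finset.add_sum_erase _ (fun i => w i ^ p) (Finset.mem_univ i₁), add_sub_cancel_left]
  have h1 : ∀ i ∈ Finset.univ.erase i₁, w i ^ p ≤ ((d + 1) * δ) ^ p := fun i hi => by
    refine Real.rpow_le_rpow (hw i) (le_trans ?_ hs) hp.le
    rw [hU.trace_eq] at hT ⊢
    exact (sum_sub_max_bounds hw hmax hT).2.1 i (Finset.ne_of_mem_erase hi)
  refine (Finset.sum_le_card_nsmul _ _ _ h1).trans ?_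
  rw [nsmul_eq_mul]
  gcongr
  exact_mod_cast (Finset.card_erase_le).trans (by simp)

end TailMass

/-! ### Evolution of the tail mass -/

section TailFlow
variable {d : ℕ} {f : Matrix (Fin d) (Fin d) ℝ → ℝ} {L : ℕ}

/-- Differentiation gives the contractions of the field with 1 and with W, both of which commute
with W; all powers then collect to the exponent 2 - 2/L = 1 + κ, the source of the superlinear bound
on the growth. -/
theorem IsEndToEndSolution.hasDerivWithinAt_tailMass (hL : 3 ≤ L)
    {W₀ : Matrix (Fin d) (Fin d) ℝ} {W : ℝ → Matrix (Fin d) (Fin d) ℝ} (h : IsEndToEndSolution f L W₀ W)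
    {t : ℝ} (ht : 0 ≤ t) (hW : (W t).PosSemidef) (hT : 0 < (W t).trace) :
    HasDerivWithinAt (fun s => tailMass (W s)) (-(L * (matGrad f (W t) *
      (psdPow (W t) (1 + (1 - 2 / L : ℝ)) * ((1 + (W t * W t).trace / (W t).trace ^ 2) •
        (1 : Matrix (Fin d) (Fin d) ℝ) - (2 / (W t).trace) • W t))).trace)) (Set.Ici 0) t := by
  have hL' : (3 : ℝ) ≤ L := by exact_mod_cast hL
  have d1 := h.hasDerivWithinAt ht
  have htr : (W t)ᵀ = W t := isHermitian_iff_transpose.mp hW.1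
  have e0 : 2 * (1 - 1 / (L : ℝ)) = 1 + (1 - 2 / L) := by ring
  have e1 : (endToEndField f L (W t)).trace =
      -(L * (matGrad f (W t) * psdPow (W t) (1 + (1 - 2 / L : ℝ))).trace) := by
    have := trace_mul_endToEndField (f := f) (L := L) (W := W t) (X := 1) (fun s => by
      rw [htr, Matrix.one_mul, Matrix.mul_one])
    rwa [Matrix.one_mul, Matrix.mul_one, htr, psdPow_mul_self hW, e0] at this
  have e2 : (W t * endToEndField f L (W t)).trace =
      -(L * (matGrad f (W t) * (psdPow (W t) (1 + (1 - 2 / L : ℝ)) * W t)).trace) := by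
    have := trace_mul_endToEndField (f := f) (L := L) (W := W t) (X := W t) (fun s => by
      rw [htr, psdPow_mul_self hW]; exact (psdPow_commute hW.1 _).symm)
    rwa [htr, psdPow_mul_self hW, e0] at this
  have d2 : HasDerivWithinAt (fun s => (W s).trace) (endToEndField f L (W t)).trace (Set.Ici 0) t :=
    (LinearMap.toContinuousLinearMap (Matrix.traceLinearMap (Fin d) ℝ ℝ)).hasFDerivAt.comp_hasDerivWithinAt
      t d1
  have d3 : HasDerivWithinAt (fun s => (W s * W s).trace)
      (endToEndField f L (W t) * W t + W t * endToEndField f L (W t)).trace (Set.Ici 0) t :=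
    (LinearMap.toContinuousLinearMap (Matrix.traceLinearMap (Fin d) ℝ ℝ)).hasFDerivAt.comp_hasDerivWithinAt
      t (d1.mul d1)
  refine (d2.sub (d3.div d2 hT.ne')).congr_deriv ?_
  rw [trace_add, Matrix.trace_mul_comm (endToEndField f L (W t)), e2, e1, Matrix.mul_sub, Matrix.mul_sub,
    trace_sub, Matrix.mul_smul, Matrix.mul_smul, Matrix.mul_smul, Matrix.mul_smul, trace_smul, trace_smul,
    Matrix.mul_one, smul_eq_mul, smul_eq_mul]
  field_simp
  ring

/-- The tail mass at most doubles over a time of length `O(Q ^ -κ)`, `κ = 1 - 2 / L`. -/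
theorem exists_tailMass_le_two_mul (hL : 3 ≤ L) (hf : ContDiff ℝ 3 f) (R : ℝ) :
    ∃ C, 0 < C ∧ ∀ (W₀ : Matrix (Fin d) (Fin d) ℝ) (W : ℝ → Matrix (Fin d) (Fin d) ℝ) (t₁ t₂ Q : ℝ),
      IsEndToEndSolution f L W₀ W → 0 ≤ t₁ →
      (∀ s ∈ Set.Icc t₁ t₂, (W s).PosSemidef ∧ 0 < (W s).trace ∧ ‖W s‖ ≤ R) → 0 < Q →
      tailMass (W t₁) ≤ Q → C * Q ^ (1 - 2 / L : ℝ) * (t₂ - t₁) ≤ 1 →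
      ∀ s ∈ Set.Icc t₁ t₂, tailMass (W s) ≤ 2 * Q := by
  have hL' : (3 : ℝ) ≤ L := by exact_mod_cast hL
  obtain ⟨C₀, hC₀, hG, -⟩ := exists_matGrad_bound hf R
  have hκ0 : (0 : ℝ) ≤ 1 - 2 / L := by
    rw [sub_nonneg, div_le_one (by positivity)]; linarith
  have hκ1 : (1 - 2 / L : ℝ) ≤ 1 := by
    have : (0 : ℝ) ≤ 2 / L := by positivity
    linarith
  set κ : ℝ := 1 - 2 / L
  set C' := L * (C₀ * (d * (2 * (d / 2 : ℝ) ^ (1 + κ)))) + 1 with hC'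
  have hC'0 : 0 < C' := by positivity
  refine ⟨2 * C' * 2 ^ (1 + κ), by positivity, fun W₀ W t₁ t₂ Q h ht₁ hb hQ hq hlen => ?_⟩
  have hd : ∀ s ∈ Set.Icc t₁ t₂, HasDerivWithinAt (fun s => tailMass (W s)) (-(L * (matGrad f (W s) *
      (psdPow (W s) (1 + κ) * ((1 + (W s * W s).trace / (W s).trace ^ 2) •
        (1 : Matrix (Fin d) (Fin d) ℝ) - (2 / (W s).trace) • W s))).trace)) (Set.Ici 0) s := fun s hs =>
    h.hasDerivWithinAt_tailMass hL (ht₁.trans hs.1) (hb s hs).1 (hb s hs).2.1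
  -- As long as the tail mass is at most 2Q its slope is below β. The length condition says that the
  -- linear barrier of slope β rises by at most Q.
  set β := 2 * C' * (2 * Q) ^ (1 + κ)
  have hβ : 0 < β := by positivity
  have hβQ : β * (t₂ - t₁) ≤ Q := by
    have : β = 2 * C' * 2 ^ (1 + κ) * Q ^ κ * Q := by
      simp only [β]
      rw [Real.mul_rpow zero_le_two hQ.le, add_comm 1 κ, Real.rpow_add_one hQ.ne']; ring
    rw [this]
    nlinarith
  have hBle : ∀ s ∈ Set.Icc t₁ t₂, Q + β * (s - t₁) ≤ 2 * Q := fun s hs => by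
    nlinarith [hs.2]
  intro s hs
  refine le_trans ?_ (hBle s hs)
  refine image_le_of_deriv_right_lt_deriv_boundary' (f := fun s => tailMass (W s)) (a := t₁) (b := t₂)
    (B := fun s => Q + β * (s - t₁)) (B' := fun _ => β)
    (fun s hs => (hd s hs).continuousWithinAt.mono fun x hx => ht₁.trans hx.1)
    (fun s hs => (hd s (Set.Ico_subset_Icc_self hs)).mono (Set.Ici_subset_Ici.mpr (ht₁.trans hs.1)))
    (by simpa using hq) (by fun_prop) (fun s _ => ?_) (fun s hs heq => ?_) hs
  · have := (((hasDerivAt_id s).sub_const t₁).const_mul β).const_add Q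
    simpa using this.hasDerivWithinAt
  · have hs' := Set.Ico_subset_Icc_self hs
    obtain ⟨hW, hT, hR⟩ := hb s hs'
    have h1 := norm_tail_weight_le hW hT hκ0 hκ1
    have h2 := abs_trace_mul_le (matGrad f (W s)) (psdPow (W s) (1 + κ) *
      ((1 + (W s * W s).trace / (W s).trace ^ 2) • (1 : Matrix (Fin d) (Fin d) ℝ) - (2 / (W s).trace) • W s))
    have h3 := tailMass_nonneg hW hT
    have h4 : tailMass (W s) ≤ 2 * Q := heq.trans_le (hBle s hs')
    have h5 : tailMass (W s) ^ (1 + κ) ≤ (2 * Q) ^ (1 + κ) := Real.rpow_le_rpow h3 h4 (by linarith)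
    rw [Real.mul_rpow (by positivity) h3] at h1
    have h6 := (abs_le.mp (h2.trans (mul_le_mul (hG _ hR) h1 (norm_nonneg _) hC₀.le))).1
    have h7 : (0 : ℝ) < (2 * Q) ^ (1 + κ) := by positivity
    calc _ ≤ L * (C₀ * (d * (2 * ((d / 2 : ℝ) ^ (1 + κ) * tailMass (W s) ^ (1 + κ))))) := by
          rw [← mul_neg]; gcongr; linarith
      _ ≤ L * (C₀ * (d * (2 * ((d / 2 : ℝ) ^ (1 + κ) * (2 * Q) ^ (1 + κ))))) := by gcongr
      _ = L * (C₀ * (d * (2 * (d / 2 : ℝ) ^ (1 + κ)))) * (2 * Q) ^ (1 + κ) := by ring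
      _ < β := by
        simp only [β, hC']
        have : 0 ≤ L * (C₀ * (d * (2 * (d / 2 : ℝ) ^ (1 + κ)))) := by positivity
        nlinarith

/-- A positive power beats a logarithm at `0`. -/
theorem tendsto_rpow_mul_neg_log {y : ℝ} (hy : 0 < y) :
    Tendsto (fun α : ℝ => α ^ y * -Real.log α) (𝓝[>] 0) (𝓝 0) := by
  have := (tendsto_log_mul_rpow_nhdsGT_zero hy).neg
  rw [neg_zero] at this
  exact this.congr fun α => by ring

variable {μ : ℝ} {v : Fin d → ℝ} {U : Matrix (Fin d) (Fin d) ℝ} {a : Fin d → ℝ} {i₀ : Fin d} {γ : ℝ}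

/-- At the end of the escape phase the solution that starts at `α I` has tail mass `O(α)`. -/
theorem exists_tailMass_flow_le [NeZero d] (hL : 3 ≤ L) (hf : ContDiff ℝ 3 f)
    (hsym : ∀ W, f W.transpose = f W)
    (hflow : ∀ W₀ : Matrix (Fin d) (Fin d) ℝ, W₀.PosSemidef →
      ∃ W : ℝ → Matrix (Fin d) (Fin d) ℝ, IsEndToEndSolution f L W₀ W)
    (hμ : 0 < μ) (hnorm : spectralNorm₂ (matGrad f 0) = μ)
    (hS : SpectralGap (-matGrad f 0) μ v U a i₀ γ) (t : ℝ) :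
    ∃ C, 0 < C ∧ ∀ᶠ α in 𝓝[>] (0 : ℝ),
      tailMass (flow f L (α • (1 : Matrix (Fin d) (Fin d) ℝ)) (delay L μ α + t)) ≤ C * α := by
  have hL' : (3 : ℝ) ≤ L := by exact_mod_cast hL
  have hp : (1 : ℝ) < L / 2 := by linarith
  have hv := hS.unit
  obtain ⟨C, m₀, hC, hm₀, hm₁, -, -, hB3⟩ := exists_rootOrbit_sub_bounds hL hf hsym hflow hμ hnorm hS
  obtain ⟨K, hK, hKm⟩ := exists_escape_le hμ hp hm₀
  obtain ⟨N, -, -, R, hR⟩ := exists_tendsto_flow hL hf hsym hflow hμ hnorm hS t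
  obtain ⟨C', hC', hq⟩ := exists_tailMass_le_two_mul (d := d) hL hf R
  obtain ⟨t1, t2, t3, t4⟩ := matchTime_spec (L := L) hL hμ
  have hpos : ∀ᶠ α in 𝓝[>] (0 : ℝ), 0 < α := self_mem_nhdsWithin
  have hκ0 : (0 : ℝ) < 1 - 2 / L := by
    rw [sub_pos, div_lt_one (by positivity)]; linarith
  set Q₀ := 2 * (d * ((d + 1) * C) ^ (L / 2 : ℝ)) with hQ₀
  have hd : (0 : ℝ) < d := by exact_mod_cast Nat.pos_of_ne_zero (NeZero.ne d)
  have hQ₀0 : 0 < Q₀ := by positivity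
  -- The time from matching to t is of order α^(-κ/(p+1)), while the tail mass to the power κ is of
  -- order α^κ. The product is a positive power of α.
  have hlen : ∀ᶠ α in 𝓝[>] (0 : ℝ), C' * (Q₀ * α) ^ (1 - 2 / L : ℝ) * (t - matchTime L μ α) ≤ 1 := by
    have h1 : Tendsto (fun α : ℝ => C' * Q₀ ^ (1 - 2 / L : ℝ) * (α ^ (1 - 2 / L : ℝ) * t +
        α ^ ((1 - 2 / L) * (L / 2) / (L / 2 + 1) : ℝ) / (2 * μ * (L / 2 - 1)))) (𝓝[>] 0) (𝓝 0) := by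
      have h2 := (tendsto_rpow_nhdsGT_zero hκ0).mul_const t
      have h3 := (tendsto_rpow_nhdsGT_zero (y := ((1 - 2 / L) * (L / 2) / (L / 2 + 1) : ℝ))
        (by positivity)).div_const (2 * μ * (L / 2 - 1))
      simpa using (h2.add h3).const_mul (C' * Q₀ ^ (1 - 2 / L : ℝ))
    filter_upwards [hpos, h1.eventually_le_const zero_lt_one] with α hα h2
    refine le_of_eq_of_le ?_ h2
    rw [Real.mul_rpow hQ₀0.le hα.le, matchTime, delay, sub_neg_eq_add, ← Real.rpow_mul hα.le]
    have e : α ^ ((1 - 2 / L) * (L / 2) / (L / 2 + 1) : ℝ) =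
        α ^ (1 - 2 / L : ℝ) * α ^ (1 / (L / 2 + 1) * -(1 - 1 / (L / 2)) : ℝ) := by
      rw [← Real.rpow_add hα]
      congr 1
      field_simp
      ring
    rw [e]
    ring
  refine ⟨2 * Q₀, by positivity, ?_⟩
  filter_upwards [hpos, hlen, hR, t3.eventually_le_atBot (min (-K) t),
    eventually_nhdsWithin_of_eventually_nhds (eventually_le_nhds zero_lt_one)] with α hα h1 h2 h3 h4
  have h5 := t2 α hα h4
  have h6 := (hB3 α (matchTime L μ α) (-K) hα (by linarith) (hKm _ le_rfl) h5
    (h3.trans (min_le_left _ _)) (t1 α hα)).1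
  have hsol := flow_spec hflow ((PosSemidef.one (n := Fin d) (R := ℝ)).smul hα.le)
  have hpd := (hsol.isRootFlow_of_posDef hL hf hsym (PosDef.one.smul hα)).1
  have hMpsd := (isRootFlow_rootOrbit_one (μ := μ) hL hf hsym hflow hα).posSemidef _ h5
  have hroot : psdPow (rootOrbit f L μ 1 α (matchTime L μ α)) (L / 2) =
      flow f L (α • (1 : Matrix (Fin d) (Fin d) ℝ)) (delay L μ α + matchTime L μ α) :=
    psdPow_root (by omega) (hpd _ (by linarith)).posSemidef
  have hMtr : 0 < (rootOrbit f L μ 1 α (matchTime L μ α)).trace := by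
    refine hMpsd.trace_nonneg.lt_of_ne' fun h0 => ?_
    have h7 : rootOrbit f L μ 1 α (matchTime L μ α) = 0 := by
      have := norm_le_trace hMpsd
      rw [h0] at this
      exact norm_le_zero_iff.mp this
    have h8 := (hpd (delay L μ α + matchTime L μ α) (by linarith)).trace_pos
    obtain ⟨V, b, hb⟩ := hMpsd.1.exists_diagonalizes
    have h9 : ∀ i, b i = 0 := by
      intro i
      have := hb.norm_sq
      rw [h7, norm_zero, zero_pow two_ne_zero, eq_comm,
        Finset.sum_eq_zero_iff_of_nonneg fun i _ => sq_nonneg _] at this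
      simpa using this i (Finset.mem_univ i)
    rw [← hroot, (hb.psdPow _).trace_eq] at h8
    simp [h9, Real.zero_rpow (show (L / 2 : ℝ) ≠ 0 by positivity)] at h8
  have h7 := tailMass_psdPow_le hMpsd hMtr hv (p := (L / 2 : ℝ)) (by positivity) h6
  rw [hroot] at h7
  -- Raising to the power L/2 turns the error α^(2/L) of the root into exactly α for W.
  have h8 : 2 * (d * ((d + 1) * (C * α ^ (2 / L : ℝ))) ^ (L / 2 : ℝ)) = Q₀ * α := by
    rw [← mul_assoc (d + 1 : ℝ), Real.mul_rpow (by positivity) (by positivity), ← Real.rpow_mul hα.le,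
      show (2 / L * (L / 2) : ℝ) = 1 by field_simp, Real.rpow_one, hQ₀]
    ring
  rw [h8] at h7
  have key := hq _ _ (delay L μ α + matchTime L μ α) (delay L μ α + t) (Q₀ * α) hsol (by linarith)
    (fun s hs => ⟨(hpd s (by linarith [hs.1])).posSemidef, (hpd s (by linarith [hs.1])).trace_pos, ?_⟩)
    (by positivity) h7 (by rwa [add_sub_add_left_eq_sub]) (delay L μ α + t)
    ⟨by linarith [h3.trans (min_le_right _ _)], le_rfl⟩
  · linarith
  · have := h2 (s - delay L μ α) ⟨by linarith [hs.1], by linarith [hs.2]⟩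
    rwa [add_sub_cancel] at this

end TailFlow

/-! ### First-order conditions at the rank-one minimizer -/

section Minimizer
variable {d : ℕ} {f : Matrix (Fin d) (Fin d) ℝ → ℝ} {L : ℕ} {W : Matrix (Fin d) (Fin d) ℝ}

theorem mul_self_eq_trace_smul_of_rank_le_one (hW : W.PosSemidef) (hr : W.rank ≤ 1) :
    W * W = W.trace • W := by
  obtain ⟨U, hU, -⟩ := Diagonalizes.exists_of_isHermitian hW.1
  rw [hW.1.rank_eq_card_non_zero_eigs, Fintype.card_le_one_iff_subsingleton] at hr
  refine (hU.mul hU).congr (hU.smul _) (funext fun i => ?_)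
  rw [Pi.mul_apply, Pi.smul_apply, smul_eq_mul, hU.trace_eq]
  by_cases hi : hW.1.eigenvalues i = 0
  · rw [hi]; simp
  · congr 1
    rw [Finset.sum_eq_single i]
    · intro j _ hj
      by_contra h
      exact hj (congrArg Subtype.val (Subsingleton.elim (⟨j, h⟩ : {i // hW.1.eigenvalues i ≠ 0}) ⟨i, hi⟩))
    · simp

theorem vecMulVec_mem_psdRankLE (x : Fin d → ℝ) : vecMulVec x x ∈ psdRankLE d 1 :=
  ⟨posSemidef_vecMulVec x, rank_vecMulVec_le x x⟩

theorem hasDerivAt_comp_matrix (hf : Differentiable ℝ f) {c : ℝ → Matrix (Fin d) (Fin d) ℝ}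
    {c' : Matrix (Fin d) (Fin d) ℝ} {s : ℝ} (hc : HasDerivAt c c' s) :
    HasDerivAt (fun s => f (c s)) ((matGrad f (c s))ᵀ * c').trace s := by
  rw [← fderiv_eq_trace]
  exact (hf (c s)).hasFDerivAt.comp_hasDerivAt s hc

theorem nonneg_of_hasDerivAt_of_le {φ : ℝ → ℝ} {φ' : ℝ} (h : HasDerivAt φ φ' 0)
    (hle : ∀ s, 0 ≤ s → φ 0 ≤ φ s) : 0 ≤ φ' := by
  have h1 := (hasDerivAt_iff_tendsto_slope.mp h).mono_left
    (nhdsWithin_mono 0 (fun x (hx : x ∈ Set.Ioi (0 : ℝ)) => ne_of_gt hx))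
  refine ge_of_tendsto h1 ?_
  filter_upwards [self_mem_nhdsWithin] with s hs
  have hs' : (0 : ℝ) < s := hs
  rw [slope_def_field, sub_zero]
  exact div_nonneg (sub_nonneg.mpr (hle s hs'.le)) hs'.le

variable (hf : ContDiff ℝ 3 f) (hsym : ∀ W, f W.transpose = f W) (hmem : W ∈ psdRankLE d 1)
  (hmin : IsMinOn f (psdRankLE d 1) W)
include hf hsym hmem hmin

/-- A minimizer over the rank-one cone is nonzero if the gradient at `0` has a negative direction,
and the gradient there annihilates its range. -/
theorem exists_rankOne_minimizer {μ : ℝ} (hμ : 0 < μ) {v : Fin d → ℝ} (hv : v ⬝ᵥ v = 1)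
    (hvtop : (-matGrad f 0).mulVec v = μ • v) :
    ∃ (u : Fin d → ℝ) (w : ℝ), u ⬝ᵥ u = 1 ∧ 0 < w ∧ W = w • vecMulVec u u ∧ matGrad f W *ᵥ u = 0 := by
  have hfd : Differentiable ℝ f := hf.differentiable (by norm_num)
  have hsq := mul_self_eq_trace_smul_of_rank_le_one hmem.1 hmem.2
  have h0 : W ≠ 0 := by
    rintro rfl
    -- Along the ray s vvᵀ the derivative of f at 0 is -μ < 0, so 0 is not a minimizer.
    have h1 : HasDerivAt (fun s : ℝ => s • vecMulVec v v) (vecMulVec v v) 0 := by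
      simpa using (hasDerivAt_id (0 : ℝ)).smul_const (vecMulVec v v)
    have h2 := nonneg_of_hasDerivAt_of_le (hasDerivAt_comp_matrix hfd h1) fun s hs => by
      rw [zero_smul]
      have : s • vecMulVec v v = vecMulVec (√s • v) (√s • v) := by
        rw [smul_vecMulVec, vecMulVec_smul, smul_smul, Real.mul_self_sqrt hs]
      rw [this]
      exact hmin (vecMulVec_mem_psdRankLE _)
    rw [zero_smul, ← matGrad_transpose hfd hsym, transpose_zero, mul_vecMulVec, trace_vecMulVec] at h2
    rw [neg_mulVec] at hvtop
    rw [← neg_neg (matGrad f 0 *ᵥ v), hvtop, neg_dotProduct, smul_dotProduct, hv, smul_eq_mul] at h2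
    linarith
  have htr : 0 < W.trace := by
    refine hmem.1.trace_nonneg.lt_of_ne' fun h => h0 ?_
    have := norm_le_trace hmem.1
    rw [h] at this
    exact norm_le_zero_iff.mp this
  obtain ⟨u, hu, hWu⟩ := exists_eq_smul_vecMulVec hmem.1.1 htr hsq rfl
  refine ⟨u, W.trace, hu, htr, hWu, ?_⟩
  set w := W.trace
  set G := matGrad f W with hG
  have hGt : Gᵀ = G := by
    rw [hG, ← matGrad_transpose hfd hsym, isHermitian_iff_transpose.mp hmem.1.1]
  have key : ∀ z : Fin d → ℝ, z ⬝ᵥ G *ᵥ u = 0 := fun z => by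
    -- The curve x xᵀ stays in the rank-one cone and passes through W at s = 0. Its first variation
    -- is 2√w zᵀGu, for arbitrary z.
    set x : ℝ → Fin d → ℝ := fun s => √w • u + s • z with hx
    have hx0 : vecMulVec (x 0) (x 0) = W := by
      simp only [hx, zero_smul, add_zero]
      rw [smul_vecMulVec, vecMulVec_smul, smul_smul, Real.mul_self_sqrt htr.le, ← hWu]
    have e : (fun s => vecMulVec (x s) (x s)) = fun s =>
        W + s • (√w • (vecMulVec u z + vecMulVec z u)) + s ^ 2 • vecMulVec z z := by
      funext s
      rw [← hx0]
      ext i j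
      simp only [hx, vecMulVec_apply, Matrix.add_apply, Matrix.smul_apply, Pi.add_apply, Pi.smul_apply,
        smul_eq_mul]
      ring
    have h1 : HasDerivAt (fun s => vecMulVec (x s) (x s)) (√w • (vecMulVec u z + vecMulVec z u)) 0 := by
      rw [e]
      have a1 := ((hasDerivAt_id (0 : ℝ)).smul_const (√w • (vecMulVec u z + vecMulVec z u))).const_add W
      have a2 := (hasDerivAt_pow 2 (0 : ℝ)).smul_const (vecMulVec z z)
      exact (a1.add a2).congr_deriv (by simp)
    have h2 := hasDerivAt_comp_matrix hfd h1
    rw [hx0, ← hG, hGt] at h2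
    have h3 : IsLocalMin (fun s => f (vecMulVec (x s) (x s))) 0 := by
      refine Eventually.of_forall fun s => ?_
      simp only [hx0]
      exact hmin (vecMulVec_mem_psdRankLE _)
    have h4 := h3.hasDerivAt_eq_zero h2
    rw [Matrix.mul_smul, trace_smul, Matrix.mul_add, trace_add, mul_vecMulVec, mul_vecMulVec, trace_vecMulVec,
      trace_vecMulVec, smul_eq_mul] at h4
    have h5 : (G *ᵥ z) ⬝ᵥ u = z ⬝ᵥ G *ᵥ u := by
      rw [← hGt, mulVec_transpose, ← dotProduct_mulVec, hGt]
    rw [h5, dotProduct_comm] at h4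
    have := Real.sqrt_pos.mpr htr
    rcases mul_eq_zero.mp h4 with h | h <;> linarith
  exact dotProduct_self_eq_zero.mp (key (G *ᵥ u))

end Minimizer

/-! ### Tangential and normal parts of a deviation -/

section TangentPart
variable {d : ℕ}

/-- The orthogonal projection of (the symmetric part of) a matrix to the tangent space at the
projector `E`. -/
noncomputable def tangentPart (E : Matrix (Fin d) (Fin d) ℝ) :
    Matrix (Fin d) (Fin d) ℝ →ₗ[ℝ] Matrix (Fin d) (Fin d) ℝ where
  toFun X := E * ((2⁻¹ : ℝ) • (X + Xᵀ)) + ((2⁻¹ : ℝ) • (X + Xᵀ)) * E - E * ((2⁻¹ : ℝ) • (X + Xᵀ)) * E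
  map_add' X Y := by
    simp only [transpose_add, smul_add, Matrix.mul_add, Matrix.add_mul]
    abel
  map_smul' c X := by
    simp only [transpose_smul, RingHom.id_apply, ← smul_add, smul_sub, Matrix.mul_smul, Matrix.smul_mul]
    simp only [smul_comm c]

theorem tangentPart_of_transpose (E : Matrix (Fin d) (Fin d) ℝ) {X : Matrix (Fin d) (Fin d) ℝ}
    (hX : Xᵀ = X) : tangentPart E X = E * X + X * E - E * X * E := by
  have : (2⁻¹ : ℝ) • (X + Xᵀ) = X := by
    rw [hX, ← two_smul ℝ X, smul_smul, inv_mul_cancel₀ two_ne_zero, one_smul]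
  change E * ((2⁻¹ : ℝ) • (X + Xᵀ)) + ((2⁻¹ : ℝ) • (X + Xᵀ)) * E - E * ((2⁻¹ : ℝ) • (X + Xᵀ)) * E = _
  rw [this]

variable {u : Fin d → ℝ} {w : ℝ}

theorem tangentPart_mem (hw : 0 < w) (X : Matrix (Fin d) (Fin d) ℝ) :
    tangentPart (vecMulVec u u) X ∈ rankTangent (w • vecMulVec u u) := by
  set E := vecMulVec u u with hE
  have hEt : Eᵀ = E := transpose_vecMulVec u u
  set S := (2⁻¹ : ℝ) • (X + Xᵀ) with hS
  have hSt : Sᵀ = S := by rw [hS, transpose_smul, transpose_add, transpose_transpose, add_comm]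
  -- The term ESE would be counted twice; the factor 1/2 takes half of it from each of V W₀ᵀ and W₀
  -- Vᵀ.
  refine ⟨w⁻¹ • (S - (2⁻¹ : ℝ) • (E * S)), ?_⟩
  change E * S + S * E - E * S * E = _
  clear_value S
  rw [transpose_smul, transpose_smul, transpose_sub, transpose_smul, transpose_mul, hEt, hSt,
    Matrix.smul_mul, Matrix.mul_smul, Matrix.smul_mul, Matrix.mul_smul, smul_smul, smul_smul,
    inv_mul_cancel₀ hw.ne', mul_inv_cancel₀ hw.ne', one_smul, one_smul, Matrix.sub_mul, Matrix.mul_sub,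
    Matrix.smul_mul, Matrix.mul_smul, ← Matrix.mul_assoc]
  have : E * S * E = (2⁻¹ : ℝ) • (E * S * E) + (2⁻¹ : ℝ) • (E * S * E) := by
    rw [← add_smul]; norm_num
  nth_rewrite 1 [this]
  abel

theorem tangentPart_of_mem (hu : u ⬝ᵥ u = 1) {X : Matrix (Fin d) (Fin d) ℝ}
    (hX : X ∈ rankTangent (w • vecMulVec u u)) : tangentPart (vecMulVec u u) X = X := by
  obtain ⟨V, rfl⟩ := hX
  have hEt : (vecMulVec u u)ᵀ = vecMulVec u u := transpose_vecMulVec u u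
  have hEE := vecMulVec_mul_self hu
  generalize vecMulVec u u = E at hEt hEE
  rw [tangentPart_of_transpose]
  · rw [transpose_smul, hEt]
    simp only [Matrix.mul_smul, Matrix.smul_mul, Matrix.mul_add, Matrix.add_mul]
    have e1 : E * (E * Vᵀ) = E * Vᵀ := by rw [← Matrix.mul_assoc, hEE]
    have e2 : V * E * E = V * E := by rw [Matrix.mul_assoc, hEE]
    have e3 : E * (V * E) * E = E * (V * E) := by rw [Matrix.mul_assoc, Matrix.mul_assoc, hEE]
    rw [e1, e2, e3]
    abel
  · rw [transpose_add, transpose_mul, transpose_mul, transpose_transpose, transpose_transpose, add_comm]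

/-- The component normal to the tangent space is controlled by the tail mass. -/
theorem norm_sub_tangentPart_le (hu : u ⬝ᵥ u = 1) (hw : 0 < w) {W : Matrix (Fin d) (Fin d) ℝ}
    (hW : W.PosSemidef) (hT : 0 < W.trace) :
    ‖(W - w • vecMulVec u u) - tangentPart (vecMulVec u u) (W - w • vecMulVec u u)‖ ≤
      (tailMass W * W.trace + ‖W - w • vecMulVec u u‖ ^ 2) / (2 * w) := by
  have hEt : (vecMulVec u u)ᵀ = vecMulVec u u := transpose_vecMulVec u u
  have hEE := vecMulVec_mul_self hu
  have hEtr := trace_vecMulVec_self hu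
  generalize vecMulVec u u = E at hEt hEE hEtr
  have hWt : Wᵀ = W := isHermitian_iff_transpose.mp hW.1
  set X := W - w • E with hX
  have hXt : Xᵀ = X := by rw [hX, transpose_sub, transpose_smul, hWt, hEt]
  clear_value X
  -- The normal part of X is that of W, namely the compression of W to the complement of u. It is
  -- semidefinite, so its trace bounds its norm.
  have hk : X - tangentPart E X = (1 - E) * W * (1 - E)ᵀ := by
    have h1 : W = X + w • E := by rw [hX, sub_add_cancel]
    rw [tangentPart_of_transpose E hXt, h1, transpose_sub, transpose_one, hEt]
    have e1 : (1 - E) * (w • E) = 0 := by rw [Matrix.mul_smul, Matrix.sub_mul, Matrix.one_mul, hEE, sub_self, smul_zero]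
    rw [Matrix.mul_add, e1, add_zero]
    noncomm_ring
  have hpsd : (X - tangentPart E X).PosSemidef := by
    rw [hk]
    have := hW.mul_mul_conjTranspose_same (1 - E)
    rwa [conjTranspose_eq_transpose_of_trivial] at this
  refine (norm_le_trace hpsd).trans ?_
  have htr : (X - tangentPart E X).trace = X.trace - (E * X).trace := by
    rw [tangentPart_of_transpose E hXt, trace_sub, trace_sub, trace_add, Matrix.trace_mul_comm (E * X) E,
      ← Matrix.mul_assoc, hEE, Matrix.trace_mul_comm X E]
    ring
  have hN : (W * W).trace = w ^ 2 + 2 * w * (E * X).trace + ‖X‖ ^ 2 := by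
    have h1 : W = X + w • E := by rw [hX, sub_add_cancel]
    rw [norm_sq_eq_trace, hXt, h1]
    simp only [Matrix.add_mul, Matrix.mul_add, trace_add, Matrix.smul_mul, Matrix.mul_smul, trace_smul, hEE,
      hEtr, smul_eq_mul]
    rw [Matrix.trace_mul_comm X E]
    ring
  have hTT : W.trace = w + X.trace := by
    rw [hX, trace_sub, trace_smul, hEtr, smul_eq_mul]; ring
  have hq : tailMass W * W.trace = W.trace ^ 2 - (W * W).trace := by
    rw [tailMass]; field_simp
  -- Expanding around wE gives (tr W)² - tr W² = 2w (tr X - tr EX) + (tr X)² - ‖X‖², and tr X - tr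
  -- EX is the trace of the normal part.
  rw [htr, le_div_iff₀ (by positivity), hq, hN, hTT]
  nlinarith [sq_nonneg X.trace]

end TangentPart

/-! ### A Lyapunov function at the minimizer -/

section Lyapunov
variable {d : ℕ} {f : Matrix (Fin d) (Fin d) ℝ → ℝ} {L : ℕ} {u : Fin d → ℝ} {w : ℝ}

theorem endToEndField_eq_zero (hL : 3 ≤ L) (hf : Differentiable ℝ f)
    (hsym : ∀ W, f W.transpose = f W) (hu : u ⬝ᵥ u = 1) (hw : 0 < w)
    (hG : matGrad f (w • vecMulVec u u) *ᵥ u = 0) : endToEndField f L (w • vecMulVec u u) = 0 := by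
  have htr : (w • vecMulVec u u).trace = w := by
    rw [trace_smul, trace_vecMulVec_self hu, smul_eq_mul, mul_one]
  have h1 : matGrad f (w • vecMulVec u u) * (w • vecMulVec u u) = 0 := by
    rw [Matrix.mul_smul, mul_vecMulVec, hG, zero_vecMulVec, smul_zero]
  have ht : (w • vecMulVec u u)ᵀ = w • vecMulVec u u := by rw [transpose_smul, transpose_vecMulVec]
  have h2 : (w • vecMulVec u u) * matGrad f (w • vecMulVec u u) = 0 := by
    have := congrArg transpose h1
    rwa [transpose_mul, ← matGrad_transpose hf hsym, ht, transpose_zero] at this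
  rw [endToEndField_of_rankOne hL ((posSemidef_vecMulVec u).smul hw.le) ?_ (htr.symm ▸ hw), h1, h2]
  · simp
  · rw [htr, Matrix.smul_mul, Matrix.mul_smul, vecMulVec_mul_self hu]

/-- The projector uuᵀ is itself tangent. A nonempty eigenbasis is what forces differentiability of
the field and yields a decay rate. -/
theorem rankTangent_finrank_pos (hu : u ⬝ᵥ u = 1) (hw : 0 < w) :
    0 < Module.finrank ℝ (rankTangent (w • vecMulVec u u)) := by
  have hmem : tangentPart (vecMulVec u u) (vecMulVec u u) ∈ rankTangent (w • vecMulVec u u) :=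
    tangentPart_mem hw _
  rw [tangentPart_of_transpose _ (transpose_vecMulVec u u), vecMulVec_mul_self hu, vecMulVec_mul_self hu,
    add_sub_cancel_right] at hmem
  refine Module.finrank_pos_iff_exists_ne_zero.mpr ⟨⟨_, hmem⟩, fun h => ?_⟩
  have h1 : vecMulVec u u = 0 := congrArg Subtype.val h
  have := trace_vecMulVec_self hu
  rw [h1, trace_zero] at this
  exact zero_ne_one this

/-- The coordinates of the tangential part in a basis of eigenvectors of the Jacobian. -/
theorem exists_tangent_coordinates (hu : u ⬝ᵥ u = 1) (hw : 0 < w)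
    (hst : TangentStable f L (w • vecMulVec u u)) :
    DifferentiableAt ℝ (endToEndField f L) (w • vecMulVec u u) ∧
    ∃ (n : ℕ) (l : Fin n → Matrix (Fin d) (Fin d) ℝ →L[ℝ] ℝ) (b : Fin n → Matrix (Fin d) (Fin d) ℝ)
      (e : Fin n → ℝ) (c : ℝ), 0 < n ∧ 0 < c ∧ (∀ i, e i ≤ -c) ∧
      (∀ X, ∑ i, l i X • b i = tangentPart (vecMulVec u u) X) ∧
      ∀ i X, l i (fderiv ℝ (endToEndField f L) (w • vecMulVec u u) (tangentPart (vecMulVec u u) X)) =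
        e i * l i X := by
  have hpos := rankTangent_finrank_pos hu hw
  have hmem := tangentPart_mem (u := u) hw
  have hfix := fun X => tangentPart_of_mem (X := X) (w := w) hu
  generalize vecMulVec u u = E at *
  obtain ⟨b, e, h⟩ := hst
  have hbe : ∀ i, e i < 0 ∧ fderiv ℝ (endToEndField f L) (w • E) (b i : Matrix (Fin d) (Fin d) ℝ) =
    e i • (b i : Matrix (Fin d) (Fin d) ℝ) := h
  clear h
  generalize Module.finrank ℝ (rankTangent (w • E)) = n at *
  have : Nonempty (Fin n) := ⟨⟨0, hpos⟩⟩
  obtain ⟨i₁, hi₁⟩ := Finite.exists_max e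
  set ρ : Matrix (Fin d) (Fin d) ℝ →ₗ[ℝ] rankTangent (w • E) :=
    LinearMap.codRestrict _ (tangentPart E) hmem with hρ
  set l : Fin n → Matrix (Fin d) (Fin d) ℝ →L[ℝ] ℝ := fun i =>
    LinearMap.toContinuousLinearMap (b.coord i ∘ₗ ρ) with hl
  have hl_apply : ∀ i X, l i X = b.coord i (ρ X) := fun i X => rfl
  have hsum : ∀ X, ∑ i, l i X • (b i : Matrix (Fin d) (Fin d) ℝ) = tangentPart E X := fun X => by
    have h1 := congrArg Subtype.val (b.sum_repr (ρ X))
    rw [AddSubmonoidClass.coe_finsetSum] at h1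
    exact h1
  have hρb : ∀ i, ρ (b i : Matrix (Fin d) (Fin d) ℝ) = b i := fun i =>
    Subtype.ext (hfix _ (b i).2)
  have hlb : ∀ i j, l i (b j : Matrix (Fin d) (Fin d) ℝ) = if i = j then 1 else 0 := fun i j => by
    rw [hl_apply, hρb, Module.Basis.coord_apply, Module.Basis.repr_self, Finsupp.single_apply]
    simp only [eq_comm]
  refine ⟨?_, n, l, fun i => b i, e, -e i₁, hpos, by linarith [(hbe i₁).1],
    fun i => by rw [neg_neg]; exact hi₁ i, hsum, fun i X => ?_⟩
  -- Without differentiability `fderiv` would be zero, and a basis vector with negative eigenvalue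
  -- would have to vanish.
  · by_contra h
    have h1 := (hbe ⟨0, hpos⟩).2
    rw [fderiv_zero_of_not_differentiableAt h] at h1
    have h2 : (b ⟨0, hpos⟩ : Matrix (Fin d) (Fin d) ℝ) = 0 :=
      (smul_eq_zero.mp h1.symm).resolve_left (hbe ⟨0, hpos⟩).1.ne
    exact b.ne_zero ⟨0, hpos⟩ (Subtype.ext h2)
  · rw [← hsum X, map_sum, map_sum, Finset.sum_eq_single i]
    · rw [map_smul, (hbe i).2, map_smul, map_smul, hlb, if_pos rfl]
      simp [mul_comm]
    · intro j _ hj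
      rw [map_smul, (hbe j).2, map_smul, map_smul, hlb, if_neg hj.symm]
      simp
    · simp

/-- The coordinates of the tangential part in a basis of eigenvectors of the Jacobian form a
Lyapunov function, up to the tail mass. -/
theorem exists_lyapunov (hL : 3 ≤ L) (hf : Differentiable ℝ f)
    (hsym : ∀ W, f W.transpose = f W) (hu : u ⬝ᵥ u = 1) (hw : 0 < w)
    (hG : matGrad f (w • vecMulVec u u) *ᵥ u = 0) (hst : TangentStable f L (w • vecMulVec u u)) :
    ∃ (n : ℕ) (l : Fin n → Matrix (Fin d) (Fin d) ℝ →L[ℝ] ℝ) (c K r : ℝ), 0 < c ∧ 0 < K ∧ 0 < r ∧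
      ∀ W : Matrix (Fin d) (Fin d) ℝ, W.PosSemidef → 0 < W.trace → ‖W - w • vecMulVec u u‖ ≤ r →
        ‖W - w • vecMulVec u u‖ ≤ K * (√(∑ i, l i (W - w • vecMulVec u u) ^ 2) + tailMass W) ∧
        2 * ∑ i, l i (W - w • vecMulVec u u) * l i (endToEndField f L W) ≤
          -c * ∑ i, l i (W - w • vecMulVec u u) ^ 2 + K * tailMass W ^ 2 ∧
        ∑ i, l i (W - w • vecMulVec u u) ^ 2 ≤ K * ‖W - w • vecMulVec u u‖ ^ 2 := by
  have hg0 := endToEndField_eq_zero hL hf hsym hu hw hG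
  obtain ⟨hdiff, n, l, b, c', c, hpos, hc0, hcc, hsum, hlJ⟩ := exists_tangent_coordinates hu hw hst
  have hnorm := fun W => norm_sub_tangentPart_le (W := W) hu hw
  have hEtr := trace_vecMulVec_self hu
  generalize vecMulVec u u = E at *
  clear hG hst
  have hJ := hdiff.hasFDerivAt
  generalize fderiv ℝ (endToEndField f L) (w • E) = J at *
  set Λ := ∑ i, ‖l i‖ with hΛ
  have hΛi : ∀ i, ‖l i‖ ≤ Λ := fun i =>
    Finset.single_le_sum (f := fun i => ‖l i‖) (fun j _ => norm_nonneg _) (Finset.mem_univ i)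
  have hΛ0 : 0 ≤ Λ := Finset.sum_nonneg fun _ _ => norm_nonneg _
  set A := Λ * (‖J‖ + 1) + 1 with hA
  have hJ0 : 0 ≤ ‖J‖ := norm_nonneg J
  have hA0 : 0 < A := by positivity
  set B := ∑ i, ‖b i‖ with hB
  have hB0 : 0 ≤ B := Finset.sum_nonneg fun _ _ => norm_nonneg _
  set D : ℝ := 1 + d with hD
  have hD0 : 0 < D := by positivity
  have hn0 : (0 : ℝ) < n := by exact_mod_cast hpos
  clear_value A B D Λ
  obtain ⟨K₁, hK₁, hK₁'⟩ : ∃ K₁, 0 ≤ K₁ ∧ (9 / 2) * n ^ 2 * A ^ 2 * D ^ 2 / c ≤ K₁ :=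
    ⟨_, by positivity, le_rfl⟩
  obtain ⟨K₂, hK₂, hK₂'⟩ : ∃ K₂, 0 ≤ K₂ ∧ n * Λ ^ 2 ≤ K₂ := ⟨_, by positivity, le_rfl⟩
  -- θ bounds the linearization error and the quadratic part of the normal component, both relative
  -- to ‖X‖. It is small enough that ‖X‖ can be absorbed and that half of the term cV pays for the
  -- resulting cross terms; it then dictates the radius r.
  obtain ⟨θ, hθ0, hθ1, hθ2⟩ : ∃ θ, 0 < θ ∧ 2 * θ ≤ 1 ∧ 2 * n * (A * (2 * θ * (2 * B))) ≤ c / 2 := by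
    obtain ⟨θ, h0, h1, h2⟩ : ∃ θ, 0 < θ ∧ θ ≤ 1 / 2 ∧ θ ≤ c / (16 * n * A * (B + 1)) :=
      ⟨min (1 / 2) (c / (16 * n * A * (B + 1))), by positivity, min_le_left _ _, min_le_right _ _⟩
    refine ⟨θ, h0, by linarith, ?_⟩
    rw [le_div_iff₀ (by positivity)] at h2
    have h3 : 0 ≤ n * A * θ := by positivity
    linarith
  obtain ⟨r₁, hr₁, hball⟩ := Metric.eventually_nhds_iff.mp (hJ.isLittleO.def hθ0)
  obtain ⟨r, hr0, hr1, hr2, hr3⟩ : ∃ r, 0 < r ∧ r ≤ r₁ / 2 ∧ r ≤ w ∧ r ≤ 2 * w * θ :=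
    ⟨min (r₁ / 2) (min w (2 * w * θ)), by positivity, min_le_left _ _,
      (min_le_right _ _).trans (min_le_left _ _), (min_le_right _ _).trans (min_le_right _ _)⟩
  refine ⟨n, l, c, 2 * B + D + 1 + K₁ + K₂, r, hc0, by positivity, hr0, fun W hW hT hWr => ?_⟩
  have hq0 := tailMass_nonneg hW hT
  have hk := hnorm W hW hT
  have hrem := hball (y := W) (by
    rw [dist_eq_norm]
    linarith)
  rw [hg0, sub_zero] at hrem
  have htrW : W.trace ≤ D * w := by
    have h1 : W.trace = w + (W - w • E).trace := by
      rw [trace_sub, trace_smul, hEtr, smul_eq_mul]; ring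
    have h2 := (abs_le.mp (abs_trace_le (W - w • E))).2
    have h3 : ‖W - w • E‖ ≤ w := hWr.trans hr2
    have h4 : (d : ℝ) * ‖W - w • E‖ ≤ d * w := by gcongr
    rw [hD]; linarith
  have hrθ : ‖W - w • E‖ ≤ 2 * w * θ := hWr.trans hr3
  set X := W - w • E with hX
  set q := tailMass W with hq
  clear_value X q
  have hx0 : 0 ≤ ‖X‖ := norm_nonneg X
  have hk' : ‖X - tangentPart E X‖ ≤ D * q / 2 + θ * ‖X‖ := by
    refine hk.trans ?_
    rw [div_le_iff₀ (by positivity)]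
    linarith [mul_le_mul_of_nonneg_left htrW hq0, mul_le_mul_of_nonneg_left hrθ hx0]
  set V := ∑ i, l i X ^ 2 with hV
  have hV0 : 0 ≤ V := Finset.sum_nonneg fun _ _ => sq_nonneg _
  set Y := √V with hY
  have hY0 : 0 ≤ Y := Real.sqrt_nonneg V
  have hYV : Y ^ 2 = V := Real.sq_sqrt hV0
  have hlY : ∀ i, |l i X| ≤ Y := fun i => by
    refine Real.abs_le_sqrt ?_
    exact Finset.single_le_sum (f := fun i => l i X ^ 2) (fun j _ => sq_nonneg _) (Finset.mem_univ i)
  have htan : ‖tangentPart E X‖ ≤ B * Y := by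
    rw [← hsum X, hB, Finset.sum_mul]
    refine (norm_sum_le _ _).trans (Finset.sum_le_sum fun i _ => ?_)
    rw [norm_smul, mul_comm, Real.norm_eq_abs]
    gcongr
    exact hlY i
  clear_value Y
  have hXle : ‖X‖ ≤ 2 * B * Y + D * q := by
    have := norm_add_le (tangentPart E X) (X - tangentPart E X)
    rw [add_sub_cancel] at this
    linarith [mul_le_mul_of_nonneg_right hθ1 hx0]
  refine ⟨?_, ?_, ?_⟩
  · refine hXle.trans ?_
    have z1 : 0 ≤ (D + 1 + K₁ + K₂) * Y := by positivity
    have z2 : 0 ≤ (2 * B + 1 + K₁ + K₂) * q := by positivity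
    linarith
  · have herr : ∀ i, |l i (endToEndField f L W) - c' i * l i X| ≤ A * (3 / 2 * D * q + 2 * θ * (2 * B * Y)) := by
      intro i
      have e1 : endToEndField f L W = J (tangentPart E X) + (J (X - tangentPart E X) +
          (endToEndField f L W - J X)) := by
        rw [map_sub]; abel
      have e2 : l i (endToEndField f L W) - c' i * l i X =
          l i (J (X - tangentPart E X) + (endToEndField f L W - J X)) := by
        rw [e1, map_add, hlJ]
        rw [← e1]; ring
      rw [e2]
      calc |l i (J (X - tangentPart E X) + (endToEndField f L W - J X))|
          ≤ ‖l i‖ * ‖J (X - tangentPart E X) + (endToEndField f L W - J X)‖ := (l i).le_opNorm _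
        _ ≤ Λ * (‖J‖ * (D * q / 2 + θ * ‖X‖) + θ * ‖X‖) := by
          gcongr
          · exact hΛi i
          · refine (norm_add_le _ _).trans (add_le_add ((J.le_opNorm _).trans ?_) hrem)
            gcongr
        _ ≤ Λ * ((‖J‖ + 1) * (D * q / 2 + 2 * θ * ‖X‖)) := by
          gcongr
          have : 0 ≤ D * q / 2 := by positivity
          have : 0 ≤ ‖J‖ * (θ * ‖X‖) := by positivity
          have : 0 ≤ θ * ‖X‖ := by positivity
          linarith
        _ ≤ A * (D * q / 2 + 2 * θ * ‖X‖) := by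
          rw [← mul_assoc]
          gcongr
          rw [hA]; linarith
        _ ≤ A * (3 / 2 * D * q + 2 * θ * (2 * B * Y)) := by
          refine mul_le_mul_of_nonneg_left ?_ hA0.le
          have h1 : 2 * θ * ‖X‖ ≤ 2 * θ * (2 * B * Y + D * q) := by gcongr
          have h2 : 2 * θ * (D * q) ≤ 1 * (D * q) := by gcongr
          linarith
    set ε := A * (3 / 2 * D * q + 2 * θ * (2 * B * Y)) with hε
    have hterm : ∀ i, l i X * l i (endToEndField f L W) ≤ -c * l i X ^ 2 + Y * ε := fun i => by
      have h1 : l i X * l i (endToEndField f L W) = c' i * l i X ^ 2 +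
          l i X * (l i (endToEndField f L W) - c' i * l i X) := by ring
      rw [h1]
      have h2 : c' i * l i X ^ 2 ≤ -c * l i X ^ 2 := mul_le_mul_of_nonneg_right (hcc i) (sq_nonneg _)
      have h3 : l i X * (l i (endToEndField f L W) - c' i * l i X) ≤ Y * ε := by
        refine (le_abs_self _).trans ?_
        rw [abs_mul]
        exact mul_le_mul (hlY i) (herr i) (abs_nonneg _) hY0
      linarith
    have hs : ∑ i, l i X * l i (endToEndField f L W) ≤ -c * V + n * (Y * ε) := by
      refine (Finset.sum_le_sum fun i _ => hterm i).trans ?_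
      rw [Finset.sum_add_distrib, ← Finset.mul_sum]
      simp [hV]
    -- Of the decay 2cV one half is spent on errors: c/2 by the choice of θ, and c/2 by Young's
    -- inequality on the product of √V and the tail mass.
    have h4 : 2 * (n * (Y * ε)) ≤ c * V + (9 / 2) * n ^ 2 * A ^ 2 * D ^ 2 / c * q ^ 2 := by
      have e1 : 2 * (n * (Y * ε)) = 3 * n * A * D * q * Y + 2 * n * (A * (2 * θ * (2 * B))) * Y ^ 2 := by
        rw [hε]; ring
      have h5 : 2 * n * (A * (2 * θ * (2 * B))) * Y ^ 2 ≤ c / 2 * Y ^ 2 := by gcongr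
      have h6 : 3 * n * A * D * q * Y ≤ c / 2 * Y ^ 2 + (9 / 2) * n ^ 2 * A ^ 2 * D ^ 2 / c * q ^ 2 := by
        have h7 : 0 ≤ (c * Y - 3 * n * A * D * q) ^ 2 / (2 * c) := by positivity
        have h8 : (c * Y - 3 * n * A * D * q) ^ 2 / (2 * c) = c / 2 * Y ^ 2 - 3 * n * A * D * q * Y +
            (9 / 2) * n ^ 2 * A ^ 2 * D ^ 2 / c * q ^ 2 := by field_simp; ring
        linarith
      rw [e1, ← hYV]; linarith
    have h5 : (9 / 2) * n ^ 2 * A ^ 2 * D ^ 2 / c * q ^ 2 ≤ (2 * B + D + 1 + K₁ + K₂) * q ^ 2 := by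
      gcongr
      linarith
    linarith
  · have h1 : V ≤ n * (Λ * ‖X‖) ^ 2 := by
      rw [hV]
      refine (Finset.sum_le_sum (g := fun _ => (Λ * ‖X‖) ^ 2) fun i _ => ?_).trans (by simp)
      rw [← sq_abs]
      gcongr
      exact ((l i).le_opNorm X).trans (by gcongr; exact hΛi i)
    have h2 : 0 ≤ (2 * B + D + 1 + K₁) * ‖X‖ ^ 2 := by positivity
    have h3 : n * Λ ^ 2 * ‖X‖ ^ 2 ≤ K₂ * ‖X‖ ^ 2 := by gcongr
    linarith

end Lyapunov

/-! ### Logarithmic final phase and conclusion -/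

section FinalPhase

/-- Continuous induction: a continuous function that starts below `r` and is below `r` at the end of
each interval on which it is at most `r` stays below `r`. -/
theorem forall_lt_of_forall_le_imp_lt {φ : ℝ → ℝ} {a b r : ℝ} (hc : ContinuousOn φ (Set.Icc a b))
    (ha : φ a < r) (h : ∀ t ∈ Set.Icc a b, (∀ s ∈ Set.Icc a t, φ s ≤ r) → φ t < r) :
    ∀ t ∈ Set.Icc a b, φ t < r := by
  have key : ∀ t ∈ Set.Icc a b, r ≤ φ t → ∃ s ∈ Set.Icc a t, φ s = r := fun t ht h1 =>
    intermediate_value_Icc ht.1 (hc.mono (Set.Icc_subset_Icc_right ht.2)) ⟨ha.le, h1⟩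
  by_contra! hcon
  obtain ⟨t, ht, h1⟩ := hcon
  obtain ⟨s, hs, h2⟩ := key t ht h1
  have hcl : IsCompact (Set.Icc a b ∩ φ ⁻¹' {r}) :=
    isCompact_Icc.of_isClosed_subset (hc.preimage_isClosed_of_isClosed isClosed_Icc isClosed_singleton)
      Set.inter_subset_left
  obtain ⟨m, ⟨hm, hmr⟩, hmin⟩ := hcl.exists_isLeast ⟨s, ⟨hs.1, hs.2.trans ht.2⟩, h2⟩
  refine (h m hm fun x hx => ?_).ne hmr
  by_contra! h3
  obtain ⟨y, hy, h4⟩ := key x ⟨hx.1, hx.2.trans hm.2⟩ h3.le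
  have h5 : m ≤ y := hmin ⟨⟨hy.1, hy.2.trans (hx.2.trans hm.2)⟩, h4⟩
  have h6 : x = m := le_antisymm hx.2 (h5.trans hy.2)
  rw [h6] at h3
  exact h3.ne' hmr

variable {d : ℕ} {f : Matrix (Fin d) (Fin d) ℝ → ℝ} {L : ℕ} {u : Fin d → ℝ} {w : ℝ}

/-- A solution that comes near the stable rank-one point with tail mass `O(α)` gets `O(α)`-close
to this point. -/
theorem exists_final_phase (hL : 3 ≤ L) (hf : ContDiff ℝ 3 f)
    (hsym : ∀ W, f W.transpose = f W) (hu : u ⬝ᵥ u = 1) (hw : 0 < w)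
    (hG : matGrad f (w • vecMulVec u u) *ᵥ u = 0) (hst : TangentStable f L (w • vecMulVec u u)) :
    ∃ r₀, 0 < r₀ ∧ ∀ C₁, 0 < C₁ → ∃ C₂, 0 < C₂ ∧ ∀ᶠ α in 𝓝[>] (0 : ℝ),
      ∀ (W₀ : Matrix (Fin d) (Fin d) ℝ) (W : ℝ → Matrix (Fin d) (Fin d) ℝ) (t₀ : ℝ),
        IsEndToEndSolution f L W₀ W → 0 ≤ t₀ → (∀ s, t₀ ≤ s → (W s).PosSemidef ∧ 0 < (W s).trace) →
        ‖W t₀ - w • vecMulVec u u‖ < r₀ → tailMass (W t₀) ≤ C₁ * α →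
        ∃ t, t₀ ≤ t ∧ ‖W t - w • vecMulVec u u‖ ≤ C₂ * α := by
  have hL' : (3 : ℝ) ≤ L := by exact_mod_cast hL
  obtain ⟨n, l, c, K, r, hc, hK, hr, hlyap⟩ :=
    exists_lyapunov hL (hf.differentiable (by norm_num)) hsym hu hw hG hst
  generalize w • vecMulVec u u = X at *
  obtain ⟨C', hC', htail⟩ := exists_tailMass_le_two_mul (d := d) hL hf (‖X‖ + r)
  have hκ0 : (0 : ℝ) < 1 - 2 / L := by
    rw [sub_pos, div_lt_one (by positivity)]; linarith
  -- A start within r₀ contributes at most r/2 to the later distance. The other half is left for the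
  -- tail mass, which is small with α; r₀ must not depend on C₁.
  obtain ⟨r₀, hr₀, hr₀r, hr₀K⟩ : ∃ r₀, 0 < r₀ ∧ r₀ ≤ r ∧ K * (√K * r₀) ≤ r / 2 := by
    refine ⟨min r (r / 2 / (K * √K)), by positivity, min_le_left _ _, ?_⟩
    have := min_le_right r (r / 2 / (K * √K))
    rw [le_div_iff₀ (by positivity)] at this
    linarith
  refine ⟨r₀, hr₀, fun C₁ hC₁ => ?_⟩
  set S := K * r₀ ^ 2 + K / c * (2 * C₁) ^ 2 with hS
  have hS0 : 0 < S := by positivity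
  refine ⟨K * (√S + 2 * C₁), by positivity, ?_⟩
  have hpos : ∀ᶠ α in 𝓝[>] (0 : ℝ), 0 < α := self_mem_nhdsWithin
  have hlen : ∀ᶠ α in 𝓝[>] (0 : ℝ), C' * (C₁ * α) ^ (1 - 2 / L : ℝ) * (2 / c * -Real.log α) ≤ 1 := by
    have h1 : Tendsto (fun α : ℝ => C' * C₁ ^ (1 - 2 / L : ℝ) * (2 / c) *
        (α ^ (1 - 2 / L : ℝ) * -Real.log α)) (𝓝[>] 0) (𝓝 0) := by
      simpa using (tendsto_rpow_mul_neg_log hκ0).const_mul (C' * C₁ ^ (1 - 2 / L : ℝ) * (2 / c))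
    filter_upwards [hpos, h1.eventually_le_const zero_lt_one] with α hα h2
    refine le_of_eq_of_le ?_ h2
    rw [Real.mul_rpow hC₁.le hα.le]
    ring
  have hsmall : ∀ᶠ α in 𝓝[>] (0 : ℝ), K * ((√(K / c) + 1) * (2 * C₁)) * α < r / 2 := by
    have h1 : Tendsto (fun α : ℝ => K * ((√(K / c) + 1) * (2 * C₁)) * α) (𝓝[>] 0) (𝓝 0) := by
      have : Tendsto (fun α : ℝ => α) (𝓝[>] (0 : ℝ)) (𝓝 0) := tendsto_nhdsWithin_of_tendsto_nhds tendsto_id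
      simpa using this.const_mul (K * ((√(K / c) + 1) * (2 * C₁)))
    exact h1.eventually_lt_const (by positivity)
  filter_upwards [hpos, hlen, hsmall,
    eventually_nhdsWithin_of_eventually_nhds (eventually_le_nhds zero_lt_one)] with α hα hα1 hα2 hα3
  intro W₀ W t₀ hsol ht₀ hW hWr hWq
  have hlog : 0 ≤ -Real.log α := neg_nonneg.mpr (Real.log_nonpos hα.le hα3)
  -- The length is chosen so that exp(-cτ) = α², which makes √V of order α. Over this logarithmic
  -- time the tail mass at most doubles.
  set τ := 2 / c * -Real.log α with hτ
  have hτ0 : 0 ≤ τ := by positivity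
  set Q := 2 * (C₁ * α) with hQ
  have hQ0 : 0 < Q := by positivity
  set V : ℝ → ℝ := fun s => ∑ i, l i (W s - X) ^ 2 with hV
  have hV0 : ∀ s, 0 ≤ V s := fun s => Finset.sum_nonneg fun _ _ => sq_nonneg _
  have hVd : ∀ s, t₀ ≤ s → HasDerivWithinAt V
      (2 * ∑ i, l i (W s - X) * l i (endToEndField f L (W s))) (Set.Ici 0) s := fun s hs => by
    have h1 : ∀ i ∈ Finset.univ, HasDerivWithinAt (fun s => l i (W s - X) ^ 2)
        (2 * (l i (W s - X) * l i (endToEndField f L (W s)))) (Set.Ici 0) s := fun i _ => by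
      have h2 : HasDerivWithinAt (fun s => l i (W s - X)) (l i (endToEndField f L (W s))) (Set.Ici 0) s :=
        (l i).hasFDerivAt.comp_hasDerivWithinAt s ((hsol.hasDerivWithinAt (ht₀.trans hs)).sub_const X)
      exact (h2.pow 2).congr_deriv (by push_cast; ring)
    have h2 := HasDerivWithinAt.fun_sum h1
    rwa [← Finset.mul_sum] at h2
  have main : ∀ t ∈ Set.Icc t₀ (t₀ + τ), (∀ s ∈ Set.Icc t₀ t, ‖W s - X‖ ≤ r) →
      V t ≤ V t₀ * Real.exp (-c * (t - t₀)) + K / c * Q ^ 2 ∧ ‖W t - X‖ ≤ K * (√(V t) + Q) := by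
    intro t ht hball
    have hq : ∀ s ∈ Set.Icc t₀ t, tailMass (W s) ≤ Q := by
      refine htail W₀ W t₀ t (C₁ * α) hsol ht₀ (fun s hs => ⟨(hW s hs.1).1, (hW s hs.1).2, ?_⟩)
        (by positivity) hWq ?_
      · have := norm_add_le X (W s - X)
        rw [add_sub_cancel] at this
        linarith [hball s hs]
      · refine le_trans ?_ hα1
        have : t - t₀ ≤ τ := by linarith [ht.2]
        gcongr
    have htt : t ∈ Set.Icc t₀ t := ⟨ht.1, le_rfl⟩
    constructor
    · have key := le_mul_exp_sub_of_deriv_le (φ := fun s => V s - K / c * Q ^ 2) (a := t₀) (b := t) (K := -c)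
        (φ' := fun s => 2 * ∑ i, l i (W s - X) * l i (endToEndField f L (W s)))
        (fun s hs => ((hVd s hs.1).continuousWithinAt.mono fun x hx => ht₀.trans hx.1).sub
          continuousWithinAt_const)
        (fun s hs => ((hVd s hs.1).mono (Set.Ici_subset_Ici.mpr (ht₀.trans hs.1))).sub_const _)
        (fun s hs => ?_) t htt
      · have h1 : 0 ≤ K / c * Q ^ 2 * Real.exp (-c * (t - t₀)) := by positivity
        simp only [sub_mul] at key
        linarith
      · have hs' := Set.Ico_subset_Icc_self hs
        have h1 := (hlyap (W s) (hW s hs.1).1 (hW s hs.1).2 (hball s hs')).2.1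
        have h2 := tailMass_nonneg (hW s hs.1).1 (hW s hs.1).2
        have h3 : K * tailMass (W s) ^ 2 ≤ K * Q ^ 2 := by
          have := hq s hs'
          gcongr
        have h4 : -c * (V s - K / c * Q ^ 2) = -c * V s + K * Q ^ 2 := by field_simp; ring
        rw [h4]
        exact h1.trans (by linarith)
    · refine (hlyap (W t) (hW t ht.1).1 (hW t ht.1).2 (hball t htt)).1.trans ?_
      have := hq t htt
      gcongr
  have hVt₀ : V t₀ ≤ K * r₀ ^ 2 := by
    refine (hlyap (W t₀) (hW t₀ le_rfl).1 (hW t₀ le_rfl).2 (hWr.le.trans hr₀r)).2.2.trans ?_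
    gcongr
  -- Bootstrap: the estimates hold while the solution is in the ball of radius r, and they place it
  -- strictly inside.
  have hin : ∀ t ∈ Set.Icc t₀ (t₀ + τ), ‖W t - X‖ < r := by
    refine forall_lt_of_forall_le_imp_lt ?_ (hWr.trans_le hr₀r) fun t ht hball => ?_
    · exact ((hsol.continuousOn.mono fun s hs => ht₀.trans hs.1).sub continuousOn_const).norm
    · obtain ⟨h1, h2⟩ := main t ht hball
      have h3 : Real.exp (-c * (t - t₀)) ≤ 1 := by
        rw [Real.exp_le_one_iff]; nlinarith [ht.1]
      have h4 : V t ≤ K * r₀ ^ 2 + K / c * Q ^ 2 := by nlinarith [hV0 t₀]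
      have h5 : √(V t) ≤ √K * r₀ + √(K / c) * Q := by
        refine Real.sqrt_le_iff.mpr ⟨by positivity, h4.trans ?_⟩
        have e1 : √K ^ 2 = K := Real.sq_sqrt hK.le
        have e2 : √(K / c) ^ 2 = K / c := Real.sq_sqrt (by positivity)
        have e3 : 0 ≤ √K * r₀ * (√(K / c) * Q) := by positivity
        calc K * r₀ ^ 2 + K / c * Q ^ 2 = √K ^ 2 * r₀ ^ 2 + √(K / c) ^ 2 * Q ^ 2 := by rw [e1, e2]
          _ ≤ _ := by linarith
      calc ‖W t - X‖ ≤ K * (√(V t) + Q) := h2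
        _ ≤ K * (√K * r₀ + √(K / c) * Q + Q) := by gcongr
        _ = K * (√K * r₀) + K * ((√(K / c) + 1) * (2 * C₁)) * α := by rw [hQ]; ring
        _ < r := by linarith
  have hmem : t₀ + τ ∈ Set.Icc t₀ (t₀ + τ) := ⟨by linarith, le_rfl⟩
  obtain ⟨h1, h2⟩ := main _ hmem fun s hs => (hin s hs).le
  refine ⟨t₀ + τ, by linarith, h2.trans ?_⟩
  have h3 : Real.exp (-c * (t₀ + τ - t₀)) = α ^ 2 := by
    rw [add_sub_cancel_left, hτ, show -c * (2 / c * -Real.log α) = (2 : ℕ) * Real.log α by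
      push_cast; field_simp, Real.exp_nat_mul, Real.exp_log hα]
  have h4 : V (t₀ + τ) ≤ S * α ^ 2 := by
    rw [h3] at h1
    calc V (t₀ + τ) ≤ K * r₀ ^ 2 * α ^ 2 + K / c * Q ^ 2 := h1.trans (by gcongr)
      _ = S * α ^ 2 := by rw [hS, hQ]; ring
  have h5 : √(V (t₀ + τ)) ≤ √S * α := by
    refine (Real.sqrt_le_sqrt h4).trans (le_of_eq ?_)
    rw [Real.sqrt_mul hS0.le, Real.sqrt_sq hα.le]
  calc K * (√(V (t₀ + τ)) + Q) ≤ K * (√S * α + Q) := by gcongr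
    _ = _ := by rw [hQ]; ring

/-- The two assertions of the main theorem, for the Frobenius topology. -/
theorem tendsto_glrlApprox_and_isBigO [NeZero d] (hL : 3 ≤ L) (hf : ContDiff ℝ 3 f)
    (hsym : ∀ W, f W.transpose = f W)
    (hflow : ∀ W₀ : Matrix (Fin d) (Fin d) ℝ, W₀.PosSemidef →
      ∃ W : ℝ → Matrix (Fin d) (Fin d) ℝ, IsEndToEndSolution f L W₀ W)
    {μ : ℝ} (hμ : μ = eigDesc (-matGrad f 0) 0) (hnorm : spectralNorm₂ (matGrad f 0) = μ)
    (hpos : 0 < μ) (hgap : ∀ h : 1 < d, eigDesc (-matGrad f 0) ⟨1, h⟩ < μ)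
    {v : Fin d → ℝ} (hv : v ⬝ᵥ v = 1) (hvtop : (-matGrad f 0).mulVec v = μ • v)
    {X : Matrix (Fin d) (Fin d) ℝ} (hlim : Tendsto (glrlTrajectory f L μ v) atTop (𝓝 X))
    (hmem : X ∈ psdRankLE d 1) (hmin : IsMinOn f (psdRankLE d 1) X) (hstable : TangentStable f L X) :
    (∀ t : ℝ, Tendsto (fun α : ℝ => glrlApprox f L μ v α t) (𝓝[>] 0) (𝓝 (glrlTrajectory f L μ v t))) ∧
    (fun α : ℝ => ⨅ t : Set.Ici (0 : ℝ), ‖flow f L (α • (1 : Matrix (Fin d) (Fin d) ℝ)) t - X‖)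
      =O[𝓝[>] 0] (fun α : ℝ => α) := by
  have hfd : Differentiable ℝ f := hf.differentiable (by norm_num)
  obtain ⟨U, a, i₀, γ, hS⟩ := exists_spectralGap
    (matGrad_isHermitian hfd hsym (transpose_zero (m := Fin d) (n := Fin d))).neg hμ hpos hgap hv hvtop
  have hconv : ∀ t, Tendsto (fun α => glrlApprox f L μ v α t) (𝓝[>] 0) (𝓝 (glrlTrajectory f L μ v t)) ∧
      Tendsto (fun α => flow f L (α • (1 : Matrix (Fin d) (Fin d) ℝ)) (delay L μ α + t)) (𝓝[>] 0)
        (𝓝 (glrlTrajectory f L μ v t)) := fun t => by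
    obtain ⟨N, h1, h2, -⟩ := exists_tendsto_flow hL hf hsym hflow hpos hnorm hS t
    have h3 : glrlTrajectory f L μ v t = N := Tendsto.limUnder_eq h1
    rw [h3]
    exact ⟨h1, h2⟩
  refine ⟨fun t => (hconv t).1, ?_⟩
  obtain ⟨u, w, hu, hw, rfl, hG⟩ := exists_rankOne_minimizer hf hsym hmem hmin hpos hv hvtop
  obtain ⟨r₀, hr₀, hfinal⟩ := exists_final_phase hL hf hsym hu hw hG hstable
  -- A time at which the limit trajectory is r₀-close to the minimizer. It is fixed before α tends
  -- to 0, so the convergence at this single time brings the orbit of αI into the same ball.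
  obtain ⟨t₀, ht₀⟩ := (Metric.tendsto_nhds.mp hlim r₀ hr₀).exists
  obtain ⟨C₁, hC₁, hq⟩ := exists_tailMass_flow_le hL hf hsym hflow hpos hnorm hS t₀
  obtain ⟨C₂, hC₂, hend⟩ := hfinal C₁ hC₁
  have hnear := ((hconv t₀).2.dist tendsto_const_nhds).eventually_lt_const ht₀
  refine Asymptotics.IsBigO.of_bound C₂ ?_
  filter_upwards [self_mem_nhdsWithin, hnear, hq, hend,
    (tendsto_delay (L := L) hL hpos).eventually_ge_atTop (-t₀)] with α hα h1 h2 h3 h4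
  have hα' : (0 : ℝ) < α := hα
  have hsol := flow_spec hflow ((PosSemidef.one (n := Fin d) (R := ℝ)).smul hα'.le)
  have hpd := (hsol.isRootFlow_of_posDef hL hf hsym (PosDef.one.smul hα')).1
  rw [dist_eq_norm] at h1
  obtain ⟨t, ht, h5⟩ := h3 _ _ (delay L μ α + t₀) hsol (by linarith)
    (fun s hs => ⟨(hpd s (by linarith)).posSemidef, (hpd s (by linarith)).trace_pos⟩) h1 h2
  have h6 : ⨅ t : Set.Ici (0 : ℝ), ‖flow f L (α • (1 : Matrix (Fin d) (Fin d) ℝ)) t - w • vecMulVec u u‖ ≤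
      ‖flow f L (α • (1 : Matrix (Fin d) (Fin d) ℝ)) t - w • vecMulVec u u‖ :=
    ciInf_le (f := fun t : Set.Ici (0 : ℝ) =>
      ‖flow f L (α • (1 : Matrix (Fin d) (Fin d) ℝ)) t - w • vecMulVec u u‖)
      ⟨0, by rintro _ ⟨t, rfl⟩; exact norm_nonneg _⟩ ⟨t, show (0 : ℝ) ≤ t by linarith⟩
  rw [Real.norm_of_nonneg (Real.iInf_nonneg fun _ => norm_nonneg _), Real.norm_of_nonneg hα'.le]
  exact h6.trans h5

end FinalPhase

end Main

theorem theorem6p4 {d : ℕ} [NeZero d] (L : ℕ) (hL : 3 ≤ L)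
    (f : Matrix (Fin d) (Fin d) ℝ → ℝ)
    (hf : ContDiff ℝ 3 f) (hconv : ConvexOn ℝ Set.univ f)
    (hsym : ∀ W, f W.transpose = f W)
    (hflow : ∀ W₀ : Matrix (Fin d) (Fin d) ℝ, W₀.PosSemidef →
      ∃ W : ℝ → Matrix (Fin d) (Fin d) ℝ, IsEndToEndSolution f L W₀ W)
    (μ₁ : ℝ) (hμ₁ : μ₁ = eigDesc (-matGrad f 0) 0)
    (hnorm : spectralNorm₂ (matGrad f 0) = μ₁)
    (hpos : 0 < μ₁)
    (hgap : ∀ h : 1 < d, eigDesc (-matGrad f 0) ⟨1, h⟩ < μ₁)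
    (v : Fin d → ℝ) (hv : v ⬝ᵥ v = 1) (hvtop : (-matGrad f 0).mulVec v = μ₁ • v)
    (Winf : Matrix (Fin d) (Fin d) ℝ)
    (hlim : Tendsto (glrlTrajectory f L μ₁ v) atTop (𝓝 Winf))
    (hmem : Winf ∈ psdRankLE d 1) (hmin : IsMinOn f (psdRankLE d 1) Winf)
    (hstable : TangentStable f L Winf) :
    (∀ t : ℝ, Tendsto (fun α : ℝ => glrlApprox f L μ₁ v α t) (𝓝[>] 0)
      (𝓝 (glrlTrajectory f L μ₁ v t))) ∧
    (fun α : ℝ => ⨅ t : Set.Ici (0 : ℝ),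
      ‖flow f L (α • (1 : Matrix (Fin d) (Fin d) ℝ)) t - Winf‖) =O[𝓝[>] 0] (fun α : ℝ => α) := by
  exact tendsto_glrlApprox_and_isBigO hL hf hsym hflow hμ₁ hnorm hpos hgap hv hvtop hlim hmem hmin hstable
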